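/- Let $d\in\mathbb N$, let $E_1,E_2,E_3$ be complex Banach spaces and let $\bullet:E_1\times E_2\to E_3$ be a multiplication, i.e. a continuous bilinear map with $|x_1\bullet x_2|_{E_3}\le |x_1|_{E_1}|x_2|_{E_2}$. Write $\langle x\rangle=(1+|x|^2)^{1/2}$, $\hat f=\mathcal F f$ for the Fourier transform with kernel $e^{-2\pi i x\cdot\xi}$, and $\mathcal S'(\mathbb R^d,E)=\mathcal L(\mathcal S(\mathbb R^d),E)$. For $1\le p,q\le\infty$ and $r,s\in\mathbb R$ let - $L^q_s(\mathbb R^d,E)$ be the space of strongly measurable $u$ with $\|u\|_{L^q_s(E)}=\|\langle\cdot\rangle^s|u|_E\|_{L^q}<\infty$ (and $L^q_s(\mathbb R^d)=L^q_s(\mathbb R^d,\mathbb C)$); - $\mathcal FL^p_r(\mathbb R^d,E)$ be the space of $f\in\mathcal S'(\mathbb R^d,E)$ with $\|f\|_{\mathcal FL^p_r(E)}=\|\mathcal F^{-1}f\|_{L^p_r(E)}<\infty$; - $W^{p,q}_{r,s}(\mathbb R^d,E)$ be the space of $f\in\mathcal S'(\mathbb R^d,E)$ with $$\|f\|_{W^{p,q}_{r,s}}=\Big(\int_{\mathbb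 R^d}\Big(\int_{\mathbb R^d}|V_gf(x,\xi)|_E^p\langle\xi\rangle^{rp}\,d\xi\Big)^{q/p}\langle x\rangle^{sq}\,dx\Big)^{1/q}<\infty$$ (suprema if $p$ or $q$ is $\infty$) for some non-zero window $g\in\mathcal S(\mathbb R^d)$, where $V_gf(x,\xi)=\langle f,\,e^{2\pi i\xi\cdot(\,\cdot\,)}g(\cdot-x)\rangle$ is the short-time Fourier transform; different non-zero windows give equivalent norms. For $f_1\in\mathcal S'(\mathbb R^d,E_1)$, $f_2\in\mathcal S'(\mathbb R^d,E_2)$ the $\bullet$-convolution $f_1*_\bullet f_2$ is the limit in $\mathcal S'(\mathbb R^d,E_3)$, if it exists for all $\chi_1,\chi_2\in C_c^\infty(\mathbb R^d)$ equal to $1$ near $0$ and does not depend on them, of $(\chi_1(\cdot/n)f_1)*_\bullet(\chi_2(\cdot/n)f_2)$ as $n\to\infty$; the $\bullet$-convolution $a*_\bullet b$ of compactly supported distributions is the one with $\mathcal F(a*_\bullet b)=\hat a\bullet\hat b$ (pointwise). The convolution of two complex-valued functions is the usual integral, absolutely convergent almost everywhere. For such spaces, $X*_\bullet Y\hookrightarrow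 Z$ means that there is a constant $C$ such that for all $f\in X$, $g\in Y$ the convolution $f*_\bullet g$ exists, belongs to $Z$, and $\|f*_\bullet g\|_Z\le C\|f\|_X\|g\|_Y$. Let $1\le p_1,p_2,p_3,q_1,q_2,q_3\le\infty$ and $r_1,r_2,r_3,s_1,s_2,s_3\in\mathbb R$ be such that $$\mathcal FL^{p_1}_{r_1}(\mathbb R^d,E_1)*_\bullet\mathcal FL^{p_2}_{r_2}(\mathbb R^d,E_2)\hookrightarrow\mathcal FL^{p_3}_{r_3}(\mathbb R^d,E_3),\qquad L^{q_1}_{s_1}(\mathbb R^d)*L^{q_2}_{s_2}(\mathbb R^d)\hookrightarrow L^{q_3}_{s_3}(\mathbb R^d).$$ Then $$W^{p_1,q_1}_{r_1,s_1}(\mathbb R^d,E_1)*_\bullet W^{p_2,q_2}_{r_2,s_2}(\mathbb R^d,E_2)\hookrightarrow W^{p_3,q_3}_{r_3,s_3}(\mathbb R^d,E_3),$$ the norms of the three $W$-spaces being taken with arbitrary non-zero windows, on which $C$ may depend. -/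

import Mathlib

open MeasureTheory Filter Topology
open scoped SchwartzMap FourierTransform ENNReal NNReal ComplexConjugate

noncomputable section

namespace WienerAmalgam

/-- The Euclidean space `ℝᵈ`. -/
abbrev Rd (d : ℕ) : Type := EuclideanSpace ℝ (Fin d)

/-- The Japanese bracket `⟨x⟩ = (1 + |x|²)^{1/2}`. -/
def japaneseBracket {d : ℕ} (x : Rd d) : ℝ := Real.sqrt (1 + ‖x‖ ^ 2)

/-- The norm of `L^q_s(ℝᵈ)` of the modulus `F` of a function: `‖⟨·⟩^s F‖_{L^q}`, in `[0, ∞]`. -/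
def weightedLpNorm {d : ℕ} (q : ℝ≥0∞) (s : ℝ) (F : Rd d → ℝ≥0∞) : ℝ≥0∞ :=
  eLpNorm (fun x => ENNReal.ofReal (japaneseBracket x ^ s) * F x) q volume

/-- Membership in the weighted Lebesgue–Bochner space `L^q_s(ℝᵈ, E)`. -/
def MemWeightedLp {d : ℕ} {E : Type*} [NormedAddCommGroup E] (q : ℝ≥0∞) (s : ℝ)
    (u : Rd d → E) : Prop :=
  AEStronglyMeasurable u volume ∧ weightedLpNorm q s (fun x => ‖u x‖ₑ) < ∞

/-- The character `y ↦ e^{-2πi y·ξ}`. -/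
def character {d : ℕ} (ξ y : Rd d) : ℂ :=
  Complex.exp (-(2 * Real.pi * Complex.I * ((inner ℝ y ξ : ℝ) : ℂ)))

lemma hasTemperateGrowth_cexp (c : ℝ) :
    Function.HasTemperateGrowth (fun t : ℝ => Complex.exp (((c * t : ℝ) : ℂ) * Complex.I)) := by
  have key : ∀ n : ℕ, iteratedDeriv n (fun t : ℝ => Complex.exp (((c * t : ℝ) : ℂ) * Complex.I)) =
      fun t : ℝ => (c * Complex.I) ^ n * Complex.exp (((c * t : ℝ) : ℂ) * Complex.I) := by
    intro n
    induction n with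
    | zero => simp
    | succ n ih =>
      rw [iteratedDeriv_succ, ih]
      funext t
      have h1 : HasDerivAt (fun t : ℝ => ((c * t : ℝ) : ℂ) * Complex.I) (c * Complex.I) t := by
        have h0 : HasDerivAt (fun t : ℝ => ((c * t : ℝ) : ℂ)) ((c : ℝ) : ℂ) t := by
          have := ((hasDerivAt_id t).const_mul c).ofReal_comp
          simpa using this
        exact h0.mul_const _
      have h2 := (h1.cexp).const_mul ((c * Complex.I) ^ n)
      rw [h2.deriv]
      ring
  refine ⟨?_, ?_⟩
  · have : ContDiff ℝ ((⊤ : ℕ∞) : WithTop ℕ∞)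
        (fun t : ℝ => ((c * t : ℝ) : ℂ) * Complex.I) :=
      (Complex.ofRealCLM.contDiff.comp (contDiff_const.mul contDiff_id)).mul contDiff_const
    exact this.cexp
  · intro n
    refine ⟨0, |c| ^ n, fun t => ?_⟩
    rw [norm_iteratedFDeriv_eq_norm_iteratedDeriv, key n]
    simp [Complex.norm_exp]

lemma hasTemperateGrowth_character {d : ℕ} (ξ : Rd d) :
    Function.HasTemperateGrowth (character ξ) := by
  have h := (hasTemperateGrowth_cexp (-(2 * Real.pi))).comp
    (Function.hasTemperateGrowth_inner_left ξ)
  have e : character ξ = (fun t : ℝ => Complex.exp (((-(2 * Real.pi) * t : ℝ) : ℂ) * Complex.I)) ∘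
      fun y : Rd d => (inner ℝ y ξ : ℝ) := by
    funext y
    simp only [character, Function.comp]
    congr 1
    push_cast
    ring
  rw [e]
  exact h

/-- Multiplication of a Schwartz function by the character `y ↦ e^{-2πi y·ξ}`. -/
def charMul {d : ℕ} (ξ : Rd d) (φ : 𝓢(Rd d, ℂ)) : 𝓢(Rd d, ℂ) :=
  SchwartzMap.smulLeftCLM ℂ (character ξ) φ

lemma charMul_apply {d : ℕ} (ξ : Rd d) (φ : 𝓢(Rd d, ℂ)) (y : Rd d) :
    charMul ξ φ y = character ξ y * φ y := by
  simp [charMul, SchwartzMap.smulLeftCLM_apply_apply (hasTemperateGrowth_character ξ)]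

/-- The pointwise complex conjugate of a Schwartz function. -/
def conjSchwartz {d : ℕ} (φ : 𝓢(Rd d, ℂ)) : 𝓢(Rd d, ℂ) :=
  SchwartzMap.postcompCLM (Complex.conjCLE : ℂ →L[ℝ] ℂ) φ

lemma conjSchwartz_apply {d : ℕ} (φ : 𝓢(Rd d, ℂ)) (y : Rd d) :
    conjSchwartz φ y = conj (φ y) := rfl

/-- The short-time Fourier transform `V_g f(x, ξ) = ⟨f, M_ξ T_x g⟩`. The bracket is conjugate
linear in its second slot, Mathlib's distributions act linearly; so `f` is applied to the
conjugate `y ↦ e^{-2πi y·ξ} conj (g (y - x))` of `M_ξ T_x g`. -/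
def stft {d : ℕ} {E : Type*} [NormedAddCommGroup E] [NormedSpace ℂ E]
    (g : 𝓢(Rd d, ℂ)) (f : 𝓢'(Rd d, E)) (x ξ : Rd d) : E :=
  f (charMul ξ (conjSchwartz (SchwartzMap.compSubConstCLM ℂ x g)))

/-- The norm of `W^{p,q}_{r,s}(ℝᵈ, E)` with window `g`, in `[0, ∞]`:
the `L^q_s`-norm in `x` of the `L^p_r`-norm in `ξ` of `V_g f(x, ξ)`. -/
def amalgamNorm {d : ℕ} {E : Type*} [NormedAddCommGroup E] [NormedSpace ℂ E]
    (p q : ℝ≥0∞) (r s : ℝ) (g : 𝓢(Rd d, ℂ)) (f : 𝓢'(Rd d, E)) : ℝ≥0∞ :=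
  weightedLpNorm q s (fun x => weightedLpNorm p r (fun ξ => ‖stft g f x ξ‖ₑ))

/-- Membership in the Wiener amalgam space `W^{p,q}_{r,s}(ℝᵈ, E)`. -/
def MemAmalgam {d : ℕ} {E : Type*} [NormedAddCommGroup E] [NormedSpace ℂ E]
    (p q : ℝ≥0∞) (r s : ℝ) (f : 𝓢'(Rd d, E)) : Prop :=
  ∃ g : 𝓢(Rd d, ℂ), g ≠ 0 ∧ amalgamNorm p q r s g f < ∞

/-- The tempered distribution `T` is given by the function `u`. -/
def IsGivenBy {d : ℕ} {E : Type*} [NormedAddCommGroup E] [NormedSpace ℂ E]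
    (T : 𝓢'(Rd d, E)) (u : Rd d → E) : Prop :=
  AEStronglyMeasurable u volume ∧
    ∀ φ : 𝓢(Rd d, ℂ), Integrable (fun x => φ x • u x) volume ∧ T φ = ∫ x, φ x • u x

/-- The Fourier–Lebesgue norm `‖f‖_{𝓕L^p_r(E)} = ‖𝓕⁻¹ f‖_{L^p_r(E)}`; it is `∞` if `𝓕⁻¹ f` is not
a function, and otherwise all the functions `u` in the infimum agree almost everywhere. -/
def fourierLebesgueNorm {d : ℕ} {E : Type*} [NormedAddCommGroup E] [NormedSpace ℂ E]
    (p : ℝ≥0∞) (r : ℝ) (f : 𝓢'(Rd d, E)) : ℝ≥0∞ :=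
  ⨅ (u : Rd d → E) (_ : IsGivenBy (𝓕⁻ f) u), weightedLpNorm p r (fun ξ => ‖u ξ‖ₑ)

/-- Membership in the Fourier–Lebesgue space `𝓕L^p_r(ℝᵈ, E)`. -/
def MemFourierLebesgue {d : ℕ} {E : Type*} [NormedAddCommGroup E] [NormedSpace ℂ E]
    (p : ℝ≥0∞) (r : ℝ) (f : 𝓢'(Rd d, E)) : Prop :=
  fourierLebesgueNorm p r f < ∞

/-- A cutoff function: smooth, compactly supported, equal to `1` near the origin. -/
def IsCutoff {d : ℕ} (χ : 𝓢(Rd d, ℂ)) : Prop :=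
  HasCompactSupport χ ∧ ∀ᶠ x in 𝓝 (0 : Rd d), χ x = 1

/-- The dilate `x ↦ χ (x / (n + 1))`. -/
def dilate {d : ℕ} (χ : 𝓢(Rd d, ℂ)) (n : ℕ) : 𝓢(Rd d, ℂ) :=
  SchwartzMap.compCLMOfContinuousLinearEquiv ℂ
    (ContinuousLinearEquiv.smulLeft (Units.mk0 ((n + 1 : ℝ)⁻¹) (by positivity)) :
      Rd d ≃L[ℝ] Rd d) χ

lemma dilate_apply {d : ℕ} (χ : 𝓢(Rd d, ℂ)) (n : ℕ) (x : Rd d) :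
    dilate χ n x = χ ((n + 1 : ℝ)⁻¹ • x) := rfl

/-- For compactly supported `χ`, the Fourier transform of the compactly supported distribution
`χ f`, which is the function `ξ ↦ f (χ e^{-2πi ξ·})`. -/
def fourierOfTruncation {d : ℕ} {E : Type*} [NormedAddCommGroup E] [NormedSpace ℂ E]
    (χ : 𝓢(Rd d, ℂ)) (f : 𝓢'(Rd d, E)) (ξ : Rd d) : E :=
  f (charMul ξ χ)

/-- `h` is the `•`-convolution of the tempered distributions `f₁` and `f₂`: for all cutoff functions
`χ₁`, `χ₂`, the convolutions `(χ₁(·/n) f₁) *_• (χ₂(·/n) f₂)` of the truncated (hence compactly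
supported) distributions converge to `h` in `𝓢'(ℝᵈ, E₃)`. This is written on the Fourier side, where
the convolution of two compactly supported distributions is the pointwise `•`-product of their
Fourier transforms, which are smooth functions of polynomial growth. -/
def IsConvolution {d : ℕ} {E₁ E₂ E₃ : Type*}
    [NormedAddCommGroup E₁] [NormedSpace ℂ E₁] [NormedAddCommGroup E₂] [NormedSpace ℂ E₂]
    [NormedAddCommGroup E₃] [NormedSpace ℂ E₃] (B : E₁ →L[ℂ] E₂ →L[ℂ] E₃)
    (f₁ : 𝓢'(Rd d, E₁)) (f₂ : 𝓢'(Rd d, E₂)) (h : 𝓢'(Rd d, E₃)) : Prop :=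
  ∀ χ₁ χ₂ : 𝓢(Rd d, ℂ), IsCutoff χ₁ → IsCutoff χ₂ → ∀ φ : 𝓢(Rd d, ℂ),
    Tendsto (fun n : ℕ => ∫ ξ, φ ξ • B (fourierOfTruncation (dilate χ₁ n) f₁ ξ)
      (fourierOfTruncation (dilate χ₂ n) f₂ ξ)) atTop (𝓝 ((𝓕 h) φ))

/-- `𝓕L^{p₁}_{r₁}(E₁) *_• 𝓕L^{p₂}_{r₂}(E₂) ↪ 𝓕L^{p₃}_{r₃}(E₃)`. -/
def FourierLebesgueConvEmbeds (d : ℕ) {E₁ E₂ E₃ : Type*}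
    [NormedAddCommGroup E₁] [NormedSpace ℂ E₁] [NormedAddCommGroup E₂] [NormedSpace ℂ E₂]
    [NormedAddCommGroup E₃] [NormedSpace ℂ E₃] (B : E₁ →L[ℂ] E₂ →L[ℂ] E₃)
    (p₁ p₂ p₃ : ℝ≥0∞) (r₁ r₂ r₃ : ℝ) : Prop :=
  ∃ C : ℝ≥0, ∀ (f₁ : 𝓢'(Rd d, E₁)) (f₂ : 𝓢'(Rd d, E₂)),
    MemFourierLebesgue p₁ r₁ f₁ → MemFourierLebesgue p₂ r₂ f₂ →
    ∃ h : 𝓢'(Rd d, E₃), IsConvolution B f₁ f₂ h ∧ MemFourierLebesgue p₃ r₃ h ∧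
      fourierLebesgueNorm p₃ r₃ h ≤
        C * fourierLebesgueNorm p₁ r₁ f₁ * fourierLebesgueNorm p₂ r₂ f₂

/-- `L^{q₁}_{s₁}(ℝᵈ) * L^{q₂}_{s₂}(ℝᵈ) ↪ L^{q₃}_{s₃}(ℝᵈ)`, for complex-valued functions and the
convolution integral, which has to converge absolutely almost everywhere. -/
def LebesgueConvEmbeds (d : ℕ) (q₁ q₂ q₃ : ℝ≥0∞) (s₁ s₂ s₃ : ℝ) : Prop :=
  ∃ C : ℝ≥0, ∀ u v : Rd d → ℂ, MemWeightedLp q₁ s₁ u → MemWeightedLp q₂ s₂ v →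
    (∀ᵐ x, ConvolutionExistsAt u v x (ContinuousLinearMap.mul ℂ ℂ) volume) ∧
    MemWeightedLp q₃ s₃ (convolution u v (ContinuousLinearMap.mul ℂ ℂ) volume) ∧
    weightedLpNorm q₃ s₃ (fun x => ‖convolution u v (ContinuousLinearMap.mul ℂ ℂ) volume x‖ₑ) ≤
      C * weightedLpNorm q₁ s₁ (fun x => ‖u x‖ₑ) * weightedLpNorm q₂ s₂ (fun x => ‖v x‖ₑ)

/-- `W^{p₁,q₁}_{r₁,s₁}(E₁) *_• W^{p₂,q₂}_{r₂,s₂}(E₂) ↪ W^{p₃,q₃}_{r₃,s₃}(E₃)`, the three norms being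
taken with any non-zero windows `g₁`, `g₂`, `g₃`, on which the constant may depend. -/
def AmalgamConvEmbeds (d : ℕ) {E₁ E₂ E₃ : Type*}
    [NormedAddCommGroup E₁] [NormedSpace ℂ E₁] [NormedAddCommGroup E₂] [NormedSpace ℂ E₂]
    [NormedAddCommGroup E₃] [NormedSpace ℂ E₃] (B : E₁ →L[ℂ] E₂ →L[ℂ] E₃)
    (p₁ p₂ p₃ q₁ q₂ q₃ : ℝ≥0∞) (r₁ r₂ r₃ s₁ s₂ s₃ : ℝ) : Prop :=
  ∀ g₁ g₂ g₃ : 𝓢(Rd d, ℂ), g₁ ≠ 0 → g₂ ≠ 0 → g₃ ≠ 0 →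
    ∃ C : ℝ≥0, ∀ (f₁ : 𝓢'(Rd d, E₁)) (f₂ : 𝓢'(Rd d, E₂)),
      MemAmalgam p₁ q₁ r₁ s₁ f₁ → MemAmalgam p₂ q₂ r₂ s₂ f₂ →
      ∃ h : 𝓢'(Rd d, E₃), IsConvolution B f₁ f₂ h ∧ MemAmalgam p₃ q₃ r₃ s₃ h ∧
        amalgamNorm p₃ q₃ r₃ s₃ g₃ h ≤
          C * amalgamNorm p₁ q₁ r₁ s₁ g₁ f₁ * amalgamNorm p₂ q₂ r₂ s₂ g₂ f₂

end WienerAmalgam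

end

/-!
Fix a compactly supported `ψ` with `∫ ψ = 1`. Since `f = ∫ ψ(· - x) f dx`, the convolution of `f₁`
and `f₂` is the superposition over `(x, y)` of the convolutions of the pieces `ψ(· - x) f₁` and
`ψ(· - y) f₂`. The local embedding bounds the `𝓕L^{p₃}_{r₃}` norm of each of these by
`A₁ x * A₂ y`, where `Aᵢ` denotes the `𝓕L^{pᵢ}_{rᵢ}` norm of the piece of `fᵢ`, and by Minkowski's
inequality the bounds add up. The convolution of two pieces is supported near `x + y`, so that it
contributes to the local norm at `z` with a factor `⟨z - (x + y)⟩^{-N}` for any `N`. Hence the local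
norms of the convolution are bounded by `⟨·⟩^{-N} * A₁ * A₂`, to which the global embedding applies,
convolution with `⟨·⟩^{-N}` being bounded on `L^{q₃}_{s₃}` for large `N`. The same estimates hold
for truncated distributions uniformly in the truncation, so that dominated convergence gives the
limit which defines the convolution. A change of window, finally, costs a convolution of the local
norms with some `⟨·⟩^{-N}`.
-/

noncomputable section

namespace WienerAmalgam

/-! ### Minkowski's integral inequality -/

section Minkowski

variable {X Y : Type*} [MeasurableSpace X] [MeasurableSpace Y]

lemma measurable_eLpNormEssSup_left {ν : Measure Y} [SFinite ν] {F : X → Y → ℝ≥0∞}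
    (hF : Measurable (Function.uncurry F)) : Measurable fun x => eLpNormEssSup (F x) ν := by
  refine measurable_of_Iic fun c => ?_
  have hIic : (fun x => eLpNormEssSup (F x) ν) ⁻¹' Set.Iic c =
      {x | ν (Prod.mk x ⁻¹' {z : X × Y | c < F z.1 z.2}) = 0} := by
    ext x
    have hae : eLpNormEssSup (F x) ν ≤ c ↔ ∀ᵐ y ∂ν, F x y ≤ c :=
      ⟨fun h => (ENNReal.ae_le_essSup (F x)).mono fun y hy => hy.trans h,
        fun h => essSup_le_of_ae_le c h⟩
    rw [ae_iff] at hae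
    simp only [not_le] at hae
    exact hae
  rw [hIic]
  exact measurable_measure_prodMk_left (measurableSet_lt measurable_const hF)
    (measurableSet_singleton 0)

lemma measurable_eLpNorm_left {ν : Measure Y} [SFinite ν] {F : X → Y → ℝ≥0∞}
    (hF : Measurable (Function.uncurry F)) (p : ℝ≥0∞) :
    Measurable fun x => eLpNorm (F x) p ν := by
  rcases eq_or_ne p 0 with rfl | h0
  · simp
  rcases eq_or_ne p ∞ with rfl | ht
  · simpa only [eLpNorm_exponent_top] using measurable_eLpNormEssSup_left hF
  · simp only [eLpNorm_eq_lintegral_rpow_enorm_toReal h0 ht, enorm_eq_self]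
    exact ((hF.pow_const p.toReal).lintegral_prod_right' (ν := ν)).pow_const _

/-- Jensen's inequality for the measure with density `a`, applied to the function `F / a`. -/
lemma lintegral_rpow_le_mul_lintegral_rpow {μ : Measure X} {F a : X → ℝ≥0∞} (hF : Measurable F)
    (ha : Measurable a) (ha0 : ∀ x, a x ≠ 0) (haμ : ∫⁻ x, a x ∂μ ≠ ∞) {P : ℝ} (hP : 1 ≤ P) :
    (∫⁻ x, F x ∂μ) ^ P ≤
      (∫⁻ x, a x ∂μ) ^ (P - 1) * ∫⁻ x, F x ^ P * a x ^ (1 - P) ∂μ := by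
  have hP0 : 0 < P := zero_lt_one.trans_le hP
  have hfin : ∀ᵐ x ∂μ, a x ≠ ∞ := (ae_lt_top ha haμ).mono fun x hx => hx.ne
  have hdiv (x : X) (hx : a x ≠ ∞) : a x * (F x / a x) = F x :=
    ENNReal.mul_div_cancel (ha0 x) hx
  have hdiv_rpow (x : X) (hx : a x ≠ ∞) : a x * (F x / a x) ^ P = F x ^ P * a x ^ (1 - P) := by
    rw [div_eq_mul_inv, ENNReal.mul_rpow_of_nonneg _ _ hP0.le, ← ENNReal.rpow_neg_one,
      ← ENNReal.rpow_mul, sub_eq_add_neg, ENNReal.rpow_add _ _ (ha0 x) hx, ENNReal.rpow_one,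
      neg_one_mul]
    ring
  have hjensen := eLpNorm'_le_eLpNorm'_mul_rpow_measure_univ zero_lt_one hP
    (μ := μ.withDensity a) (hF.div ha).aestronglyMeasurable
  simp only [eLpNorm', enorm_eq_self, ENNReal.rpow_one, div_one,
    withDensity_apply a MeasurableSet.univ, Measure.restrict_univ] at hjensen
  rw [lintegral_withDensity_eq_lintegral_mul μ ha (hF.div ha),
    lintegral_withDensity_eq_lintegral_mul μ ha ((hF.div ha).pow_const P)] at hjensen
  simp only [Pi.mul_apply, Pi.div_apply] at hjensen
  rw [lintegral_congr_ae (hfin.mono hdiv), lintegral_congr_ae (hfin.mono hdiv_rpow)] at hjensen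
  refine (ENNReal.rpow_le_rpow hjensen hP0.le).trans_eq ?_
  rw [ENNReal.mul_rpow_of_nonneg _ _ hP0.le, ← ENNReal.rpow_mul, ← ENNReal.rpow_mul,
    one_div_mul_cancel hP0.ne', ENNReal.rpow_one, mul_comm]
  congr 2
  field_simp

lemma eLpNormEssSup_lintegral_le {μ : Measure X} {ν : Measure Y} [SFinite μ] [SFinite ν]
    {F : X → Y → ℝ≥0∞} (hF : Measurable (Function.uncurry F)) :
    eLpNormEssSup (fun y => ∫⁻ x, F x y ∂μ) ν ≤ ∫⁻ x, eLpNormEssSup (F x) ν ∂μ := by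
  have hle : ∀ᵐ x ∂μ, ∀ᵐ y ∂ν, F x y ≤ eLpNormEssSup (F x) ν :=
    Eventually.of_forall fun x => ENNReal.ae_le_essSup (F x)
  have hswap := (Measure.ae_ae_comm (p := fun x y => F x y ≤ eLpNormEssSup (F x) ν)
    (measurableSet_le hF ((measurable_eLpNormEssSup_left hF).comp measurable_fst))).1 hle
  exact essSup_le_of_ae_le _ (hswap.mono fun y hy => lintegral_mono_ae hy)

lemma lintegral_rpow_lintegral_le {μ : Measure X} {ν : Measure Y} [SFinite μ] [SFinite ν]
    {F : X → Y → ℝ≥0∞} (hF : Measurable (Function.uncurry F)) {a : X → ℝ≥0∞} (ha : Measurable a)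
    (ha0 : ∀ x, a x ≠ 0) {P : ℝ} (hP : 1 ≤ P) (hFa : ∀ x, ∫⁻ y, F x y ^ P ∂ν ≤ a x ^ P) :
    ∫⁻ y, (∫⁻ x, F x y ∂μ) ^ P ∂ν ≤ (∫⁻ x, a x ∂μ) ^ P := by
  have hP0 : 0 < P := zero_lt_one.trans_le hP
  rcases eq_or_ne (∫⁻ x, a x ∂μ) ∞ with hR | hR
  · rw [hR, ENNReal.top_rpow_of_pos hP0]
    exact le_top
  have hfin : ∀ᵐ x ∂μ, a x ≠ ∞ := (ae_lt_top ha hR).mono fun x hx => hx.ne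
  set R := ∫⁻ x, a x ∂μ
  calc ∫⁻ y, (∫⁻ x, F x y ∂μ) ^ P ∂ν
      ≤ ∫⁻ y, R ^ (P - 1) * ∫⁻ x, F x y ^ P * a x ^ (1 - P) ∂μ ∂ν :=
        lintegral_mono fun y => lintegral_rpow_le_mul_lintegral_rpow
          hF.of_uncurry_right ha ha0 hR hP
    _ = R ^ (P - 1) * ∫⁻ x, (∫⁻ y, F x y ^ P ∂ν) * a x ^ (1 - P) ∂μ := by
        rw [lintegral_const_mul' _ _ (ENNReal.rpow_ne_top_of_nonneg (sub_nonneg.2 hP) hR),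
          lintegral_lintegral_swap (((hF.comp measurable_swap).pow_const _).mul
            ((ha.pow_const _).comp measurable_snd)).aemeasurable]
        simp only [lintegral_mul_const _ (hF.of_uncurry_left.pow_const P)]
    _ ≤ R ^ (P - 1) * ∫⁻ x, a x ∂μ := by
        gcongr 1
        refine lintegral_mono_ae (hfin.mono fun x hx => ?_)
        refine (mul_le_mul_left (hFa x) _).trans_eq ?_
        rw [← ENNReal.rpow_add _ _ (ha0 x) hx, add_sub_cancel, ENNReal.rpow_one]
    _ = R ^ P := by
        conv_lhs => rw [← ENNReal.rpow_one (∫⁻ x, a x ∂μ)]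
        rw [← ENNReal.rpow_add_of_nonneg _ _ (sub_nonneg.2 hP) zero_le_one, sub_add_cancel]

theorem eLpNorm_lintegral_le {μ : Measure X} {ν : Measure Y} [SigmaFinite μ] [SFinite ν]
    {F : X → Y → ℝ≥0∞} (hF : Measurable (Function.uncurry F)) {p : ℝ≥0∞} (hp : 1 ≤ p) :
    eLpNorm (fun y => ∫⁻ x, F x y ∂μ) p ν ≤ ∫⁻ x, eLpNorm (F x) p ν ∂μ := by
  rcases eq_or_ne p ∞ with rfl | ht
  · simpa only [eLpNorm_exponent_top] using eLpNormEssSup_lintegral_le hF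
  have hp0 : p ≠ 0 := (zero_lt_one.trans_le hp).ne'
  have hP : 1 ≤ p.toReal := by
    simpa using ENNReal.toReal_mono ht hp
  have hP0 : 0 < p.toReal := zero_lt_one.trans_le hP
  have hm := measurable_eLpNorm_left (ν := ν) hF p
  -- The lemma above needs positive bounds: perturb `x ↦ ‖F x‖ₚ` by a positive integrable `b`.
  refine ENNReal.le_of_forall_pos_le_add fun ε hε _ => ?_
  obtain ⟨b, hb0, hbm, hb⟩ := exists_pos_lintegral_lt_of_sigmaFinite μ
    (ENNReal.coe_ne_zero.2 hε.ne')
  have hbound (x : X) : ∫⁻ y, F x y ^ p.toReal ∂ν ≤ (eLpNorm (F x) p ν + b x) ^ p.toReal := by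
    rw [← ENNReal.rpow_inv_le_iff hP0, ← one_div]
    simpa only [eLpNorm_eq_lintegral_rpow_enorm_toReal hp0 ht, enorm_eq_self] using
      le_self_add (a := eLpNorm (F x) p ν)
  calc eLpNorm (fun y => ∫⁻ x, F x y ∂μ) p ν
      = (∫⁻ y, (∫⁻ x, F x y ∂μ) ^ p.toReal ∂ν) ^ (1 / p.toReal) := by
        simp only [eLpNorm_eq_lintegral_rpow_enorm_toReal hp0 ht, enorm_eq_self]
    _ ≤ ∫⁻ x, (eLpNorm (F x) p ν + b x) ∂μ := by
        rw [one_div, ENNReal.rpow_inv_le_iff hP0]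
        exact lintegral_rpow_lintegral_le hF (hm.add hbm.coe_nnreal_ennreal)
          (fun x => by simp [(hb0 x).ne']) hP hbound
    _ ≤ ∫⁻ x, eLpNorm (F x) p ν ∂μ + ε := by
        rw [lintegral_add_left hm]
        gcongr

end Minkowski

/-! ### Polynomial weights -/

section Weights

variable {d : ℕ}

lemma one_le_japaneseBracket (x : Rd d) : 1 ≤ japaneseBracket x := by
  rw [japaneseBracket, Real.one_le_sqrt]
  nlinarith [sq_nonneg ‖x‖]

lemma japaneseBracket_pos (x : Rd d) : 0 < japaneseBracket x :=
  zero_lt_one.trans_le (one_le_japaneseBracket x)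

lemma japaneseBracket_le_one_add_norm (x : Rd d) : japaneseBracket x ≤ 1 + ‖x‖ :=
  Real.sqrt_le_iff.2 ⟨by positivity, by nlinarith [norm_nonneg x]⟩

lemma continuous_japaneseBracket : Continuous (japaneseBracket (d := d)) := by
  unfold japaneseBracket; fun_prop

lemma japaneseBracket_neg (x : Rd d) : japaneseBracket (-x) = japaneseBracket x := by
  simp [japaneseBracket]

lemma japaneseBracket_add_le (x y : Rd d) :
    japaneseBracket (x + y) ≤ 2 * japaneseBracket x * japaneseBracket y := by
  have hx := Real.sq_sqrt (show 0 ≤ 1 + ‖x‖ ^ 2 by positivity)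
  have hy := Real.sq_sqrt (show 0 ≤ 1 + ‖y‖ ^ 2 by positivity)
  refine (Real.sqrt_le_left (by positivity [japaneseBracket_pos x, japaneseBracket_pos y])).2 ?_
  rw [mul_pow, mul_pow]
  simp only [japaneseBracket, hx, hy]
  nlinarith [norm_add_le x y, norm_nonneg (x + y), sq_nonneg (‖x‖ - ‖y‖), sq_nonneg (‖x‖ * ‖y‖),
    norm_nonneg x, norm_nonneg y, sq_nonneg ‖x‖, sq_nonneg ‖y‖]

/-- The weight `⟨x⟩^s` of `weightedLpNorm`, with values in `[0, ∞]`. -/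
def weight (s : ℝ) (x : Rd d) : ℝ≥0∞ := ENNReal.ofReal (japaneseBracket x ^ s)

lemma weight_ne_top (s : ℝ) (x : Rd d) : weight s x ≠ ∞ := ENNReal.ofReal_ne_top

lemma weight_ne_zero (s : ℝ) (x : Rd d) : weight s x ≠ 0 := by
  have := Real.rpow_pos_of_pos (japaneseBracket_pos x) s
  simpa [weight] using this

lemma weight_add (s t : ℝ) (x : Rd d) : weight (s + t) x = weight s x * weight t x := by
  rw [weight, Real.rpow_add (japaneseBracket_pos x),
    ENNReal.ofReal_mul (Real.rpow_nonneg (japaneseBracket_pos x).le _)]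
  rfl

@[simp] lemma weight_zero (x : Rd d) : weight 0 x = 1 := by simp [weight]

lemma weight_neg_arg (s : ℝ) (x : Rd d) : weight s (-x) = weight s x := by
  simp [weight, japaneseBracket_neg]

lemma weight_sub_comm (s : ℝ) (x y : Rd d) : weight s (x - y) = weight s (y - x) := by
  rw [← weight_neg_arg, neg_sub]

lemma weight_mono {s t : ℝ} (h : s ≤ t) (x : Rd d) : weight s x ≤ weight t x :=
  ENNReal.ofReal_le_ofReal (Real.rpow_le_rpow_of_exponent_le (one_le_japaneseBracket x) h)

lemma continuous_weight (s : ℝ) : Continuous (weight s : Rd d → ℝ≥0∞) :=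
  ENNReal.continuous_ofReal.comp
    (continuous_japaneseBracket.rpow_const fun x => Or.inl (japaneseBracket_pos x).ne')

@[fun_prop]
lemma measurable_weight (s : ℝ) : Measurable (weight s : Rd d → ℝ≥0∞) :=
  (continuous_weight s).measurable

lemma japaneseBracket_add_rpow_le (s : ℝ) (x y : Rd d) :
    japaneseBracket (x + y) ^ s ≤ 2 ^ |s| * japaneseBracket x ^ |s| * japaneseBracket y ^ s := by
  have hx := japaneseBracket_pos x
  have hy := japaneseBracket_pos y
  have hxy := japaneseBracket_pos (x + y)
  rw [← Real.mul_rpow two_pos.le hx.le]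
  rcases le_total 0 s with hs | hs
  · rw [abs_of_nonneg hs, ← Real.mul_rpow (by positivity) hy.le]
    exact Real.rpow_le_rpow hxy.le (japaneseBracket_add_le x y) hs
  · have hle : japaneseBracket y ≤ 2 * japaneseBracket x * japaneseBracket (x + y) := by
      simpa [japaneseBracket_neg] using japaneseBracket_add_le (-x) (x + y)
    have hrpow := Real.rpow_le_rpow_of_nonpos hy hle hs
    rwa [Real.mul_rpow (by positivity) hxy.le, ← le_inv_mul_iff₀ (by positivity),
      ← Real.rpow_neg (by positivity), ← abs_of_nonpos hs] at hrpow

lemma weight_add_le (s : ℝ) (x y : Rd d) :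
    weight s (x + y) ≤ ENNReal.ofReal (2 ^ |s|) * weight |s| x * weight s y := by
  have hx := japaneseBracket_pos x
  rw [weight, weight, weight, ← ENNReal.ofReal_mul (by positivity),
    ← ENNReal.ofReal_mul (by positivity)]
  exact ENNReal.ofReal_le_ofReal (japaneseBracket_add_rpow_le s x y)

lemma lintegral_weight_neg_lt_top {s : ℝ} (hs : d < s) : ∫⁻ x : Rd d, weight (-s) x < ∞ := by
  have hint := integrable_rpow_neg_one_add_norm_sq (E := Rd d) (μ := volume) (r := s)
    (by simpa using hs)
  refine lt_of_eq_of_lt (lintegral_congr fun x => ?_) hint.lintegral_lt_top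
  rw [weight, japaneseBracket, Real.sqrt_eq_rpow, ← Real.rpow_mul (by positivity)]
  congr 2
  ring

lemma ofReal_le_mul_weight {a c : ℝ} (ha : 0 ≤ a) {x : Rd d} {N : ℕ}
    (h : (1 + ‖x‖) ^ N * a ≤ c) : ENNReal.ofReal a ≤ ENNReal.ofReal c * weight (-(N : ℝ)) x := by
  have hpos := japaneseBracket_pos x
  have hc : 0 ≤ c := le_trans (by positivity) h
  rw [weight, ← ENNReal.ofReal_mul hc, Real.rpow_neg hpos.le, Real.rpow_natCast]
  refine ENNReal.ofReal_le_ofReal ((le_div_iff₀' (by positivity)).2 (le_trans ?_ h))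
  gcongr
  exact japaneseBracket_le_one_add_norm x

lemma weightedLpNorm_eq (q : ℝ≥0∞) (s : ℝ) (F : Rd d → ℝ≥0∞) :
    weightedLpNorm q s F = eLpNorm (fun x => weight s x * F x) q volume := rfl

lemma weightedLpNorm_mono_ae {q : ℝ≥0∞} {s : ℝ} {F G : Rd d → ℝ≥0∞} (h : ∀ᵐ x, F x ≤ G x) :
    weightedLpNorm q s F ≤ weightedLpNorm q s G := by
  refine eLpNorm_mono_enorm_ae (h.mono fun x hx => ?_)
  simp only [enorm_eq_self]
  gcongr

lemma weightedLpNorm_mono {q : ℝ≥0∞} {s : ℝ} {F G : Rd d → ℝ≥0∞} (h : ∀ x, F x ≤ G x) :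
    weightedLpNorm q s F ≤ weightedLpNorm q s G :=
  weightedLpNorm_mono_ae (Eventually.of_forall h)

lemma weightedLpNorm_congr_ae {q : ℝ≥0∞} {s : ℝ} {F G : Rd d → ℝ≥0∞} (h : ∀ᵐ x, F x = G x) :
    weightedLpNorm q s F = weightedLpNorm q s G :=
  le_antisymm (weightedLpNorm_mono_ae (h.mono fun _ hx => hx.le))
    (weightedLpNorm_mono_ae (h.mono fun _ hx => hx.ge))

lemma weightedLpNorm_const_mul_le (q : ℝ≥0∞) (s : ℝ) (F : Rd d → ℝ≥0∞) {c : ℝ≥0∞}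
    (hc : c ≠ ∞) : weightedLpNorm q s (fun x => c * F x) ≤ c * weightedLpNorm q s F := by
  lift c to ℝ≥0 using hc
  refine (eLpNorm_le_nnreal_smul_eLpNorm_of_ae_le_mul' (f := fun x => weight s x * (c * F x))
    (g := fun x => weight s x * F x) (c := c) (Eventually.of_forall fun x => ?_) q)
  exact (mul_left_comm _ _ _).le

lemma weightedLpNorm_lintegral_le {X : Type*} [MeasurableSpace X] {μ : Measure X} [SigmaFinite μ]
    {p : ℝ≥0∞} (hp : 1 ≤ p) (r : ℝ) {F : X → Rd d → ℝ≥0∞} (hF : Measurable (Function.uncurry F)) :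
    weightedLpNorm p r (fun ξ => ∫⁻ x, F x ξ ∂μ) ≤ ∫⁻ x, weightedLpNorm p r (F x) ∂μ := by
  have hG : Measurable (Function.uncurry fun x ξ => weight r ξ * F x ξ) :=
    ((measurable_weight r).comp measurable_snd).mul hF
  simpa only [weightedLpNorm_eq, lintegral_const_mul' _ _ (weight_ne_top r _)] using
    eLpNorm_lintegral_le (ν := (volume : Measure (Rd d))) (μ := μ) hG hp

lemma measurable_weightedLpNorm_left {X : Type*} [MeasurableSpace X] (p : ℝ≥0∞) (r : ℝ)
    {F : X → Rd d → ℝ≥0∞} (hF : Measurable (Function.uncurry F)) :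
    Measurable fun x => weightedLpNorm p r (F x) :=
  measurable_eLpNorm_left (F := fun x ξ => weight r ξ * F x ξ)
    (((measurable_weight r).comp measurable_snd).mul hF) p

lemma weightedLpNorm_comp_sub_le (p : ℝ≥0∞) (r : ℝ) {F : Rd d → ℝ≥0∞} (hF : Measurable F)
    (η : Rd d) : weightedLpNorm p r (fun ξ => F (ξ - η)) ≤
      ENNReal.ofReal (2 ^ |r|) * weight |r| η * weightedLpNorm p r F := by
  obtain ⟨c, hc⟩ : ∃ c : ℝ≥0, c = ENNReal.ofReal (2 ^ |r|) * weight |r| η :=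
    ⟨_, ENNReal.coe_toNNReal (ENNReal.mul_ne_top ENNReal.ofReal_ne_top (weight_ne_top _ _))⟩
  rw [← hc]
  calc weightedLpNorm p r (fun ξ => F (ξ - η))
      ≤ c * eLpNorm (fun ξ => weight r (ξ - η) * F (ξ - η)) p volume := by
        refine eLpNorm_le_nnreal_smul_eLpNorm_of_ae_le_mul' (Eventually.of_forall fun ξ => ?_) p
        simp only [enorm_eq_self]
        rw [hc, ← mul_assoc]
        have hadd := weight_add_le r η (ξ - η)
        rw [add_sub_cancel] at hadd
        exact mul_le_mul_left hadd _
    _ = c * weightedLpNorm p r F := by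
        congr 1
        exact eLpNorm_comp_measurePreserving (g := fun ξ => weight r ξ * F ξ)
          ((measurable_weight r).mul hF).aestronglyMeasurable
          (measurePreserving_sub_right volume η)

lemma weightedLpNorm_comp_neg (p : ℝ≥0∞) (r : ℝ) {F : Rd d → ℝ≥0∞} (hF : AEMeasurable F) :
    weightedLpNorm p r (fun ξ => F (-ξ)) = weightedLpNorm p r F := by
  simpa only [Function.comp_def, weight_neg_arg, weightedLpNorm_eq] using
    eLpNorm_comp_measurePreserving (p := p) (g := fun ξ => weight r ξ * F ξ)
      ((measurable_weight r).aemeasurable.mul hF).aestronglyMeasurable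
      (Measure.measurePreserving_neg (volume : Measure (Rd d)))

lemma exists_weightedLpNorm_conv_weight_le {p : ℝ≥0∞} (hp : 1 ≤ p) (r : ℝ) {m : ℝ}
    (hm : d + |r| < m) : ∃ C : ℝ≥0, ∀ F : Rd d → ℝ≥0∞, Measurable F →
      weightedLpNorm p r (fun ξ => ∫⁻ η, weight (-m) (ξ - η) * F η) ≤ C * weightedLpNorm p r F := by
  obtain ⟨C, hC⟩ : ∃ C : ℝ≥0,
      C = ∫⁻ η : Rd d, weight (-m) η * (ENNReal.ofReal (2 ^ |r|) * weight |r| η) := by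
    refine ⟨_, ENNReal.coe_toNNReal ?_⟩
    simp_rw [mul_left_comm (weight (-m) _), ← weight_add, show -m + |r| = -(m - |r|) by ring]
    rw [lintegral_const_mul' _ _ ENNReal.ofReal_ne_top]
    exact ENNReal.mul_ne_top ENNReal.ofReal_ne_top (lintegral_weight_neg_lt_top (by linarith)).ne
  refine ⟨C, fun F hF => ?_⟩
  have hswap (ξ : Rd d) :
      ∫⁻ η, weight (-m) (ξ - η) * F η = ∫⁻ η, weight (-m) η * F (ξ - η) := by
    rw [← lintegral_sub_left_eq_self _ ξ]
    simp only [sub_sub_cancel]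
  simp_rw [hswap]
  calc weightedLpNorm p r (fun ξ => ∫⁻ η, weight (-m) η * F (ξ - η))
      ≤ ∫⁻ η, weightedLpNorm p r (fun ξ => weight (-m) η * F (ξ - η)) :=
        weightedLpNorm_lintegral_le hp r (((measurable_weight _).comp measurable_fst).mul
          (hF.comp (measurable_snd.sub measurable_fst)))
    _ ≤ ∫⁻ η, weight (-m) η * (ENNReal.ofReal (2 ^ |r|) * weight |r| η) * weightedLpNorm p r F :=
        lintegral_mono fun η => by
          rw [mul_assoc]
          exact (weightedLpNorm_const_mul_le p r _ (weight_ne_top _ _)).trans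
            (mul_le_mul_right (weightedLpNorm_comp_sub_le p r hF η) _)
    _ = C * weightedLpNorm p r F := by rw [lintegral_mul_const _ (by fun_prop), hC]

/-- Hölder's inequality `L^p_r ⊆ L^1_{-m}`, in the form of Jensen's inequality for the finite
measure with density `⟨·⟩^{-(m + r)} ≤ 1`. -/
lemma exists_lintegral_weight_mul_le {p : ℝ≥0∞} (hp : 1 ≤ p) {r m : ℝ} (hm : d < m + r) :
    ∃ C : ℝ≥0, ∀ F : Rd d → ℝ≥0∞, Measurable F →
      ∫⁻ ξ, weight (-m) ξ * F ξ ≤ C * weightedLpNorm p r F := by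
  set ν : Measure (Rd d) := volume.withDensity (weight (-(m + r)))
  have hν : ν ≤ volume := by
    refine (withDensity_mono (Eventually.of_forall fun x => ?_)).trans_eq withDensity_one
    have hneg : -(m + r) ≤ 0 := by linarith [Nat.cast_nonneg (α := ℝ) d]
    simpa using weight_mono hneg x
  have hν_univ : ν Set.univ ≠ ∞ := by
    rw [withDensity_apply _ MeasurableSet.univ, Measure.restrict_univ]
    exact (lintegral_weight_neg_lt_top hm).ne
  obtain ⟨C, hC⟩ : ∃ C : ℝ≥0, C = ν Set.univ ^ (1 / (1 : ℝ≥0∞).toReal - 1 / p.toReal) := by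
    refine ⟨_, ENNReal.coe_toNNReal (ENNReal.rpow_ne_top_of_nonneg ?_ hν_univ)⟩
    rcases eq_or_ne p ∞ with rfl | ht
    · simp
    · have : 1 ≤ p.toReal := by simpa using ENNReal.toReal_mono ht hp
      simpa using inv_le_one_of_one_le₀ this
  refine ⟨C, fun F hF => ?_⟩
  have hm' : Measurable fun ξ => weight r ξ * F ξ := (measurable_weight r).mul hF
  calc ∫⁻ ξ, weight (-m) ξ * F ξ = eLpNorm (fun ξ => weight r ξ * F ξ) 1 ν := by
        rw [eLpNorm_one_eq_lintegral_enorm,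
          lintegral_withDensity_eq_lintegral_mul _ (measurable_weight _) hm'.enorm]
        refine lintegral_congr fun ξ => ?_
        rw [Pi.mul_apply, enorm_eq_self, ← mul_assoc, ← weight_add, neg_add, neg_add_cancel_right]
    _ ≤ eLpNorm (fun ξ => weight r ξ * F ξ) p ν * C := by
        rw [hC]
        exact eLpNorm_le_eLpNorm_mul_rpow_measure_univ hp hm'.aestronglyMeasurable
    _ ≤ C * weightedLpNorm p r F := by
        rw [mul_comm]
        exact mul_le_mul_right (eLpNorm_mono_measure _ hν) _

end Weights

/-! ### Schwartz functions: seminorms, translations, products -/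

section Schwartz

variable {V F E : Type*} [NormedAddCommGroup V]

lemma one_add_norm_add_le (x y : V) : 1 + ‖x + y‖ ≤ (1 + ‖x‖) * (1 + ‖y‖) := by
  nlinarith [norm_add_le x y, mul_nonneg (norm_nonneg x) (norm_nonneg y)]

lemma one_add_norm_le_mul_sub (x y : V) : 1 + ‖y‖ ≤ (1 + ‖x‖) * (1 + ‖y - x‖) := by
  simpa only [add_sub_cancel] using one_add_norm_add_le x (y - x)

variable [NormedSpace ℝ V] [NormedAddCommGroup F] [NormedSpace ℝ F] [NormedSpace ℂ F]
  [SMulCommClass ℝ ℂ F] [NormedAddCommGroup E] [NormedSpace ℂ E]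

/-- The `m`-th of an increasing sequence of seminorms that defines the topology of `𝓢(V, F)`. -/
def supSeminorm (m : ℕ) : Seminorm ℂ 𝓢(V, F) :=
  (Finset.Iic (m, m)).sup (schwartzSeminormFamily ℂ V F)

lemma one_add_pow_mul_le_supSeminorm {m k n : ℕ} (hk : k ≤ m) (hn : n ≤ m) (φ : 𝓢(V, F)) (x : V) :
    (1 + ‖x‖) ^ k * ‖iteratedFDeriv ℝ n φ x‖ ≤ 2 ^ m * supSeminorm m φ :=
  SchwartzMap.one_add_le_sup_seminorm_apply (𝕜 := ℂ) (m := (m, m)) hk hn φ x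

lemma norm_iteratedFDeriv_le_supSeminorm {m k n : ℕ} (hk : k ≤ m) (hn : n ≤ m) (φ : 𝓢(V, F))
    (x : V) : ‖iteratedFDeriv ℝ n φ x‖ ≤ 2 ^ m * supSeminorm m φ / (1 + ‖x‖) ^ k := by
  rw [le_div_iff₀' (by positivity)]
  exact one_add_pow_mul_le_supSeminorm hk hn φ x

lemma supSeminorm_le {m : ℕ} {φ : 𝓢(V, F)} {c : ℝ} (hc : 0 ≤ c)
    (h : ∀ k ≤ m, ∀ n ≤ m, ∀ x, ‖x‖ ^ k * ‖iteratedFDeriv ℝ n φ x‖ ≤ c) :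
    supSeminorm m φ ≤ c := by
  refine Seminorm.finset_sup_apply_le hc fun i hi => ?_
  have him : i.1 ≤ m ∧ i.2 ≤ m := by simpa [Prod.le_def] using hi
  exact SchwartzMap.seminorm_le_bound ℂ i.1 i.2 φ hc (h i.1 him.1 i.2 him.2)

lemma exists_le_supSeminorm {q : Seminorm ℂ 𝓢(V, F)} (hq : Continuous q) :
    ∃ (m : ℕ) (C : ℝ≥0), ∀ φ, q φ ≤ C * supSeminorm m φ := by
  obtain ⟨s, C, -, hs⟩ := Seminorm.bound_of_continuous (schwartz_withSeminorms ℂ V F) q hq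
  obtain ⟨m, hm⟩ : ∃ m : ℕ, s ⊆ Finset.Iic (m, m) := by
    refine ⟨s.sup fun i => max i.1 i.2, fun i hi => ?_⟩
    have hle := Finset.le_sup (f := fun i : ℕ × ℕ => max i.1 i.2) hi
    exact Finset.mem_Iic.2 ⟨(le_max_left _ _).trans hle, (le_max_right _ _).trans hle⟩
  refine ⟨m, C, fun φ => (hs φ).trans ?_⟩
  rw [smul_apply, NNReal.smul_def, smul_eq_mul]
  exact mul_le_mul_of_nonneg_left (Finset.sup_mono (f := schwartzSeminormFamily ℂ V F) hm φ) C.2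

lemma continuous_supSeminorm (m : ℕ) : Continuous (supSeminorm m : Seminorm ℂ 𝓢(V, F)) := by
  refine Seminorm.continuous_of_le ?_ (Seminorm.finset_sup_le_sum _ (Finset.Iic (m, m)))
  rw [FunLike.coe_sum, Finset.sum_fn]
  exact continuous_finsetSum _ fun i _ => (schwartz_withSeminorms ℂ V F).continuous_seminorm i

lemma exists_norm_le_supSeminorm (f : 𝓢(V, F) →L[ℂ] E) :
    ∃ (m : ℕ) (C : ℝ≥0), ∀ φ, ‖f φ‖ ≤ C * supSeminorm m φ :=
  exists_le_supSeminorm (q := (normSeminorm ℂ E).comp f.toLinearMap)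
    (continuous_norm.comp f.continuous)

lemma exists_supSeminorm_apply_le (L : 𝓢(V, F) →L[ℂ] 𝓢(V, F)) (m : ℕ) :
    ∃ (m' : ℕ) (C : ℝ≥0), ∀ φ, supSeminorm m (L φ) ≤ C * supSeminorm m' φ :=
  exists_le_supSeminorm (q := (supSeminorm m : Seminorm ℂ 𝓢(V, F)).comp L.toLinearMap)
    ((continuous_supSeminorm m).comp L.continuous)

lemma tendsto_schwartz_of_supSeminorm {ι : Type*} {l : Filter ι} {u : ι → 𝓢(V, F)}
    {φ : 𝓢(V, F)} (h : ∀ m, Tendsto (fun i => supSeminorm m (u i - φ)) l (𝓝 0)) :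
    Tendsto u l (𝓝 φ) := by
  rw [(schwartz_withSeminorms ℂ V F).tendsto_nhds]
  intro i ε hε
  have hi : schwartzSeminormFamily ℂ V F i ≤ supSeminorm (max i.1 i.2) :=
    Finset.le_sup (f := schwartzSeminormFamily ℂ V F) (by simp [Prod.le_def])
  filter_upwards [(h (max i.1 i.2)).eventually_lt_const hε] with j hj
  exact (hi _).trans_lt hj

/-- The translation operator `φ ↦ φ(· - x)` on Schwartz functions, written `T_x` in
time-frequency analysis. -/
abbrev translate (x : V) : 𝓢(V, F) →L[ℂ] 𝓢(V, F) := SchwartzMap.compSubConstCLM ℂ x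

lemma iteratedFDeriv_translate (n : ℕ) (x : V) (φ : 𝓢(V, F)) (y : V) :
    iteratedFDeriv ℝ n (translate x φ) y = iteratedFDeriv ℝ n φ (y - x) := by
  rw [show ⇑(translate x φ) = fun z => φ (z - x) from rfl, iteratedFDeriv_comp_sub]

lemma supSeminorm_translate_le (m : ℕ) (x : V) (φ : 𝓢(V, F)) :
    supSeminorm m (translate x φ) ≤ 2 ^ m * (1 + ‖x‖) ^ m * supSeminorm m φ := by
  refine supSeminorm_le (by positivity) fun k hk n hn y => ?_
  rw [iteratedFDeriv_translate]
  calc ‖y‖ ^ k * ‖iteratedFDeriv ℝ n φ (y - x)‖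
      ≤ ((1 + ‖x‖) * (1 + ‖y - x‖)) ^ k * ‖iteratedFDeriv ℝ n φ (y - x)‖ := by
        gcongr
        linarith [one_add_norm_le_mul_sub x y]
    _ = (1 + ‖x‖) ^ k * ((1 + ‖y - x‖) ^ k * ‖iteratedFDeriv ℝ n φ (y - x)‖) := by
        rw [mul_pow, mul_assoc]
    _ ≤ (1 + ‖x‖) ^ m * (2 ^ m * supSeminorm m φ) := by
        gcongr ?_ * ?_
        · exact pow_le_pow_right₀ (by linarith [norm_nonneg x]) hk
        · exact one_add_pow_mul_le_supSeminorm hk hn φ _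
    _ = 2 ^ m * (1 + ‖x‖) ^ m * supSeminorm m φ := by ring

lemma norm_iteratedFDeriv_sub_sub_le {m k n : ℕ} (hk : k ≤ m) (hn : n ≤ m) {h : V} (hh : ‖h‖ ≤ 1)
    (φ : 𝓢(V, F)) (y : V) :
    (1 + ‖y‖) ^ k * ‖iteratedFDeriv ℝ n φ (y - h) - iteratedFDeriv ℝ n φ y‖ ≤
      2 ^ m * (2 ^ (m + 1) * supSeminorm (m + 1) φ) * ‖h‖ := by
  have hdiff : Differentiable ℝ (iteratedFDeriv ℝ n φ) :=
    (φ.smooth (n + 1 : ℕ)).differentiable_iteratedFDeriv (by norm_cast; omega)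
  have hball : ∀ z ∈ Metric.closedBall y ‖h‖, ‖fderiv ℝ (iteratedFDeriv ℝ n φ) z‖ ≤
      2 ^ m * (2 ^ (m + 1) * supSeminorm (m + 1) φ) / (1 + ‖y‖) ^ k := by
    intro z hz
    have hyz : 1 + ‖y‖ ≤ 2 * (1 + ‖z‖) := by
      have hdist : ‖y - z‖ ≤ ‖h‖ := by simpa [dist_eq_norm, norm_sub_rev] using hz
      linarith [norm_le_insert' y z, norm_nonneg z]
    rw [norm_fderiv_iteratedFDeriv, le_div_iff₀' (by positivity)]
    calc (1 + ‖y‖) ^ k * ‖iteratedFDeriv ℝ (n + 1) φ z‖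
        ≤ (2 * (1 + ‖z‖)) ^ k * ‖iteratedFDeriv ℝ (n + 1) φ z‖ := by gcongr
      _ = 2 ^ k * ((1 + ‖z‖) ^ k * ‖iteratedFDeriv ℝ (n + 1) φ z‖) := by rw [mul_pow, mul_assoc]
      _ ≤ 2 ^ m * (2 ^ (m + 1) * supSeminorm (m + 1) φ) :=
          mul_le_mul (pow_le_pow_right₀ one_le_two hk)
            (one_add_pow_mul_le_supSeminorm (by omega) (by omega) φ z) (by positivity)
            (by positivity)
  have hmv := Convex.norm_image_sub_le_of_norm_fderiv_le (𝕜 := ℝ) (s := Metric.closedBall y ‖h‖)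
    (x := y) (y := y - h) (fun z _ => hdiff z) hball (convex_closedBall _ _) (by simp) (by simp)
  rwa [sub_sub_cancel_left, norm_neg, div_mul_eq_mul_div, le_div_iff₀' (by positivity)] at hmv

lemma supSeminorm_translate_sub_le (m : ℕ) {h : V} (hh : ‖h‖ ≤ 1) (φ : 𝓢(V, F)) :
    supSeminorm m (translate h φ - φ) ≤ 2 ^ m * (2 ^ (m + 1) * supSeminorm (m + 1) φ) * ‖h‖ := by
  refine supSeminorm_le (by positivity) fun k hk n hn y => ?_
  have hsub : iteratedFDeriv ℝ n (translate h φ - φ : 𝓢(V, F)) y =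
      iteratedFDeriv ℝ n φ (y - h) - iteratedFDeriv ℝ n φ y := by
    rw [← iteratedFDeriv_translate, ← iteratedFDeriv_sub_apply
      ((translate h φ).smooth n).contDiffAt (φ.smooth n).contDiffAt]
    rfl
  rw [hsub]
  refine le_trans ?_ (norm_iteratedFDeriv_sub_sub_le hk hn hh φ y)
  gcongr
  linarith

lemma continuous_translate_prod : Continuous fun z : V × 𝓢(V, F) => translate z.1 z.2 := by
  refine continuous_iff_continuousAt.2 fun ⟨x₀, φ₀⟩ => tendsto_schwartz_of_supSeminorm fun m => ?_
  have hsplit (z : V × 𝓢(V, F)) : translate z.1 z.2 - translate x₀ φ₀ =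
      translate z.1 (z.2 - φ₀) + translate x₀ (translate (z.1 - x₀) φ₀ - φ₀) := by
    ext y
    simp
  have hlim : Tendsto (fun z : V × 𝓢(V, F) =>
      2 ^ m * (1 + ‖z.1‖) ^ m * supSeminorm m (z.2 - φ₀) + 2 ^ m * (1 + ‖x₀‖) ^ m *
        (2 ^ m * (2 ^ (m + 1) * supSeminorm (m + 1) φ₀) * ‖z.1 - x₀‖)) (𝓝 (x₀, φ₀)) (𝓝 0) := by
    have hS : Continuous fun z : V × 𝓢(V, F) => supSeminorm m (z.2 - φ₀) :=
      (continuous_supSeminorm m).comp (continuous_snd.sub continuous_const)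
    refine Continuous.tendsto' (by fun_prop) _ _ (by simp)
  have hnear : ∀ᶠ z : V × 𝓢(V, F) in 𝓝 (x₀, φ₀), ‖z.1 - x₀‖ ≤ 1 :=
    (Continuous.tendsto' (by fun_prop) (x₀, φ₀) 0 (by simp)).eventually_le_const one_pos
  refine tendsto_of_tendsto_of_tendsto_of_le_of_le' tendsto_const_nhds hlim
    (Eventually.of_forall fun z => apply_nonneg _ _) (hnear.mono fun z hz => ?_)
  rw [hsplit]
  refine (map_add_le_add _ _ _).trans (add_le_add (supSeminorm_translate_le m z.1 _) ?_)
  refine (supSeminorm_translate_le m x₀ _).trans ?_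
  gcongr
  exact supSeminorm_translate_sub_le m hz φ₀

/-- Multiplication by the Schwartz function `a`, as an operator on Schwartz functions. -/
def mulSchwartz (a : 𝓢(V, ℂ)) : 𝓢(V, ℂ) →L[ℂ] 𝓢(V, ℂ) := SchwartzMap.smulLeftCLM ℂ a

@[simp] lemma mulSchwartz_apply (a b : 𝓢(V, ℂ)) (y : V) : mulSchwartz a b y = a y * b y := by
  simp [mulSchwartz, SchwartzMap.smulLeftCLM_apply_apply a.hasTemperateGrowth]

lemma mulSchwartz_comm (a b : 𝓢(V, ℂ)) : mulSchwartz a b = mulSchwartz b a := by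
  ext y
  rw [mulSchwartz_apply, mulSchwartz_apply, mul_comm]

lemma mulSchwartz_eq_left {a b : 𝓢(V, ℂ)} (h : ∀ y ∈ Function.support a, b y = 1) :
    mulSchwartz a b = a := by
  ext y
  by_cases hy : a y = 0
  · rw [mulSchwartz_apply, hy, zero_mul]
  · rw [mulSchwartz_apply, h y hy, mul_one]

lemma coe_mulSchwartz (a b : 𝓢(V, ℂ)) : ⇑(mulSchwartz a b) = fun y => a y * b y :=
  funext (mulSchwartz_apply a b)

lemma norm_iteratedFDeriv_mul_le_of_le {A : Type*} [NormedRing A] [NormedAlgebra ℝ A]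
    {f g : V → A} {n : ℕ} (hf : ContDiff ℝ n f) (hg : ContDiff ℝ n g) {y : V} {a b : ℝ}
    (hfa : ∀ i ≤ n, ‖iteratedFDeriv ℝ i f y‖ ≤ a) (hgb : ∀ i ≤ n, ‖iteratedFDeriv ℝ i g y‖ ≤ b) :
    ‖iteratedFDeriv ℝ n (fun y => f y * g y) y‖ ≤ 2 ^ n * (a * b) := by
  have ha : 0 ≤ a := (norm_nonneg _).trans (hfa 0 n.zero_le)
  calc ‖iteratedFDeriv ℝ n (fun y => f y * g y) y‖
      ≤ ∑ i ∈ Finset.range (n + 1), (n.choose i : ℝ) * ‖iteratedFDeriv ℝ i f y‖ *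
          ‖iteratedFDeriv ℝ (n - i) g y‖ := norm_iteratedFDeriv_mul_le hf hg y le_rfl
    _ ≤ ∑ i ∈ Finset.range (n + 1), (n.choose i : ℝ) * (a * b) := by
        refine Finset.sum_le_sum fun i hi => ?_
        rw [mul_assoc]
        gcongr
        · exact hfa i (Nat.lt_succ_iff.1 (Finset.mem_range.1 hi))
        · exact hgb _ (n.sub_le i)
    _ = 2 ^ n * (a * b) := by
        rw [← Finset.sum_mul]
        congr 1
        exact_mod_cast Nat.sum_range_choose n

lemma supSeminorm_mul_translate_le (m N : ℕ) (a b : 𝓢(V, ℂ)) (x : V) :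
    (1 + ‖x‖) ^ N * supSeminorm m (mulSchwartz a (translate x b)) ≤
      2 ^ m * ((2 ^ (m + N) * supSeminorm (m + N) a) * (2 ^ (m + N) * supSeminorm (m + N) b)) := by
  have hx : 0 < (1 + ‖x‖) ^ N := by positivity
  rw [← le_div_iff₀' hx]
  refine supSeminorm_le (by positivity) fun k hk n hn y => ?_
  have hy : 1 + ‖x‖ ≤ (1 + ‖y‖) * (1 + ‖y - x‖) := by
    simpa only [norm_sub_rev x y] using one_add_norm_le_mul_sub y x
  have hab : ‖iteratedFDeriv ℝ n (mulSchwartz a (translate x b)) y‖ ≤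
      2 ^ n * (2 ^ (m + N) * supSeminorm (m + N) a / (1 + ‖y‖) ^ (k + N) *
        (2 ^ (m + N) * supSeminorm (m + N) b / (1 + ‖y - x‖) ^ N)) := by
    rw [coe_mulSchwartz]
    refine norm_iteratedFDeriv_mul_le_of_le (a.smooth n) ((translate x b).smooth n)
      (fun i hi => norm_iteratedFDeriv_le_supSeminorm (by omega) (by omega) a y) fun i hi => ?_
    rw [iteratedFDeriv_translate]
    exact norm_iteratedFDeriv_le_supSeminorm (by omega) (by omega) b _
  set S := (2 ^ (m + N) * supSeminorm (m + N) a) * (2 ^ (m + N) * supSeminorm (m + N) b) with hS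
  calc ‖y‖ ^ k * ‖iteratedFDeriv ℝ n (mulSchwartz a (translate x b)) y‖
      ≤ (1 + ‖y‖) ^ k * (2 ^ n * (2 ^ (m + N) * supSeminorm (m + N) a / (1 + ‖y‖) ^ (k + N) *
        (2 ^ (m + N) * supSeminorm (m + N) b / (1 + ‖y - x‖) ^ N))) := by
        gcongr
        linarith
    _ = 2 ^ n * S / ((1 + ‖y‖) * (1 + ‖y - x‖)) ^ N := by
        rw [hS, pow_add (1 + ‖y‖), mul_pow (1 + ‖y‖)]
        field_simp
    _ ≤ 2 ^ m * S / (1 + ‖x‖) ^ N := by gcongr; norm_num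

lemma supSeminorm_mul_le_of_bounded (m : ℕ) {K : ℝ} (a b : 𝓢(V, ℂ))
    (ha : ∀ n ≤ m, ∀ y, ‖iteratedFDeriv ℝ n a y‖ ≤ K) :
    supSeminorm m (mulSchwartz a b) ≤ 2 ^ m * (K * (2 ^ m * supSeminorm m b)) := by
  have hK : 0 ≤ K := (norm_nonneg _).trans (ha 0 m.zero_le 0)
  refine supSeminorm_le (by positivity) fun k hk n hn y => ?_
  have hab : ‖iteratedFDeriv ℝ n (mulSchwartz a b) y‖ ≤
      2 ^ n * (K * (2 ^ m * supSeminorm m b / (1 + ‖y‖) ^ k)) := by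
    rw [coe_mulSchwartz]
    exact norm_iteratedFDeriv_mul_le_of_le (a.smooth n) (b.smooth n)
      (fun i hi => ha i (by omega) y)
      fun i hi => norm_iteratedFDeriv_le_supSeminorm hk (by omega) b y
  calc ‖y‖ ^ k * ‖iteratedFDeriv ℝ n (mulSchwartz a b) y‖
      ≤ (1 + ‖y‖) ^ k * (2 ^ n * (K * (2 ^ m * supSeminorm m b / (1 + ‖y‖) ^ k))) := by
        gcongr
        linarith
    _ = 2 ^ n * (K * (2 ^ m * supSeminorm m b)) := by field_simp
    _ ≤ 2 ^ m * (K * (2 ^ m * supSeminorm m b)) := by gcongr; norm_num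

end Schwartz

/-! ### Weak integrals of Schwartz functions -/

section WeakIntegral

open scoped BoundedContinuousFunction

variable {V F E X : Type*} [NormedAddCommGroup V] [NormedSpace ℝ V]
  [NormedAddCommGroup F] [NormedSpace ℝ F] [NormedSpace ℂ F] [SMulCommClass ℝ ℂ F]
  [NormedAddCommGroup E] [NormedSpace ℂ E] [MeasurableSpace X] {μ : Measure X}

lemma map_eq_integral_map_of_norm_le {𝕜 W G H : Type*} [RCLike 𝕜] [AddCommGroup W] [Module 𝕜 W]
    [NormedAddCommGroup G] [NormedSpace 𝕜 G] [CompleteSpace G] [NormedSpace ℝ G]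
    [NormedAddCommGroup H] [NormedSpace 𝕜 H] [CompleteSpace H] [NormedSpace ℝ H]
    {T : W →ₗ[𝕜] H} {J : W →ₗ[𝕜] G} {C : ℝ} (hTJ : ∀ w, ‖T w‖ ≤ C * ‖J w‖) {Φ : X → W}
    (hT : Integrable (fun x => T (Φ x)) μ) (hJ : Integrable (fun x => J (Φ x)) μ) {w : W}
    (hw : J w = ∫ x, J (Φ x) ∂μ) : T w = ∫ x, T (Φ x) ∂μ := by
  set K : Submodule 𝕜 (G × H) := (LinearMap.range (J.prod T)).topologicalClosure
  have hgraph (u : W) : (J u, T u) ∈ K :=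
    Submodule.le_topologicalClosure _ (LinearMap.mem_range_self (J.prod T) u)
  have hbound : ∀ z ∈ K, ‖z.2‖ ≤ C * ‖z.1‖ := by
    have hclosed : IsClosed {z : G × H | ‖z.2‖ ≤ C * ‖z.1‖} :=
      isClosed_le (by fun_prop) (by fun_prop)
    refine fun z hz => closure_minimal ?_ hclosed hz
    rintro _ ⟨u, rfl⟩
    exact hTJ u
  have : IsClosed (K : Set (G × H)) := Submodule.isClosed_topologicalClosure _
  have hint : (∫ x, J (Φ x) ∂μ, ∫ x, T (Φ x) ∂μ) ∈ K := by
    rw [← integral_pair hJ hT, ← K.ker_mkQ, LinearMap.mem_ker, ← Submodule.coe_mkQL,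
      ← K.mkQL.integral_comp_comm (hJ.prodMk hT)]
    have hzero (x : X) : K.mkQ (J (Φ x), T (Φ x)) = 0 := by simpa using hgraph (Φ x)
    simp only [Submodule.coe_mkQL, hzero, integral_zero]
  simpa [hw, sub_eq_zero] using hbound _ (K.sub_mem (hgraph w) hint)

/-- The operator `φ ↦ ‖·‖ ^ k • D ^ n φ` from Schwartz functions to bounded continuous functions.
Finitely many of these operators dominate any given continuous linear map on `𝓢(V, F)`. -/
def weightedDerivCLM (k n : ℕ) : 𝓢(V, F) →L[ℂ] V →ᵇ V [×n]→L[ℝ] F :=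
  SchwartzMap.mkCLMtoNormedSpace (σ := RingHom.id ℂ)
    (fun φ : 𝓢(V, F) => BoundedContinuousFunction.ofNormedAddCommGroup
      (fun y => ‖y‖ ^ k • iteratedFDeriv ℝ n φ y)
      ((continuous_norm.pow k).smul ((φ.smooth n).continuous_iteratedFDeriv le_rfl))
      (SchwartzMap.seminorm ℂ k n φ)
      (fun y => by simpa [norm_smul] using SchwartzMap.le_seminorm ℂ k n φ y))
    (fun φ ψ => by
      ext1 y
      have hadd := iteratedFDeriv_add_apply (x := y) (φ.smooth n).contDiffAt (ψ.smooth n).contDiffAt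
      exact (congrArg _ hadd).trans (smul_add _ _ _))
    (fun a φ => by
      ext1 y
      have hsmul := iteratedFDeriv_const_smul_apply (a := a) (x := y) (φ.smooth n).contDiffAt
      exact (congrArg _ hsmul).trans (smul_comm _ _ _))
    ⟨{(k, n)}, 1, zero_le_one, fun φ => by
      rw [Finset.sup_singleton, one_mul]
      exact BoundedContinuousFunction.norm_ofNormedAddCommGroup_le _
        (apply_nonneg (SchwartzMap.seminorm ℂ k n) φ) _⟩

@[simp] lemma weightedDerivCLM_apply (k n : ℕ) (φ : 𝓢(V, F)) (y : V) :
    weightedDerivCLM k n φ y = ‖y‖ ^ k • iteratedFDeriv ℝ n φ y := rfl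

lemma supSeminorm_le_of_weightedDerivCLM {m : ℕ} {φ : 𝓢(V, F)} {c : ℝ} (hc : 0 ≤ c)
    (h : ∀ k ≤ m, ∀ n ≤ m, ‖weightedDerivCLM k n φ‖ ≤ c) : supSeminorm m φ ≤ c :=
  supSeminorm_le hc fun k hk n hn y => by
    simpa [norm_smul] using ((weightedDerivCLM k n φ).norm_coe_le_norm y).trans (h k hk n hn)

variable [TopologicalSpace X]

/-- A continuous family of Schwartz functions all of whose seminorms are integrable. Such a family
can be integrated pointwise, and a Schwartz function that is the pointwise integral is also the weak
integral of the family (`IsIntegrableFamily.apply_eq_integral`). -/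
structure IsIntegrableFamily (Φ : X → 𝓢(V, F)) (μ : Measure X) : Prop where
  continuous : Continuous Φ
  integrable_supSeminorm : ∀ m, Integrable (fun x => supSeminorm m (Φ x)) μ

namespace IsIntegrableFamily

variable [OpensMeasurableSpace X] [SecondCountableTopology X] {Φ : X → 𝓢(V, F)}

theorem integrable_apply (hΦ : IsIntegrableFamily Φ μ) (T : 𝓢(V, F) →L[ℂ] E) :
    Integrable (fun x => T (Φ x)) μ := by
  obtain ⟨m, C, hT⟩ := exists_norm_le_supSeminorm T
  exact ((hΦ.integrable_supSeminorm m).const_mul C).mono'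
    (T.continuous.comp hΦ.continuous).aestronglyMeasurable (Eventually.of_forall fun x => hT (Φ x))

lemma integrable_iteratedFDeriv (hΦ : IsIntegrableFamily Φ μ) (n : ℕ) (y : V) :
    Integrable (fun x => iteratedFDeriv ℝ n (Φ x) y) μ := by
  simpa using hΦ.integrable_apply
    ((BoundedContinuousFunction.evalCLM ℂ y).comp
      (weightedDerivCLM 0 n : 𝓢(V, F) →L[ℂ] V →ᵇ V [×n]→L[ℝ] F))

lemma hasFDerivAt_integral_iteratedFDeriv (hΦ : IsIntegrableFamily Φ μ) (n : ℕ) (y : V) :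
    HasFDerivAt (fun y => ∫ x, iteratedFDeriv ℝ n (Φ x) y ∂μ)
      (∫ x, fderiv ℝ (iteratedFDeriv ℝ n (Φ x)) y ∂μ) y := by
  refine hasFDerivAt_integral_of_dominated_of_fderiv_le (𝕜 := ℝ) (E := V [×n]→L[ℝ] F)
    (F' := fun z x => fderiv ℝ (iteratedFDeriv ℝ n (Φ x)) z) (s := Set.univ) univ_mem
    (Eventually.of_forall fun z => (hΦ.integrable_iteratedFDeriv n z).aestronglyMeasurable)
    (hΦ.integrable_iteratedFDeriv n y) ?_ (Eventually.of_forall fun x z _ => ?_)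
    ((hΦ.integrable_supSeminorm (n + 1)).const_mul (2 ^ (n + 1)))
    (Eventually.of_forall fun x z _ => ?_)
  · have hcurry := (continuousMultilinearCurryLeftEquiv ℝ (fun _ : Fin (n + 1) => V) F).continuous
    exact hcurry.comp_aestronglyMeasurable
      (hΦ.integrable_iteratedFDeriv (n + 1) y).aestronglyMeasurable
  · rw [norm_fderiv_iteratedFDeriv]
    simpa using norm_iteratedFDeriv_le_supSeminorm (k := 0) (Nat.zero_le _) le_rfl (Φ x) z
  · exact (((Φ x).smooth (n + 1 : ℕ)).differentiable_iteratedFDeriv (m := n)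
      (by norm_cast; omega) z).hasFDerivAt

variable {φ : 𝓢(V, F)}

lemma iteratedFDeriv_eq_integral (hΦ : IsIntegrableFamily Φ μ) (hφ : ∀ y, φ y = ∫ x, Φ x y ∂μ)
    (n : ℕ) (y : V) : iteratedFDeriv ℝ n φ y = ∫ x, iteratedFDeriv ℝ n (Φ x) y ∂μ := by
  induction n generalizing y with
  | zero =>
    ext v
    rw [ContinuousMultilinearMap.integral_apply (hΦ.integrable_iteratedFDeriv 0 y)]
    simpa using hφ y
  | succ n ih =>
    simp only [iteratedFDeriv_succ_eq_comp_left, Function.comp_apply]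
    rw [funext ih, (hΦ.hasFDerivAt_integral_iteratedFDeriv n y).fderiv]
    let curry := continuousMultilinearCurryLeftEquiv ℝ (fun _ : Fin (n + 1) => V) F
    exact (curry.symm.toContinuousLinearEquiv.integral_comp_comm (𝕜 := ℝ)
      (E := V →L[ℝ] V [×n]→L[ℝ] F) (F := V [×(n + 1)]→L[ℝ] F) (μ := μ)
      (fun x => fderiv ℝ (iteratedFDeriv ℝ n (Φ x)) y)).symm

variable [CompleteSpace F]

lemma weightedDerivCLM_eq_integral (hΦ : IsIntegrableFamily Φ μ)
    (hφ : ∀ y, φ y = ∫ x, Φ x y ∂μ) (k n : ℕ) :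
    weightedDerivCLM k n φ = ∫ x, weightedDerivCLM k n (Φ x) ∂μ := by
  ext1 y
  let ev : (V →ᵇ V [×n]→L[ℝ] F) →L[ℂ] V [×n]→L[ℝ] F := BoundedContinuousFunction.evalCLM ℂ y
  have heval := ev.integral_comp_comm (𝕜 := ℂ) (E := V →ᵇ V [×n]→L[ℝ] F) (Fₗ := V [×n]→L[ℝ] F)
    (hΦ.integrable_apply (weightedDerivCLM k n))
  refine Eq.trans ?_ heval
  simp [ev, integral_smul, hΦ.iteratedFDeriv_eq_integral hφ]

set_option maxSynthPendingDepth 3 in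
theorem apply_eq_integral [CompleteSpace E] (hΦ : IsIntegrableFamily Φ μ)
    (hφ : ∀ y, φ y = ∫ x, Φ x y ∂μ) (T : 𝓢(V, F) →L[ℂ] E) : T φ = ∫ x, T (Φ x) ∂μ := by
  obtain ⟨m, C, hT⟩ := exists_norm_le_supSeminorm T
  let J : 𝓢(V, F) →L[ℂ] (i : Fin (m + 1) × Fin (m + 1)) → V →ᵇ V [×(i.2 : ℕ)]→L[ℝ] F :=
    ContinuousLinearMap.pi fun i => weightedDerivCLM i.1 i.2
  have hTJ (ψ : 𝓢(V, F)) : ‖T ψ‖ ≤ C * ‖J ψ‖ := by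
    refine (hT ψ).trans (mul_le_mul_of_nonneg_left ?_ C.2)
    exact supSeminorm_le_of_weightedDerivCLM (norm_nonneg _) fun k hk n hn =>
      norm_le_pi_norm (J ψ) (⟨k, Nat.lt_succ_of_le hk⟩, ⟨n, Nat.lt_succ_of_le hn⟩)
  have hJ : Integrable (fun x => J (Φ x)) μ := hΦ.integrable_apply J
  refine map_eq_integral_map_of_norm_le (T := T.toLinearMap) (J := J.toLinearMap) hTJ
    (hΦ.integrable_apply T) hJ (funext fun i => ?_)
  exact (hΦ.weightedDerivCLM_eq_integral hφ i.1 i.2).trans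
    (eval_integral (fun j => hJ.eval j) i).symm

end IsIntegrableFamily

end WeakIntegral

/-! ### Characters and the Fourier transform -/

section Characters

variable {d : ℕ}

lemma norm_character (ξ y : Rd d) : ‖character ξ y‖ = 1 := by
  rw [character, show -(2 * Real.pi * Complex.I * ((inner ℝ y ξ : ℝ) : ℂ)) =
    ((-(2 * Real.pi * inner ℝ y ξ) : ℝ) : ℂ) * Complex.I by push_cast; ring,
    Complex.norm_exp_ofReal_mul_I]

lemma character_add_left (ξ η y : Rd d) :
    character (ξ + η) y = character ξ y * character η y := by
  simp only [character, ← Complex.exp_add, inner_add_right, Complex.ofReal_add, mul_add, neg_add]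

lemma character_comm (ξ y : Rd d) : character ξ y = character y ξ := by
  rw [character, character, real_inner_comm]

lemma character_add_right (ξ y z : Rd d) :
    character ξ (y + z) = character ξ y * character ξ z := by
  rw [character_comm, character_add_left, character_comm y, character_comm z]

lemma fourier_schwartz_apply (φ : 𝓢(Rd d, ℂ)) (ξ : Rd d) :
    (𝓕 φ) ξ = ∫ y, character ξ y * φ y := by
  rw [SchwartzMap.fourier_coe, Real.fourier_eq']
  refine integral_congr_ae (Eventually.of_forall fun y => ?_)
  simp only [character, smul_eq_mul]
  congr 2
  push_cast
  ring

lemma fourierInv_schwartz_eq_neg (φ : 𝓢(Rd d, ℂ)) (ξ : Rd d) : (𝓕⁻ φ) ξ = (𝓕 φ) (-ξ) := by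
  rw [SchwartzMap.fourierInv_coe, SchwartzMap.fourier_coe, Real.fourierInv_eq_fourier_neg]

lemma fourier_translate (ξ : Rd d) (φ : 𝓢(Rd d, ℂ)) :
    𝓕 (translate ξ φ) = charMul ξ (𝓕 φ) := by
  ext y
  rw [charMul_apply, fourier_schwartz_apply, fourier_schwartz_apply, ← integral_const_mul,
    ← integral_add_right_eq_self _ ξ]
  refine integral_congr_ae (Eventually.of_forall fun z => ?_)
  simp only [SchwartzMap.compSubConstCLM_apply, add_sub_cancel_right]
  rw [character_add_right, character_comm y ξ]
  ring

lemma charMul_eq_fourier_translate (ξ : Rd d) (φ : 𝓢(Rd d, ℂ)) :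
    charMul ξ φ = 𝓕 (translate ξ (𝓕⁻ φ)) := by
  rw [fourier_translate, FourierTransform.fourier_fourierInv_eq]

lemma fourierInv_charMul (ξ : Rd d) (φ : 𝓢(Rd d, ℂ)) :
    𝓕⁻ (charMul ξ φ) = translate ξ (𝓕⁻ φ) := by
  rw [charMul_eq_fourier_translate, FourierTransform.fourierInv_fourier_eq]

lemma charMul_mulSchwartz (ξ : Rd d) (a b : 𝓢(Rd d, ℂ)) :
    charMul ξ (mulSchwartz a b) = mulSchwartz (charMul ξ a) b := by
  ext y
  simp only [charMul_apply, mulSchwartz_apply, mul_assoc]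

lemma enorm_fourierInv_translate (x : Rd d) (φ : 𝓢(Rd d, ℂ)) (η : Rd d) :
    ‖(𝓕⁻ (translate x φ)) η‖ₑ = ‖(𝓕⁻ φ) η‖ₑ := by
  rw [fourierInv_schwartz_eq_neg, fourierInv_schwartz_eq_neg, fourier_translate, charMul_apply,
    enorm_mul, ← ofReal_norm (character x (-η)), norm_character, ENNReal.ofReal_one, one_mul]

lemma continuous_fourier_schwartz : Continuous fun φ : 𝓢(Rd d, ℂ) => 𝓕 φ :=
  (FourierTransform.fourierCLM ℂ 𝓢(Rd d, ℂ)).continuous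

lemma continuous_fourierInv_schwartz : Continuous fun φ : 𝓢(Rd d, ℂ) => 𝓕⁻ φ :=
  (FourierTransform.fourierCLE ℂ 𝓢(Rd d, ℂ)).symm.continuous

lemma continuous_translate {X : Type*} [TopologicalSpace X] {u : X → Rd d} {v : X → 𝓢(Rd d, ℂ)}
    (hu : Continuous u) (hv : Continuous v) : Continuous fun x => translate (u x) (v x) :=
  continuous_translate_prod.comp (hu.prodMk hv)

lemma continuous_charMul {X : Type*} [TopologicalSpace X] {u : X → Rd d} {v : X → 𝓢(Rd d, ℂ)}
    (hu : Continuous u) (hv : Continuous v) : Continuous fun x => charMul (u x) (v x) := by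
  simp only [charMul_eq_fourier_translate]
  exact continuous_fourier_schwartz.comp
    (continuous_translate hu (continuous_fourierInv_schwartz.comp hv))

lemma exists_supSeminorm_fourier_le (m : ℕ) : ∃ (m' : ℕ) (C : ℝ≥0), ∀ φ : 𝓢(Rd d, ℂ),
    supSeminorm m (𝓕 φ) ≤ C * supSeminorm m' φ :=
  exists_supSeminorm_apply_le (FourierTransform.fourierCLM ℂ 𝓢(Rd d, ℂ)) m

lemma exists_supSeminorm_fourierInv_le (m : ℕ) : ∃ (m' : ℕ) (C : ℝ≥0), ∀ φ : 𝓢(Rd d, ℂ),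
    supSeminorm m (𝓕⁻ φ) ≤ C * supSeminorm m' φ :=
  exists_supSeminorm_apply_le
    ((FourierTransform.fourierCLE ℂ 𝓢(Rd d, ℂ)).symm : 𝓢(Rd d, ℂ) →L[ℂ] 𝓢(Rd d, ℂ)) m

lemma exists_supSeminorm_charMul_le (m : ℕ) : ∃ (k m' : ℕ) (C : ℝ≥0), ∀ (ξ : Rd d)
    (φ : 𝓢(Rd d, ℂ)), supSeminorm m (charMul ξ φ) ≤ C * (1 + ‖ξ‖) ^ k * supSeminorm m' φ := by
  obtain ⟨k, C₁, hfourier⟩ := exists_supSeminorm_fourier_le (d := d) m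
  obtain ⟨m', C₂, hfourierInv⟩ := exists_supSeminorm_fourierInv_le (d := d) k
  refine ⟨k, m', C₁ * 2 ^ k * C₂, fun ξ φ => ?_⟩
  calc supSeminorm m (charMul ξ φ)
      ≤ C₁ * supSeminorm k (translate ξ (𝓕⁻ φ)) := by
        rw [charMul_eq_fourier_translate]
        exact hfourier _
    _ ≤ C₁ * (2 ^ k * (1 + ‖ξ‖) ^ k * (C₂ * supSeminorm m' φ)) := by
        gcongr
        exact (supSeminorm_translate_le k ξ _).trans
          (mul_le_mul_of_nonneg_left (hfourierInv φ) (by positivity))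
    _ = _ := by push_cast; ring

lemma one_add_pow_mul_norm_le (N : ℕ) (φ : 𝓢(Rd d, ℂ)) (x : Rd d) :
    (1 + ‖x‖) ^ N * ‖φ x‖ ≤ 2 ^ N * supSeminorm N φ := by
  simpa using one_add_pow_mul_le_supSeminorm (le_refl N) (Nat.zero_le N) φ x

lemma enorm_apply_le (N : ℕ) (φ : 𝓢(Rd d, ℂ)) (x : Rd d) :
    ‖φ x‖ₑ ≤ ENNReal.ofReal (2 ^ N * supSeminorm N φ) * weight (-(N : ℝ)) x := by
  rw [← ofReal_norm]
  exact ofReal_le_mul_weight (norm_nonneg _) (one_add_pow_mul_norm_le N φ x)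

lemma exists_enorm_fourierInv_le (N : ℕ) : ∃ (m : ℕ) (C : ℝ≥0), ∀ (φ : 𝓢(Rd d, ℂ)) (η : Rd d),
    ‖(𝓕⁻ φ) η‖ₑ ≤ C * ENNReal.ofReal (supSeminorm m φ) * weight (-(N : ℝ)) η := by
  obtain ⟨m, C, hm⟩ := exists_supSeminorm_fourierInv_le (d := d) N
  refine ⟨m, 2 ^ N * C, fun φ η => (enorm_apply_le N _ η).trans ?_⟩
  gcongr
  rw [← ENNReal.ofReal_coe_nnreal, ← ENNReal.ofReal_mul NNReal.zero_le_coe]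
  refine ENNReal.ofReal_le_ofReal ?_
  push_cast
  rw [mul_assoc]
  exact mul_le_mul_of_nonneg_left (hm φ) (by positivity)

lemma integrable_of_one_add_pow_mul_le {E : Type*} [NormedAddCommGroup E] {g : Rd d → E}
    (hg : AEStronglyMeasurable g) {c : ℝ} (h : ∀ x, (1 + ‖x‖) ^ (d + 1) * ‖g x‖ ≤ c) :
    Integrable g := by
  have hdecay : Integrable fun x : Rd d => (1 + ‖x‖) ^ (-((d + 1 : ℕ) : ℝ)) :=
    integrable_one_add_norm (by simp)
  refine (hdecay.const_mul c).mono' hg (Eventually.of_forall fun x => ?_)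
  rw [Real.rpow_neg (by positivity), Real.rpow_natCast, ← div_eq_mul_inv,
    le_div_iff₀' (by positivity)]
  exact h x

lemma isIntegrableFamily_of_decay {Φ : Rd d → 𝓢(Rd d, ℂ)} (hΦ : Continuous Φ)
    (h : ∀ m, ∃ c : ℝ, ∀ x, (1 + ‖x‖) ^ (d + 1) * supSeminorm m (Φ x) ≤ c) :
    IsIntegrableFamily Φ volume := by
  refine ⟨hΦ, fun m => ?_⟩
  obtain ⟨c, hc⟩ := h m
  refine integrable_of_one_add_pow_mul_le
    ((continuous_supSeminorm m).comp hΦ).aestronglyMeasurable (c := c) fun x => ?_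
  rw [Real.norm_of_nonneg (apply_nonneg _ _)]
  exact hc x

lemma isIntegrableFamily_smul_charMul (a φ : 𝓢(Rd d, ℂ)) :
    IsIntegrableFamily (fun ξ => φ ξ • charMul ξ a) volume := by
  refine isIntegrableFamily_of_decay
    (φ.continuous.smul (continuous_charMul continuous_id continuous_const)) fun m => ?_
  obtain ⟨k, m', C, h⟩ := exists_supSeminorm_charMul_le (d := d) m
  refine ⟨(2 ^ (d + 1 + k) * supSeminorm (d + 1 + k) φ) * (C * supSeminorm m' a), fun ξ => ?_⟩
  rw [map_smul_eq_mul]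
  calc (1 + ‖ξ‖) ^ (d + 1) * (‖φ ξ‖ * supSeminorm m (charMul ξ a))
      ≤ (1 + ‖ξ‖) ^ (d + 1) * (‖φ ξ‖ * (C * (1 + ‖ξ‖) ^ k * supSeminorm m' a)) := by
        gcongr
        exact h ξ a
    _ = ((1 + ‖ξ‖) ^ (d + 1 + k) * ‖φ ξ‖) * (C * supSeminorm m' a) := by
        rw [pow_add _ (d + 1) k]
        ring
    _ ≤ _ := mul_le_mul_of_nonneg_right (one_add_pow_mul_norm_le _ φ ξ) (by positivity)

lemma isIntegrableFamily_mul_translate (φ G : 𝓢(Rd d, ℂ)) :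
    IsIntegrableFamily (fun x => mulSchwartz φ (translate x G)) volume :=
  isIntegrableFamily_of_decay ((mulSchwartz φ).continuous.comp
    (continuous_translate continuous_id continuous_const)) fun m =>
      ⟨_, fun x => supSeminorm_mul_translate_le m (d + 1) φ G x⟩

variable {E : Type*} [NormedAddCommGroup E] [NormedSpace ℂ E] (f : 𝓢(Rd d, ℂ) →L[ℂ] E)

lemma integrable_smul_apply_charMul (a φ : 𝓢(Rd d, ℂ)) :
    Integrable fun ξ => φ ξ • f (charMul ξ a) := by
  simpa using (isIntegrableFamily_smul_charMul a φ).integrable_apply f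

lemma continuous_apply_charMul (a : 𝓢(Rd d, ℂ)) : Continuous fun ξ => f (charMul ξ a) :=
  f.continuous.comp (continuous_charMul continuous_id continuous_const)

lemma exists_norm_apply_charMul_le (a : 𝓢(Rd d, ℂ)) :
    ∃ (k : ℕ) (C : ℝ≥0), ∀ ξ, ‖f (charMul ξ a)‖ ≤ C * (1 + ‖ξ‖) ^ k := by
  obtain ⟨m, C, hf⟩ := exists_norm_le_supSeminorm f
  obtain ⟨k, m', C', hchar⟩ := exists_supSeminorm_charMul_le (d := d) m
  refine ⟨k, C * C' * (supSeminorm m' a).toNNReal, fun ξ => ?_⟩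
  calc ‖f (charMul ξ a)‖ ≤ C * supSeminorm m (charMul ξ a) := hf _
    _ ≤ C * (C' * (1 + ‖ξ‖) ^ k * supSeminorm m' a) :=
        mul_le_mul_of_nonneg_left (hchar ξ a) C.2
    _ = _ := by
        push_cast
        rw [Real.coe_toNNReal _ (apply_nonneg _ _)]
        ring

/-- The `𝓕L^p_r`-norm of the product `a f` of a distribution with a Schwartz function, read off from
the function `ξ ↦ f (a e^{-2πi ξ·})`, which is the Fourier transform of `a f`. -/
def localNorm (p : ℝ≥0∞) (r : ℝ) (f : 𝓢(Rd d, ℂ) →L[ℂ] E) (a : 𝓢(Rd d, ℂ)) : ℝ≥0∞ :=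
  weightedLpNorm p r (fun ξ => ‖f (charMul ξ a)‖ₑ)

variable [CompleteSpace E]

theorem apply_mul_fourier (a φ : 𝓢(Rd d, ℂ)) :
    f (mulSchwartz a (𝓕 φ)) = ∫ ξ, φ ξ • f (charMul ξ a) := by
  have hweak : f (mulSchwartz a (𝓕 φ)) = ∫ ξ, f (φ ξ • charMul ξ a) := by
    refine (isIntegrableFamily_smul_charMul a φ).apply_eq_integral (fun y => ?_) f
    rw [mulSchwartz_apply, fourier_schwartz_apply, ← integral_const_mul]
    refine integral_congr_ae (Eventually.of_forall fun ξ => ?_)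
    simp only [smul_apply, charMul_apply, smul_eq_mul, character_comm y ξ]
    ring
  simpa using hweak

theorem apply_eq_integral_translate {G : 𝓢(Rd d, ℂ)} (hG : ∫ x, G x = 1) (φ : 𝓢(Rd d, ℂ)) :
    f φ = ∫ x, f (mulSchwartz φ (translate x G)) := by
  refine (isIntegrableFamily_mul_translate φ G).apply_eq_integral (fun y => ?_) f
  simp only [mulSchwartz_apply, SchwartzMap.compSubConstCLM_apply]
  rw [integral_const_mul, integral_sub_left_eq_self, hG, mul_one]

lemma apply_charMul_mul (a κ : 𝓢(Rd d, ℂ)) (ξ : Rd d) :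
    f (charMul ξ (mulSchwartz a κ)) = ∫ η, (𝓕⁻ κ) η • f (charMul (ξ + η) a) := by
  have hκ : charMul ξ (mulSchwartz a κ) = mulSchwartz (charMul ξ a) (𝓕 (𝓕⁻ κ)) := by
    rw [FourierTransform.fourier_fourierInv_eq, charMul_mulSchwartz]
  have hadd (η : Rd d) : charMul η (charMul ξ a) = charMul (ξ + η) a := by
    ext y
    simp only [charMul_apply, character_add_left]
    ring
  simp only [hκ, apply_mul_fourier, hadd]

lemma enorm_apply_charMul_mul_le (a κ : 𝓢(Rd d, ℂ)) {c : ℝ≥0∞} (hc : c ≠ ∞) {N : ℝ}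
    (hκ : ∀ η, ‖(𝓕⁻ κ) η‖ₑ ≤ c * weight (-N) η) (ξ : Rd d) :
    ‖f (charMul ξ (mulSchwartz a κ))‖ₑ ≤
      c * ∫⁻ η, weight (-N) (ξ - η) * ‖f (charMul η a)‖ₑ := by
  calc ‖f (charMul ξ (mulSchwartz a κ))‖ₑ
      ≤ ∫⁻ η, ‖(𝓕⁻ κ) η • f (charMul (ξ + η) a)‖ₑ := by
        rw [apply_charMul_mul]
        exact enorm_integral_le_lintegral_enorm _
    _ ≤ ∫⁻ η, c * (weight (-N) (ξ - (ξ + η)) * ‖f (charMul (ξ + η) a)‖ₑ) := by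
        refine lintegral_mono fun η => ?_
        rw [enorm_smul, sub_add_cancel_left, weight_neg_arg, ← mul_assoc]
        gcongr
        exact hκ η
    _ = c * ∫⁻ η, weight (-N) (ξ - η) * ‖f (charMul η a)‖ₑ := by
        rw [lintegral_add_left_eq_self (fun η => c * (weight (-N) (ξ - η) * ‖f (charMul η a)‖ₑ)) ξ,
          lintegral_const_mul' _ _ hc]

lemma exists_localNorm_mul_translate_le (d : ℕ) {p : ℝ≥0∞} (hp : 1 ≤ p) (r : ℝ) :
    ∃ (m : ℕ) (C : ℝ≥0), ∀ (f : 𝓢(Rd d, ℂ) →L[ℂ] E) (a κ : 𝓢(Rd d, ℂ)) (x : Rd d),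
      localNorm p r f (mulSchwartz a (translate x κ)) ≤
        C * ENNReal.ofReal (supSeminorm m κ) * localNorm p r f a := by
  obtain ⟨N, hN⟩ := exists_nat_gt (d + |r|)
  obtain ⟨C, hC⟩ := exists_weightedLpNorm_conv_weight_le (d := d) hp r hN
  obtain ⟨m, C', hκ⟩ := exists_enorm_fourierInv_le (d := d) N
  refine ⟨m, C' * C, fun f a κ x => ?_⟩
  set c : ℝ≥0∞ := C' * ENNReal.ofReal (supSeminorm m κ)
  have hc : c ≠ ∞ := ENNReal.mul_ne_top ENNReal.coe_ne_top ENNReal.ofReal_ne_top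
  have hκx (η : Rd d) : ‖(𝓕⁻ (translate x κ)) η‖ₑ ≤ c * weight (-N) η := by
    rw [enorm_fourierInv_translate]
    exact hκ κ η
  calc localNorm p r f (mulSchwartz a (translate x κ))
      ≤ weightedLpNorm p r (fun ξ => c * ∫⁻ η, weight (-N) (ξ - η) * ‖f (charMul η a)‖ₑ) :=
        weightedLpNorm_mono (enorm_apply_charMul_mul_le f a _ hc hκx)
    _ ≤ c * (C * localNorm p r f a) := by
        refine (weightedLpNorm_const_mul_le _ _ _ hc).trans ?_
        gcongr
        exact hC _ (continuous_apply_charMul f a).enorm.measurable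
    _ = _ := by push_cast; ring

end Characters

/-! ### Change of window -/

section Windows

variable {d : ℕ} {E : Type*} [NormedAddCommGroup E] [NormedSpace ℂ E]

lemma continuous_translate_left (g : 𝓢(Rd d, ℂ)) : Continuous fun x => translate x g :=
  continuous_translate continuous_id continuous_const

lemma measurable_enorm_apply_charMul (f : 𝓢(Rd d, ℂ) →L[ℂ] E) {a : Rd d → 𝓢(Rd d, ℂ)}
    (ha : Continuous a) :
    Measurable (Function.uncurry fun x ξ : Rd d => ‖f (charMul ξ (a x))‖ₑ) :=
  (f.continuous.comp
    (continuous_charMul continuous_snd (ha.comp continuous_fst))).enorm.measurable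

lemma measurable_localNorm (p : ℝ≥0∞) (r : ℝ) (f : 𝓢(Rd d, ℂ) →L[ℂ] E)
    {a : Rd d → 𝓢(Rd d, ℂ)} (ha : Continuous a) : Measurable fun x => localNorm p r f (a x) :=
  measurable_weightedLpNorm_left p r (measurable_enorm_apply_charMul f ha)

lemma conjSchwartz_translate (x : Rd d) (g : 𝓢(Rd d, ℂ)) :
    conjSchwartz (translate x g) = translate x (conjSchwartz g) := by
  ext y
  simp [conjSchwartz_apply]

lemma amalgamNorm_eq (p q : ℝ≥0∞) (r s : ℝ) (g : 𝓢(Rd d, ℂ)) (f : 𝓢'(Rd d, E)) :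
    amalgamNorm p q r s g f = weightedLpNorm q s fun x =>
      localNorm p r (f : 𝓢(Rd d, ℂ) →L[ℂ] E) (translate x (conjSchwartz g)) := by
  simp only [← conjSchwartz_translate]
  rfl

lemma conjSchwartz_ne_zero {g : 𝓢(Rd d, ℂ)} (hg : g ≠ 0) : conjSchwartz g ≠ 0 := by
  contrapose hg
  ext y
  simpa [conjSchwartz_apply] using congrArg (fun φ : 𝓢(Rd d, ℂ) => φ y) hg

lemma integral_mul_conj_ne_zero {g : 𝓢(Rd d, ℂ)} (hg : g ≠ 0) :
    ∫ x, mulSchwartz g (conjSchwartz g) x ≠ 0 := by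
  have hsq (x : Rd d) : mulSchwartz g (conjSchwartz g) x = ((‖g x‖ ^ 2 : ℝ) : ℂ) := by
    rw [mulSchwartz_apply, conjSchwartz_apply, Complex.mul_conj, Complex.normSq_eq_norm_sq]
  have hint : Integrable fun x => ‖g x‖ ^ 2 := by
    simpa [hsq, ← Complex.ofReal_pow] using (mulSchwartz g (conjSchwartz g)).integrable.norm
  obtain ⟨x₀, hx₀⟩ := DFunLike.ne_iff.1 hg
  have hpos : 0 < ∫ x, ‖g x‖ ^ 2 :=
    integral_pos_of_integrable_nonneg_nonzero (x := x₀) (by fun_prop) hint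
      (fun x => by positivity) (by simpa using hx₀)
  simp only [hsq, integral_complex_ofReal]
  exact_mod_cast hpos.ne'

lemma exists_integral_mul_eq_one {g : 𝓢(Rd d, ℂ)} (hg : g ≠ 0) :
    ∃ γ : 𝓢(Rd d, ℂ), ∫ x, mulSchwartz g γ x = 1 := by
  refine ⟨(∫ x, mulSchwartz g (conjSchwartz g) x)⁻¹ • conjSchwartz g, ?_⟩
  simp only [map_smul, smul_apply, smul_eq_mul]
  rw [integral_const_mul, inv_mul_cancel₀ (integral_mul_conj_ne_zero hg)]

lemma mul_translate_mul_translate (g g' γ : 𝓢(Rd d, ℂ)) (x z : Rd d) :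
    mulSchwartz (translate z g') (translate x (mulSchwartz g γ)) =
      mulSchwartz (translate x g) (translate x (mulSchwartz γ (translate (z - x) g'))) := by
  ext y
  simp only [mulSchwartz_apply, SchwartzMap.compSubConstCLM_apply, sub_sub_sub_cancel_right]
  ring

variable [CompleteSpace E]

lemma localNorm_le_lintegral {p : ℝ≥0∞} (hp : 1 ≤ p) (r : ℝ) (f : 𝓢(Rd d, ℂ) →L[ℂ] E)
    {G : 𝓢(Rd d, ℂ)} (hG : ∫ x, G x = 1) (a : 𝓢(Rd d, ℂ)) :
    localNorm p r f a ≤ ∫⁻ x, localNorm p r f (mulSchwartz a (translate x G)) := by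
  calc localNorm p r f a
      ≤ weightedLpNorm p r (fun ξ => ∫⁻ x, ‖f (charMul ξ (mulSchwartz a (translate x G)))‖ₑ) := by
        refine weightedLpNorm_mono fun ξ => ?_
        rw [apply_eq_integral_translate f hG]
        simp only [charMul_mulSchwartz]
        exact enorm_integral_le_lintegral_enorm _
    _ ≤ _ := weightedLpNorm_lintegral_le hp r (measurable_enorm_apply_charMul f
        ((mulSchwartz a).continuous.comp (continuous_translate_left G)))

lemma exists_localNorm_mul_translate_mul_le {p : ℝ≥0∞} (hp : 1 ≤ p) (r : ℝ) (N : ℕ)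
    (g g' γ : 𝓢(Rd d, ℂ)) : ∃ C : ℝ≥0, ∀ (f : 𝓢(Rd d, ℂ) →L[ℂ] E) (x z : Rd d),
      localNorm p r f (mulSchwartz (translate z g') (translate x (mulSchwartz g γ))) ≤
        C * (weight (-(N : ℝ)) (z - x) * localNorm p r f (translate x g)) := by
  obtain ⟨m, C, hC⟩ := exists_localNorm_mul_translate_le (E := E) d hp r
  set c : ℝ := 2 ^ m *
    ((2 ^ (m + N) * supSeminorm (m + N) γ) * (2 ^ (m + N) * supSeminorm (m + N) g'))
  refine ⟨C * c.toNNReal, fun f x z => ?_⟩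
  have hseminorm : ENNReal.ofReal (supSeminorm m (mulSchwartz γ (translate (z - x) g'))) ≤
      ENNReal.ofReal c * weight (-(N : ℝ)) (z - x) :=
    ofReal_le_mul_weight (apply_nonneg _ _) (supSeminorm_mul_translate_le m N γ g' (z - x))
  calc localNorm p r f (mulSchwartz (translate z g') (translate x (mulSchwartz g γ)))
      ≤ C * ENNReal.ofReal (supSeminorm m (mulSchwartz γ (translate (z - x) g'))) *
          localNorm p r f (translate x g) := by
        rw [mul_translate_mul_translate]
        exact hC f _ _ x
    _ ≤ C * (ENNReal.ofReal c * weight (-(N : ℝ)) (z - x)) * localNorm p r f (translate x g) := by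
        gcongr
    _ = _ := by
        rw [ENNReal.ofReal, ENNReal.coe_mul]
        ring

/-- Writing `1 = ∫ T_x (g γ) dx`, the piece `f T_z g'` is a superposition of the multiples
`f T_x g · T_x (γ T_{z - x} g')` of the pieces `f T_x g`, with rapid decay in `z - x`. -/
theorem exists_windowChange_le {p q : ℝ≥0∞} (hp : 1 ≤ p) (hq : 1 ≤ q) (r s : ℝ)
    {g : 𝓢(Rd d, ℂ)} (hg : g ≠ 0) (g' : 𝓢(Rd d, ℂ)) :
    ∃ C : ℝ≥0, ∀ f : 𝓢(Rd d, ℂ) →L[ℂ] E,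
      weightedLpNorm q s (fun z => localNorm p r f (translate z g')) ≤
        C * weightedLpNorm q s (fun x => localNorm p r f (translate x g)) := by
  obtain ⟨γ, hγ⟩ := exists_integral_mul_eq_one hg
  obtain ⟨N, hN⟩ := exists_nat_gt (d + |s|)
  obtain ⟨C, hC⟩ := exists_localNorm_mul_translate_mul_le (E := E) hp r N g g' γ
  obtain ⟨K, hK⟩ := exists_weightedLpNorm_conv_weight_le (d := d) hq s hN
  refine ⟨C * K, fun f => ?_⟩
  have hpiece (z : Rd d) : localNorm p r f (translate z g') ≤
      C * ∫⁻ x, weight (-(N : ℝ)) (z - x) * localNorm p r f (translate x g) := by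
    rw [← lintegral_const_mul' _ _ ENNReal.coe_ne_top]
    exact (localNorm_le_lintegral hp r f hγ _).trans (lintegral_mono fun x => hC f x z)
  refine (weightedLpNorm_mono hpiece).trans
    ((weightedLpNorm_const_mul_le _ _ _ ENNReal.coe_ne_top).trans ?_)
  rw [ENNReal.coe_mul, mul_assoc]
  gcongr
  exact hK _ (measurable_localNorm p r f (continuous_translate_left g))

end Windows

section Truncation

variable {d : ℕ} {E : Type*} [NormedAddCommGroup E] [NormedSpace ℂ E]

lemma norm_iteratedFDeriv_dilate_le (χ : 𝓢(Rd d, ℂ)) (n : ℕ) {k m : ℕ} (hk : k ≤ m) (y : Rd d) :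
    ‖iteratedFDeriv ℝ k (dilate χ n) y‖ ≤ 2 ^ m * supSeminorm m χ := by
  have hscale : |(n + 1 : ℝ)⁻¹| ^ k ≤ 1 := by
    rw [abs_of_nonneg (by positivity)]
    exact pow_le_one₀ (by positivity) (inv_le_one_of_one_le₀ (by linarith [n.cast_nonneg (α := ℝ)]))
  rw [funext (dilate_apply χ n), iteratedFDeriv_comp_const_smul _ (χ.smooth k), norm_smul, norm_pow,
    Real.norm_eq_abs]
  refine (mul_le_of_le_one_left (norm_nonneg _) hscale).trans ?_
  simpa using one_add_pow_mul_le_supSeminorm (Nat.zero_le m) hk χ ((n + 1 : ℝ)⁻¹ • y)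

lemma exists_localNorm_truncation_le [CompleteSpace E] {p : ℝ≥0∞} (hp : 1 ≤ p) (r : ℝ)
    {ψ ρ : 𝓢(Rd d, ℂ)} (hρ : ∀ y, ψ y ≠ 0 → ρ y = 1) (χ : 𝓢(Rd d, ℂ)) :
    ∃ C : ℝ≥0, ∀ (f : 𝓢(Rd d, ℂ) →L[ℂ] E) (n : ℕ) (x : Rd d),
      localNorm p r f (mulSchwartz (translate x ψ) (dilate χ n)) ≤
        C * localNorm p r f (translate x ψ) := by
  obtain ⟨m, C, hC⟩ := exists_localNorm_mul_translate_le (E := E) d hp r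
  set c : ℝ := 2 ^ m * ((2 ^ m * supSeminorm m χ) * (2 ^ m * supSeminorm m ρ))
  refine ⟨C * c.toNNReal, fun f n x => ?_⟩
  have hinsert : mulSchwartz (translate x ψ) (dilate χ n) = mulSchwartz (translate x ψ)
      (translate x (mulSchwartz (translate (-x) (dilate χ n)) ρ)) := by
    ext y
    simp only [mulSchwartz_apply, SchwartzMap.compSubConstCLM_apply, sub_neg_eq_add, sub_add_cancel]
    rcases eq_or_ne (ψ (y - x)) 0 with hψ | hψ
    · simp [hψ]
    · rw [hρ _ hψ, mul_one]
  have hseminorm : supSeminorm m (mulSchwartz (translate (-x) (dilate χ n)) ρ) ≤ c := by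
    refine supSeminorm_mul_le_of_bounded m _ _ fun k hk y => ?_
    rw [iteratedFDeriv_translate]
    exact norm_iteratedFDeriv_dilate_le χ n hk _
  rw [hinsert]
  refine (hC f _ _ x).trans ?_
  rw [ENNReal.coe_mul]
  gcongr
  exact ENNReal.ofReal_le_ofReal hseminorm

lemma exists_bump (d : ℕ) {R : ℝ} (hR : 0 < R) : ∃ ρ : 𝓢(Rd d, ℂ), (∀ y, ‖y‖ ≤ R → ρ y = 1) ∧
    (∀ y, R + 1 ≤ ‖y‖ → ρ y = 0) ∧ HasCompactSupport ρ ∧ ∫ y, ρ y ≠ 0 := by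
  let b : ContDiffBump (0 : Rd d) := ⟨R, R + 1, hR, by linarith⟩
  have hcompact : HasCompactSupport fun y => (b y : ℂ) :=
    b.hasCompactSupport.comp_left (g := fun t : ℝ => (t : ℂ)) Complex.ofReal_zero
  have hsmooth : ContDiff ℝ ((⊤ : ℕ∞) : WithTop ℕ∞) fun y => (b y : ℂ) :=
    Complex.ofRealCLM.contDiff.comp (f := fun y => b y) b.contDiff
  refine ⟨hcompact.toSchwartzMap hsmooth, fun y hy => ?_, fun y hy => ?_, hcompact, ?_⟩
  · simp [b.one_of_mem_closedBall (x := y) (by simpa using hy)]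
  · simp [b.zero_of_le_dist (x := y) (by simpa using hy)]
  · simp only [HasCompactSupport.toSchwartzMap_toFun, integral_complex_ofReal]
    exact_mod_cast (b.integral_pos (μ := volume)).ne'

end Truncation

/-! ### Distributions given by functions, and localization of distributions -/

section Distribution

variable {d : ℕ} {E : Type*} [NormedAddCommGroup E] [NormedSpace ℂ E]

lemma IsGivenBy.locallyIntegrable {T : 𝓢'(Rd d, E)} {u : Rd d → E} (h : IsGivenBy T u) :
    LocallyIntegrable u volume := by
  rw [locallyIntegrable_iff]
  intro K hK
  obtain ⟨R, hR0, hR⟩ := hK.isBounded.exists_pos_norm_le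
  obtain ⟨ρ, hρ, -⟩ := exists_bump d hR0
  refine (h.2 ρ).1.integrableOn.congr_fun (fun y hy => ?_) hK.measurableSet
  simp only [hρ y (hR y hy), one_smul]

lemma IsGivenBy.ae_eq [CompleteSpace E] {T : 𝓢'(Rd d, E)} {u v : Rd d → E} (hu : IsGivenBy T u)
    (hv : IsGivenBy T v) : u =ᵐ[volume] v := by
  refine ae_eq_of_integral_contDiff_smul_eq hu.locallyIntegrable hv.locallyIntegrable
    fun g hg hgs => ?_
  have hs : HasCompactSupport fun y => (g y : ℂ) := hgs.comp_left (g := Complex.ofReal) rfl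
  have hc : ContDiff ℝ ((⊤ : ℕ∞) : WithTop ℕ∞) fun y => (g y : ℂ) :=
    Complex.ofRealCLM.contDiff.comp hg
  have huv := (hu.2 (hs.toSchwartzMap hc)).2.symm.trans (hv.2 (hs.toSchwartzMap hc)).2
  simpa using huv

lemma fourierLebesgueNorm_eq [CompleteSpace E] {f : 𝓢'(Rd d, E)} {u : Rd d → E}
    (hu : IsGivenBy (𝓕⁻ f) u) (p : ℝ≥0∞) (r : ℝ) :
    fourierLebesgueNorm p r f = weightedLpNorm p r fun ξ => ‖u ξ‖ₑ := by
  refine le_antisymm (iInf₂_le _ hu) (le_iInf₂ fun v hv => (weightedLpNorm_congr_ae ?_).le)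
  filter_upwards [hu.ae_eq hv] with ξ hξ using by rw [hξ]

lemma isGivenBy_fourierInv {f : 𝓢'(Rd d, E)} {u : Rd d → E} (hu : Continuous u)
    (hint : ∀ φ : 𝓢(Rd d, ℂ), Integrable fun ξ => φ ξ • u ξ)
    (hf : ∀ φ : 𝓢(Rd d, ℂ), (𝓕 f) φ = ∫ ξ, φ ξ • u ξ) :
    IsGivenBy (𝓕⁻ f) fun ξ => u (-ξ) := by
  refine ⟨(hu.comp continuous_neg).aestronglyMeasurable, fun φ => ?_⟩
  have hφ : 𝓕⁻ φ = 𝓕 (𝓕⁻ (𝓕⁻ φ)) := (FourierTransform.fourier_fourierInv_eq _).symm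
  have hreflect : ∀ ξ, (𝓕⁻ (𝓕⁻ φ)) ξ = φ (-ξ) := fun ξ => by
    rw [fourierInv_schwartz_eq_neg, FourierTransform.fourier_fourierInv_eq]
  constructor
  · simpa only [hreflect, neg_neg] using (hint (𝓕⁻ (𝓕⁻ φ))).comp_neg
  · rw [TemperedDistribution.fourierInv_apply, hφ, ← TemperedDistribution.fourier_apply, hf,
      ← integral_neg_eq_self]
    simp only [hreflect, neg_neg]

lemma fourierLebesgueNorm_eq_of_fourier_apply [CompleteSpace E] {f : 𝓢'(Rd d, E)} {u : Rd d → E}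
    (hu : Continuous u) (hint : ∀ φ : 𝓢(Rd d, ℂ), Integrable fun ξ => φ ξ • u ξ)
    (hf : ∀ φ : 𝓢(Rd d, ℂ), (𝓕 f) φ = ∫ ξ, φ ξ • u ξ) (p : ℝ≥0∞) (r : ℝ) :
    fourierLebesgueNorm p r f = weightedLpNorm p r fun ξ => ‖u ξ‖ₑ := by
  rw [fourierLebesgueNorm_eq (isGivenBy_fourierInv hu hint hf)]
  exact weightedLpNorm_comp_neg p r (F := fun ξ => ‖u ξ‖ₑ) hu.enorm.measurable.aemeasurable

/-- The localization `a f` of the distribution `f` to the support of the Schwartz function `a`. -/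
def mulDistribution (a : 𝓢(Rd d, ℂ)) (f : 𝓢(Rd d, ℂ) →L[ℂ] E) : 𝓢'(Rd d, E) :=
  (f.comp (mulSchwartz a) : 𝓢(Rd d, ℂ) →L[ℂ] E)

lemma mulDistribution_apply (a : 𝓢(Rd d, ℂ)) (f : 𝓢(Rd d, ℂ) →L[ℂ] E) (φ : 𝓢(Rd d, ℂ)) :
    mulDistribution a f φ = f (mulSchwartz a φ) := rfl

lemma fourierLebesgueNorm_mulDistribution [CompleteSpace E] (p : ℝ≥0∞) (r : ℝ) (a : 𝓢(Rd d, ℂ))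
    (f : 𝓢(Rd d, ℂ) →L[ℂ] E) :
    fourierLebesgueNorm p r (mulDistribution a f) = localNorm p r f a :=
  fourierLebesgueNorm_eq_of_fourier_apply (continuous_apply_charMul f a)
    (integrable_smul_apply_charMul f a) (apply_mul_fourier f a) p r

lemma fourierOfTruncation_mulDistribution (a χ : 𝓢(Rd d, ℂ)) (f : 𝓢(Rd d, ℂ) →L[ℂ] E)
    (ξ : Rd d) : fourierOfTruncation χ (mulDistribution a f) ξ =
      f (charMul ξ (mulSchwartz a χ)) := by
  rw [fourierOfTruncation, mulDistribution_apply, charMul_mulSchwartz]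
  congr 1
  ext y
  simp only [mulSchwartz_apply, charMul_apply]
  ring

end Distribution

section Cutoff

variable {d : ℕ}

lemma exists_isCutoff (d : ℕ) : ∃ χ : 𝓢(Rd d, ℂ), IsCutoff χ := by
  obtain ⟨ρ, hρ, -, hsupp, -⟩ := exists_bump d one_pos
  refine ⟨ρ, hsupp, ?_⟩
  filter_upwards [Metric.closedBall_mem_nhds (0 : Rd d) one_pos] with y hy
  exact hρ y (mem_closedBall_zero_iff.1 hy)

lemma IsCutoff.eventually_dilate_eq_one {χ : 𝓢(Rd d, ℂ)} (hχ : IsCutoff χ) (R : ℝ) :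
    ∀ᶠ n : ℕ in atTop, ∀ y : Rd d, ‖y‖ ≤ R → dilate χ n y = 1 := by
  obtain ⟨ε, hε, hball⟩ := Metric.eventually_nhds_iff.1 hχ.2
  have hlim : Tendsto (fun n : ℕ => ((n : ℝ) + 1) * ε) atTop atTop :=
    (tendsto_natCast_atTop_atTop.atTop_add tendsto_const_nhds).atTop_mul_const hε
  filter_upwards [hlim.eventually_gt_atTop R] with n hn y hy
  have hn1 : (0 : ℝ) < n + 1 := by positivity
  rw [dilate_apply]
  refine hball ?_
  rw [dist_zero_right, norm_smul, Real.norm_of_nonneg (by positivity), inv_mul_lt_iff₀ hn1]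
  exact hy.trans_lt hn

lemma IsCutoff.eventually_mul_dilate_eq {χ a : 𝓢(Rd d, ℂ)} (hχ : IsCutoff χ)
    (ha : HasCompactSupport a) : ∀ᶠ n : ℕ in atTop, mulSchwartz a (dilate χ n) = a := by
  obtain ⟨R, hR⟩ := ha.isCompact.isBounded.exists_norm_le
  filter_upwards [hχ.eventually_dilate_eq_one R] with n hn
  exact mulSchwartz_eq_left fun y hy => hn y (hR y (subset_tsupport a hy))

end Cutoff

/-! ### Products of localized Fourier transforms -/

section ProdSymbol

variable {d : ℕ}

lemma integrable_norm_mul_one_add_pow (φ : 𝓢(Rd d, ℂ)) (k : ℕ) :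
    Integrable fun ξ => ‖φ ξ‖ * (1 + ‖ξ‖) ^ k := by
  have hcont : Continuous fun ξ => ‖φ ξ‖ * (1 + ‖ξ‖) ^ k := by fun_prop
  refine integrable_of_one_add_pow_mul_le hcont.aestronglyMeasurable
    (c := 2 ^ (d + 1 + k) * supSeminorm (d + 1 + k) φ) fun ξ => ?_
  calc (1 + ‖ξ‖) ^ (d + 1) * ‖‖φ ξ‖ * (1 + ‖ξ‖) ^ k‖
      = (1 + ‖ξ‖) ^ (d + 1 + k) * ‖φ ξ‖ := by
        rw [Real.norm_of_nonneg (by positivity), pow_add]; ring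
    _ ≤ _ := one_add_pow_mul_norm_le _ φ ξ

variable {E₁ E₂ E₃ : Type*} [NormedAddCommGroup E₁] [NormedSpace ℂ E₁] [NormedAddCommGroup E₂]
  [NormedSpace ℂ E₂] [NormedAddCommGroup E₃] [NormedSpace ℂ E₃]

section

variable (B : E₁ →L[ℂ] E₂ →L[ℂ] E₃) (f₁ : 𝓢(Rd d, ℂ) →L[ℂ] E₁) (f₂ : 𝓢(Rd d, ℂ) →L[ℂ] E₂)

/-- The pointwise `•`-product of the Fourier transforms of `a f₁` and `b f₂`. For compactly
supported `a` and `b` it is the Fourier transform of `(a f₁) *_• (b f₂)`. -/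
def prodSymbol (a b : 𝓢(Rd d, ℂ)) (ξ : Rd d) : E₃ := B (f₁ (charMul ξ a)) (f₂ (charMul ξ b))

lemma continuous_prodSymbol {X : Type*} [TopologicalSpace X] {a b : X → 𝓢(Rd d, ℂ)} {u : X → Rd d}
    (ha : Continuous a) (hb : Continuous b) (hu : Continuous u) :
    Continuous fun x => prodSymbol B f₁ f₂ (a x) (b x) (u x) :=
  (B.continuous.comp (f₁.continuous.comp (continuous_charMul hu ha))).clm_apply
    (f₂.continuous.comp (continuous_charMul hu hb))

lemma continuous_prodSymbol_right (a b : 𝓢(Rd d, ℂ)) : Continuous (prodSymbol B f₁ f₂ a b) :=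
  continuous_prodSymbol B f₁ f₂ continuous_const continuous_const continuous_id

lemma exists_norm_prodSymbol_le (b : 𝓢(Rd d, ℂ)) : ∃ (k m : ℕ) (C : ℝ≥0), ∀ (a : 𝓢(Rd d, ℂ)) ξ,
    ‖prodSymbol B f₁ f₂ a b ξ‖ ≤ C * supSeminorm m a * (1 + ‖ξ‖) ^ k := by
  obtain ⟨m, C, hf₁⟩ := exists_norm_le_supSeminorm f₁
  obtain ⟨k₁, m', C₁, hchar⟩ := exists_supSeminorm_charMul_le (d := d) m
  obtain ⟨k₂, C₂, hf₂⟩ := exists_norm_apply_charMul_le f₂ b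
  refine ⟨k₁ + k₂, m', ‖B‖₊ * C * C₁ * C₂, fun a ξ => ?_⟩
  calc ‖prodSymbol B f₁ f₂ a b ξ‖ ≤ ‖B‖ * ‖f₁ (charMul ξ a)‖ * ‖f₂ (charMul ξ b)‖ :=
        B.le_opNorm₂ _ _
    _ ≤ ‖B‖ * (C * (C₁ * (1 + ‖ξ‖) ^ k₁ * supSeminorm m' a)) * (C₂ * (1 + ‖ξ‖) ^ k₂) := by
        gcongr
        · exact (hf₁ _).trans (mul_le_mul_of_nonneg_left (hchar ξ a) C.coe_nonneg)
        · exact hf₂ ξ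
    _ = _ := by push_cast; rw [pow_add]; ring

lemma integrable_smul_prodSymbol (a b φ : 𝓢(Rd d, ℂ)) :
    Integrable fun ξ => φ ξ • prodSymbol B f₁ f₂ a b ξ := by
  obtain ⟨k, m, C, hle⟩ := exists_norm_prodSymbol_le B f₁ f₂ b
  refine ((integrable_norm_mul_one_add_pow φ k).const_mul (C * supSeminorm m a)).mono'
    (φ.continuous.smul (continuous_prodSymbol_right B f₁ f₂ a b)).aestronglyMeasurable
    (Eventually.of_forall fun ξ => ?_)
  calc ‖φ ξ • prodSymbol B f₁ f₂ a b ξ‖ = ‖φ ξ‖ * ‖prodSymbol B f₁ f₂ a b ξ‖ := norm_smul _ _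
    _ ≤ ‖φ ξ‖ * (C * supSeminorm m a * (1 + ‖ξ‖) ^ k) := by gcongr; exact hle a ξ
    _ = _ := by ring

end

variable {B : E₁ →L[ℂ] E₂ →L[ℂ] E₃}

lemma IsConvolution.fourier_apply_of_hasCompactSupport {f₁ : 𝓢(Rd d, ℂ) →L[ℂ] E₁}
    {f₂ : 𝓢(Rd d, ℂ) →L[ℂ] E₂} {a b : 𝓢(Rd d, ℂ)} {h : 𝓢'(Rd d, E₃)}
    (hconv : IsConvolution B (mulDistribution a f₁) (mulDistribution b f₂) h)
    (ha : HasCompactSupport a) (hb : HasCompactSupport b) (φ : 𝓢(Rd d, ℂ)) :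
    (𝓕 h) φ = ∫ ξ, φ ξ • prodSymbol B f₁ f₂ a b ξ := by
  obtain ⟨χ, hχ⟩ := exists_isCutoff d
  refine tendsto_nhds_unique (hconv χ χ hχ hχ φ) (tendsto_const_nhds.congr' ?_)
  filter_upwards [hχ.eventually_mul_dilate_eq ha, hχ.eventually_mul_dilate_eq hb] with n hna hnb
  simp only [fourierOfTruncation_mulDistribution, hna, hnb, prodSymbol]

variable [CompleteSpace E₁] [CompleteSpace E₂] [CompleteSpace E₃]

theorem FourierLebesgueConvEmbeds.exists_prodSymbol_le {p₁ p₂ p₃ : ℝ≥0∞} {r₁ r₂ r₃ : ℝ}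
    (hB : FourierLebesgueConvEmbeds d B p₁ p₂ p₃ r₁ r₂ r₃) :
    ∃ C : ℝ≥0, ∀ (f₁ : 𝓢(Rd d, ℂ) →L[ℂ] E₁) (f₂ : 𝓢(Rd d, ℂ) →L[ℂ] E₂) (a b : 𝓢(Rd d, ℂ)),
      HasCompactSupport a → HasCompactSupport b →
      localNorm p₁ r₁ f₁ a < ∞ → localNorm p₂ r₂ f₂ b < ∞ →
      weightedLpNorm p₃ r₃ (fun ξ => ‖prodSymbol B f₁ f₂ a b ξ‖ₑ) ≤
        C * (localNorm p₁ r₁ f₁ a * localNorm p₂ r₂ f₂ b) := by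
  obtain ⟨C, hC⟩ := hB
  refine ⟨C, fun f₁ f₂ a b ha hb hfin₁ hfin₂ => ?_⟩
  rw [← fourierLebesgueNorm_mulDistribution] at hfin₁ hfin₂ ⊢
  obtain ⟨h, hconv, -, hnorm⟩ := hC _ _ hfin₁ hfin₂
  rwa [fourierLebesgueNorm_eq_of_fourier_apply (continuous_prodSymbol_right B f₁ f₂ a b)
    (integrable_smul_prodSymbol B f₁ f₂ a b) (hconv.fourier_apply_of_hasCompactSupport ha hb),
    fourierLebesgueNorm_mulDistribution p₂, mul_assoc] at hnorm

end ProdSymbol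

/-! ### Pairings with products of localized Fourier transforms -/

section Pairing

variable {d : ℕ}

lemma fourier_charMul_apply (η : Rd d) (φ : 𝓢(Rd d, ℂ)) (s : Rd d) :
    (𝓕 (charMul η φ)) s = (𝓕 φ) (s + η) := by
  rw [fourier_schwartz_apply, fourier_schwartz_apply]
  refine integral_congr_ae (Eventually.of_forall fun y => ?_)
  simp only [charMul_apply, character_add_left]
  ring

lemma fourier_mul_fourier_apply (K a : 𝓢(Rd d, ℂ)) (t : Rd d) :
    (𝓕 (mulSchwartz K (𝓕 a))) t = ∫ s, (𝓕 K) (s + t) * a s := by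
  have hdual := SchwartzMap.integral_fourier_mul_eq (charMul t K) a
  simp only [fourier_charMul_apply] at hdual
  rw [hdual, fourier_schwartz_apply]
  refine integral_congr_ae (Eventually.of_forall fun ξ => ?_)
  simp only [charMul_apply, mulSchwartz_apply]
  ring

lemma fourierInv_apply_sub (a : 𝓢(Rd d, ℂ)) (ζ ξ : Rd d) :
    (𝓕⁻ a) (ζ - ξ) = (𝓕 (charMul (-ζ) a)) ξ := by
  rw [fourier_charMul_apply, fourierInv_schwartz_eq_neg, neg_sub, sub_eq_add_neg]

lemma mul_fourier_mul_fourier_eq_zero {a b K : 𝓢(Rd d, ℂ)}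
    (hK : ∀ s ∈ Function.support a, ∀ t ∈ Function.support b, (𝓕 K) (s + t) = 0) :
    mulSchwartz b (𝓕 (mulSchwartz K (𝓕 a))) = 0 := by
  ext t
  rw [mulSchwartz_apply, fourier_mul_fourier_apply, zero_apply, mul_eq_zero]
  refine or_iff_not_imp_left.2 fun ht => ?_
  refine (integral_congr_ae (Eventually.of_forall fun s => ?_)).trans (integral_zero _ _)
  by_cases hs : a s = 0
  · simp only [hs, mul_zero]
  · simp only [hK s hs t ht, zero_mul]

lemma one_add_norm_pow_le (k : ℕ) (ζ ξ : Rd d) :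
    (1 + ‖ζ‖) ^ k ≤ (1 + ‖ξ‖) ^ k * (1 + ‖ζ - ξ‖) ^ k := by
  rw [← mul_pow]
  exact pow_le_pow_left₀ (by positivity) (one_add_norm_le_mul_sub ξ ζ) _

variable {E₁ E₂ E₃ : Type*} [NormedAddCommGroup E₁] [NormedSpace ℂ E₁] [NormedAddCommGroup E₂]
  [NormedSpace ℂ E₂] [NormedAddCommGroup E₃] [NormedSpace ℂ E₃] (B : E₁ →L[ℂ] E₂ →L[ℂ] E₃)

lemma integrable_smul_bilin_sub_smul {u : Rd d → E₁} {v : Rd d → E₂} (hu : Continuous u)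
    (hv : Continuous v) {k₁ k₂ : ℕ} {C₁ C₂ : ℝ≥0} (hu_le : ∀ ξ, ‖u ξ‖ ≤ C₁ * (1 + ‖ξ‖) ^ k₁)
    (hv_le : ∀ ξ, ‖v ξ‖ ≤ C₂ * (1 + ‖ξ‖) ^ k₂) (K κ : 𝓢(Rd d, ℂ)) :
    Integrable fun z : Rd d × Rd d => K z.2 • B (κ (z.1 - z.2) • u z.1) (v z.2) := by
  have hdom : Integrable fun z : Rd d × Rd d => (‖K z.2‖ * (1 + ‖z.2‖) ^ (k₁ + k₂)) *
      (‖κ (z.1 - z.2)‖ * (1 + ‖z.1 - z.2‖) ^ k₁) :=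
    (integrable_norm_mul_one_add_pow K (k₁ + k₂)).convolution_integrand
      (ContinuousLinearMap.mul ℝ ℝ) (integrable_norm_mul_one_add_pow κ k₁)
  have hcont : Continuous fun z : Rd d × Rd d => K z.2 • B (κ (z.1 - z.2) • u z.1) (v z.2) :=
    (K.continuous.comp continuous_snd).smul ((B.continuous.comp
      ((κ.continuous.comp (continuous_fst.sub continuous_snd)).smul
        (hu.comp continuous_fst))).clm_apply (hv.comp continuous_snd))
  refine (hdom.const_mul (‖B‖ * C₁ * C₂)).mono' hcont.aestronglyMeasurable
    (Eventually.of_forall fun ⟨ζ, ξ⟩ => ?_)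
  calc ‖K ξ • B (κ (ζ - ξ) • u ζ) (v ξ)‖
      ≤ ‖K ξ‖ * (‖B‖ * (‖κ (ζ - ξ)‖ * ‖u ζ‖) * ‖v ξ‖) := by
        rw [norm_smul, ← norm_smul (κ _)]
        gcongr
        exact B.le_opNorm₂ _ _
    _ ≤ ‖K ξ‖ * (‖B‖ * (‖κ (ζ - ξ)‖ * (C₁ * ((1 + ‖ξ‖) ^ k₁ * (1 + ‖ζ - ξ‖) ^ k₁))) *
          (C₂ * (1 + ‖ξ‖) ^ k₂)) := by
        gcongr
        · exact (hu_le ζ).trans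
            (mul_le_mul_of_nonneg_left (one_add_norm_pow_le k₁ ζ ξ) C₁.coe_nonneg)
        · exact hv_le ξ
    _ = _ := by simp only; rw [pow_add]; ring

variable (f₁ : 𝓢(Rd d, ℂ) →L[ℂ] E₁) (f₂ : 𝓢(Rd d, ℂ) →L[ℂ] E₂)

/-- The integral of a test function `φ` against `prodSymbol B f₁ f₂ a b`, linear in `φ`. For
compactly supported `a` and `b` it is the value at `φ` of the Fourier transform of
`(a f₁) *_• (b f₂)`. -/
def pairing (a b : 𝓢(Rd d, ℂ)) : 𝓢(Rd d, ℂ) →ₗ[ℂ] E₃ where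
  toFun φ := ∫ ξ, φ ξ • prodSymbol B f₁ f₂ a b ξ
  map_add' φ φ' := by
    simp only [add_apply, add_smul]
    exact integral_add (integrable_smul_prodSymbol B f₁ f₂ a b φ)
      (integrable_smul_prodSymbol B f₁ f₂ a b φ')
  map_smul' c φ := by
    simp only [smul_apply, smul_eq_mul, mul_smul]
    exact integral_smul _ _

lemma pairing_apply (a b φ : 𝓢(Rd d, ℂ)) :
    pairing B f₁ f₂ a b φ = ∫ ξ, φ ξ • prodSymbol B f₁ f₂ a b ξ := rfl

variable [CompleteSpace E₃]

lemma prodSymbol_eq_integral [CompleteSpace E₁] {a a' : 𝓢(Rd d, ℂ)} (ha : mulSchwartz a a' = a)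
    (b : 𝓢(Rd d, ℂ)) (ξ : Rd d) : prodSymbol B f₁ f₂ a b ξ =
      ∫ ζ, B ((𝓕⁻ a') (ζ - ξ) • f₁ (charMul ζ a)) (f₂ (charMul ξ b)) := by
  have hint : Integrable fun ζ => (𝓕⁻ a') (ζ - ξ) • f₁ (charMul ζ a) :=
    integrable_smul_apply_charMul f₁ a (translate ξ (𝓕⁻ a'))
  have hf₁ : f₁ (charMul ξ a) = ∫ ζ, (𝓕⁻ a') (ζ - ξ) • f₁ (charMul ζ a) := by
    rw [← integral_add_left_eq_self _ ξ]
    simpa only [ha, add_sub_cancel_left] using apply_charMul_mul f₁ a a' ξ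
  rw [prodSymbol, hf₁]
  exact ((B.flip (f₂ (charMul ξ b))).integral_comp_comm hint).symm

variable [CompleteSpace E₂]

lemma integral_smul_bilin_fourierInv_eq (a b K : 𝓢(Rd d, ℂ)) (e : E₁) (ζ : Rd d) :
    ∫ ξ, K ξ • B ((𝓕⁻ a) (ζ - ξ) • e) (f₂ (charMul ξ b)) =
      B e (f₂ (mulSchwartz b (𝓕 (mulSchwartz K (𝓕 (charMul (-ζ) a)))))) := by
  rw [apply_mul_fourier, ← (B e).integral_comp_comm (integrable_smul_apply_charMul f₂ b _)]
  simp only [mulSchwartz_apply, fourierInv_apply_sub, map_smul, smul_apply, smul_smul]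

variable [CompleteSpace E₁]

-- With `f₁ (charMul ξ a) = ∫ 𝓕⁻ a' (ζ - ξ) • f₁ (charMul ζ a) dζ`, integrating over `ξ` first
-- leaves `f₂` evaluated at `b * 𝓕 (K * 𝓕 (charMul (-ζ) a')) = 0`.
theorem pairing_eq_zero {a a' b K : 𝓢(Rd d, ℂ)} (ha : mulSchwartz a a' = a)
    (hK : ∀ s ∈ Function.support a', ∀ t ∈ Function.support b, (𝓕 K) (s + t) = 0) :
    pairing B f₁ f₂ a b K = 0 := by
  obtain ⟨k₁, C₁, hf₁⟩ := exists_norm_apply_charMul_le f₁ a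
  obtain ⟨k₂, C₂, hf₂⟩ := exists_norm_apply_charMul_le f₂ b
  have hint := integrable_smul_bilin_sub_smul B (continuous_apply_charMul f₁ a)
    (continuous_apply_charMul f₂ b) hf₁ hf₂ K (𝓕⁻ a')
  have hsupp (ζ : Rd d) : ∀ s ∈ Function.support (charMul (-ζ) a'),
      ∀ t ∈ Function.support b, (𝓕 K) (s + t) = 0 := fun s hs =>
    hK s fun h => hs (by rw [charMul_apply, h, mul_zero])
  calc pairing B f₁ f₂ a b K
      = ∫ ξ, ∫ ζ, K ξ • B ((𝓕⁻ a') (ζ - ξ) • f₁ (charMul ζ a)) (f₂ (charMul ξ b)) := by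
        simp only [pairing_apply, prodSymbol_eq_integral B f₁ f₂ ha, integral_smul]
    _ = ∫ ζ, ∫ ξ, K ξ • B ((𝓕⁻ a') (ζ - ξ) • f₁ (charMul ζ a)) (f₂ (charMul ξ b)) :=
        (integral_integral_swap hint).symm
    _ = 0 := by
        simp only [integral_smul_bilin_fourierInv_eq, mul_fourier_mul_fourier_eq_zero (hsupp _),
          map_zero, integral_zero]

lemma pairing_eq_of_eqOn {a a' b φ φ' : 𝓢(Rd d, ℂ)} (ha : mulSchwartz a a' = a)
    (hφ : ∀ s ∈ Function.support a', ∀ t ∈ Function.support b, (𝓕 φ) (s + t) = (𝓕 φ') (s + t)) :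
    pairing B f₁ f₂ a b φ = pairing B f₁ f₂ a b φ' := by
  rw [← sub_eq_zero, ← map_sub]
  refine pairing_eq_zero B f₁ f₂ ha fun s hs t ht => ?_
  have hsub : 𝓕 (φ - φ') = 𝓕 φ - 𝓕 φ' := map_sub (FourierTransform.fourierCLM ℂ 𝓢(Rd d, ℂ)) φ φ'
  rw [hsub, sub_apply, hφ s hs t ht, sub_self]

lemma pairing_eq_localized {R : ℝ} (hR : 0 < R) {ρ : 𝓢(Rd d, ℂ)}
    (hρ : ∀ y, ‖y‖ ≤ 2 * R + 1 → ρ y = 1) {a b : 𝓢(Rd d, ℂ)} {x y : Rd d}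
    (ha : Function.support a ⊆ Metric.closedBall x R)
    (hb : Function.support b ⊆ Metric.closedBall y R) (φ : 𝓢(Rd d, ℂ)) :
    pairing B f₁ f₂ a b φ =
      pairing B f₁ f₂ a b (𝓕⁻ (mulSchwartz (𝓕 φ) (translate (x + y) ρ))) := by
  obtain ⟨σ, hσ_one, hσ_zero, -⟩ := exists_bump d hR
  have haσ : mulSchwartz a (translate x σ) = a :=
    mulSchwartz_eq_left fun t ht => hσ_one _ (mem_closedBall_iff_norm.1 (ha ht))
  refine pairing_eq_of_eqOn B f₁ f₂ haσ fun s hs t ht => ?_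
  have hsx : ‖s - x‖ < R + 1 := not_le.1 fun h => hs (hσ_zero _ h)
  have hty : ‖t - y‖ ≤ R := mem_closedBall_iff_norm.1 (hb ht)
  have hst : ‖s + t - (x + y)‖ ≤ 2 * R + 1 := by
    rw [add_sub_add_comm]
    linarith [norm_add_le (s - x) (t - y)]
  rw [FourierTransform.fourier_fourierInv_eq, mulSchwartz_apply,
    SchwartzMap.compSubConstCLM_apply, hρ _ hst, mul_one]

end Pairing

/-! ### Decay of pairings with localized pieces -/

section PairingBounds

variable {d : ℕ}

lemma exists_enorm_fourierInv_mul_translate_le (M N : ℕ) (ρ : 𝓢(Rd d, ℂ)) :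
    ∃ (m : ℕ) (C : ℝ≥0), ∀ (φ : 𝓢(Rd d, ℂ)) (w η : Rd d),
      ‖(𝓕⁻ (mulSchwartz φ (translate w ρ))) η‖ₑ ≤
        C * ENNReal.ofReal (supSeminorm m φ) * weight (-(N : ℝ)) w * weight (-(M : ℝ)) η := by
  obtain ⟨m, C, hC⟩ := exists_enorm_fourierInv_le (d := d) M
  set c : ℝ := 2 ^ m * 2 ^ (m + N) * (2 ^ (m + N) * supSeminorm (m + N) ρ)
  refine ⟨m + N, C * c.toNNReal, fun φ w η => ?_⟩
  have hmul : (1 + ‖w‖) ^ N * supSeminorm m (mulSchwartz φ (translate w ρ)) ≤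
      c * supSeminorm (m + N) φ :=
    (supSeminorm_mul_translate_le m N φ ρ w).trans (le_of_eq (by ring))
  calc ‖(𝓕⁻ (mulSchwartz φ (translate w ρ))) η‖ₑ
      ≤ C * ENNReal.ofReal (supSeminorm m (mulSchwartz φ (translate w ρ))) *
          weight (-(M : ℝ)) η := hC _ η
    _ ≤ C * (ENNReal.ofReal (c * supSeminorm (m + N) φ) * weight (-(N : ℝ)) w) *
          weight (-(M : ℝ)) η := by
        gcongr
        exact ofReal_le_mul_weight (apply_nonneg _ _) hmul
    _ = _ := by
        rw [ENNReal.ofReal_mul (by positivity), ENNReal.ofReal, ENNReal.coe_mul]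
        ring

variable {E₁ E₂ E₃ : Type*} [NormedAddCommGroup E₁] [NormedSpace ℂ E₁] [NormedAddCommGroup E₂]
  [NormedSpace ℂ E₂] [NormedAddCommGroup E₃] [NormedSpace ℂ E₃]

lemma enorm_pairing_le_of_enorm_le (B : E₁ →L[ℂ] E₂ →L[ℂ] E₃) (f₁ : 𝓢(Rd d, ℂ) →L[ℂ] E₁)
    (f₂ : 𝓢(Rd d, ℂ) →L[ℂ] E₂) (a b : 𝓢(Rd d, ℂ)) {φ : 𝓢(Rd d, ℂ)} {c : ℝ≥0∞} (hc : c ≠ ∞)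
    {w : Rd d → ℝ≥0∞} (hφ : ∀ ξ, ‖φ ξ‖ₑ ≤ c * w ξ) :
    ‖pairing B f₁ f₂ a b φ‖ₑ ≤ c * ∫⁻ ξ, w ξ * ‖prodSymbol B f₁ f₂ a b ξ‖ₑ := by
  rw [← lintegral_const_mul' _ _ hc]
  refine (enorm_integral_le_lintegral_enorm _).trans (lintegral_mono fun ξ => ?_)
  rw [enorm_smul, ← mul_assoc]
  gcongr
  exact hφ ξ

variable [CompleteSpace E₁] [CompleteSpace E₂] [CompleteSpace E₃]

lemma exists_enorm_pairing_le_lintegral {R : ℝ} (hR : 0 < R) (M N : ℕ) : ∃ (m : ℕ) (C : ℝ≥0),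
    ∀ (B : E₁ →L[ℂ] E₂ →L[ℂ] E₃) (f₁ : 𝓢(Rd d, ℂ) →L[ℂ] E₁) (f₂ : 𝓢(Rd d, ℂ) →L[ℂ] E₂)
      (a b φ : 𝓢(Rd d, ℂ)) (x y : Rd d), Function.support a ⊆ Metric.closedBall x R →
      Function.support b ⊆ Metric.closedBall y R → ‖pairing B f₁ f₂ a b φ‖ₑ ≤
        C * ENNReal.ofReal (supSeminorm m φ) * weight (-(N : ℝ)) (x + y) *
          ∫⁻ ξ, weight (-(M : ℝ)) ξ * ‖prodSymbol B f₁ f₂ a b ξ‖ₑ := by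
  obtain ⟨ρ, hρ, -⟩ := exists_bump d (R := 2 * R + 1) (by positivity)
  obtain ⟨m', C, hdecay⟩ := exists_enorm_fourierInv_mul_translate_le M N ρ
  obtain ⟨m, C', hfourier⟩ := exists_supSeminorm_fourier_le (d := d) m'
  refine ⟨m, C * C', fun B f₁ f₂ a b φ x y ha hb => ?_⟩
  rw [pairing_eq_localized B f₁ f₂ hR hρ ha hb]
  refine enorm_pairing_le_of_enorm_le B f₁ f₂ a b ?_ fun ξ => (hdecay (𝓕 φ) (x + y) ξ).trans ?_
  · exact ENNReal.mul_ne_top (ENNReal.mul_ne_top ENNReal.coe_ne_top ENNReal.ofReal_ne_top)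
      (weight_ne_top _ _)
  · rw [ENNReal.coe_mul, mul_assoc (C : ℝ≥0∞) C', ← ENNReal.ofReal_coe_nnreal (p := C'),
      ← ENNReal.ofReal_mul C'.coe_nonneg]
    gcongr
    exact hfourier φ

theorem FourierLebesgueConvEmbeds.exists_enorm_pairing_le {p₁ p₂ p₃ : ℝ≥0∞} {r₁ r₂ r₃ : ℝ}
    (hp₃ : 1 ≤ p₃) {B : E₁ →L[ℂ] E₂ →L[ℂ] E₃}
    (hB : FourierLebesgueConvEmbeds d B p₁ p₂ p₃ r₁ r₂ r₃) {R : ℝ} (hR : 0 < R) (N : ℕ) :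
    ∃ (m : ℕ) (C : ℝ≥0), ∀ (f₁ : 𝓢(Rd d, ℂ) →L[ℂ] E₁) (f₂ : 𝓢(Rd d, ℂ) →L[ℂ] E₂)
      (a b φ : 𝓢(Rd d, ℂ)) (x y : Rd d), Function.support a ⊆ Metric.closedBall x R →
      Function.support b ⊆ Metric.closedBall y R →
      localNorm p₁ r₁ f₁ a < ∞ → localNorm p₂ r₂ f₂ b < ∞ →
      ‖pairing B f₁ f₂ a b φ‖ₑ ≤ C * ENNReal.ofReal (supSeminorm m φ) *
        (weight (-(N : ℝ)) (x + y) * (localNorm p₁ r₁ f₁ a * localNorm p₂ r₂ f₂ b)) := by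
  obtain ⟨M, hM⟩ := exists_nat_gt (d - r₃)
  obtain ⟨m, C, hpairing⟩ := exists_enorm_pairing_le_lintegral (d := d) (E₁ := E₁) (E₂ := E₂)
    (E₃ := E₃) hR M N
  obtain ⟨K, hK⟩ := exists_lintegral_weight_mul_le (d := d) hp₃ (sub_lt_iff_lt_add.1 hM)
  obtain ⟨C', hsymbol⟩ := hB.exists_prodSymbol_le
  refine ⟨m, C * (K * C'), fun f₁ f₂ a b φ x y ha hb hfin₁ hfin₂ => ?_⟩
  have ha' : HasCompactSupport a := .of_support_subset_isCompact (isCompact_closedBall x R) ha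
  have hb' : HasCompactSupport b := .of_support_subset_isCompact (isCompact_closedBall y R) hb
  calc ‖pairing B f₁ f₂ a b φ‖ₑ
      ≤ C * ENNReal.ofReal (supSeminorm m φ) * weight (-(N : ℝ)) (x + y) *
          ∫⁻ ξ, weight (-(M : ℝ)) ξ * ‖prodSymbol B f₁ f₂ a b ξ‖ₑ :=
        hpairing B f₁ f₂ a b φ x y ha hb
    _ ≤ C * ENNReal.ofReal (supSeminorm m φ) * weight (-(N : ℝ)) (x + y) *
          (K * (C' * (localNorm p₁ r₁ f₁ a * localNorm p₂ r₂ f₂ b))) := by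
        gcongr
        refine (hK _ (continuous_prodSymbol_right B f₁ f₂ a b).enorm.measurable).trans ?_
        gcongr
        exact hsymbol f₁ f₂ a b ha' hb' hfin₁ hfin₂
    _ = _ := by push_cast; ring

/-- The left side is the short-time Fourier transform, with window `conj g`, of the convolution
of the two pieces. -/
lemma exists_enorm_pairing_charMul_translate_le {R : ℝ} (hR : 0 < R) (M N : ℕ) (g : 𝓢(Rd d, ℂ)) :
    ∃ C : ℝ≥0, ∀ (B : E₁ →L[ℂ] E₂ →L[ℂ] E₃) (f₁ : 𝓢(Rd d, ℂ) →L[ℂ] E₁)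
      (f₂ : 𝓢(Rd d, ℂ) →L[ℂ] E₂) (a b : 𝓢(Rd d, ℂ)) (x y z ξ : Rd d),
      Function.support a ⊆ Metric.closedBall x R → Function.support b ⊆ Metric.closedBall y R →
      ‖pairing B f₁ f₂ a b (𝓕⁻ (charMul ξ (translate z g)))‖ₑ ≤
        C * weight (-(N : ℝ)) (z - (x + y)) *
          ∫⁻ η, weight (-(M : ℝ)) (ξ - η) * ‖prodSymbol B f₁ f₂ a b η‖ₑ := by
  obtain ⟨ρ, hρ, -⟩ := exists_bump d (R := 2 * R + 1) (by positivity)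
  obtain ⟨m, C, hdecay⟩ := exists_enorm_fourierInv_mul_translate_le M N g
  refine ⟨C * (supSeminorm m ρ).toNNReal, fun B f₁ f₂ a b x y z ξ ha hb => ?_⟩
  have hwindow : mulSchwartz (charMul ξ (translate z g)) (translate (x + y) ρ) =
      charMul ξ (translate (x + y) (mulSchwartz ρ (translate (z - (x + y)) g))) := by
    ext t
    simp only [mulSchwartz_apply, charMul_apply, SchwartzMap.compSubConstCLM_apply,
      sub_sub t, add_sub_cancel]
    ring
  rw [pairing_eq_localized B f₁ f₂ hR hρ ha hb, FourierTransform.fourier_fourierInv_eq, hwindow,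
    fourierInv_charMul, ENNReal.coe_mul, ← ENNReal.ofReal]
  refine enorm_pairing_le_of_enorm_le B f₁ f₂ a b ?_ fun η => ?_
  · exact ENNReal.mul_ne_top (ENNReal.mul_ne_top ENNReal.coe_ne_top ENNReal.ofReal_ne_top)
      (weight_ne_top _ _)
  · rw [SchwartzMap.compSubConstCLM_apply, enorm_fourierInv_translate, weight_sub_comm _ ξ η]
    exact hdecay ρ _ _

end PairingBounds

/-! ### Convolutions of nonnegative functions -/

section Global

lemma lintegral_prod_add_mul {G : Type*} [AddCommGroup G] [MeasurableSpace G] [MeasurableAdd₂ G]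
    [MeasurableSub₂ G] {μ : Measure G} [SFinite μ] [μ.IsAddLeftInvariant] {K A₁ A₂ : G → ℝ≥0∞}
    (hK : Measurable K) (hA₁ : Measurable A₁) (hA₂ : Measurable A₂) :
    ∫⁻ p : G × G, K (p.1 + p.2) * (A₁ p.1 * A₂ p.2) ∂μ.prod μ =
      ∫⁻ w, K w * ∫⁻ t, A₁ t * A₂ (w - t) ∂μ ∂μ := by
  calc _ = ∫⁻ x, ∫⁻ y, K (x + y) * (A₁ x * A₂ y) ∂μ ∂μ := lintegral_prod _ (by fun_prop)
    _ = ∫⁻ x, ∫⁻ w, K w * (A₁ x * A₂ (w - x)) ∂μ ∂μ := by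
        refine lintegral_congr fun x => ?_
        rw [← lintegral_add_left_eq_self (fun w => K w * (A₁ x * A₂ (w - x))) x]
        simp only [add_sub_cancel_left]
    _ = ∫⁻ w, ∫⁻ x, K w * (A₁ x * A₂ (w - x)) ∂μ ∂μ := lintegral_lintegral_swap (by fun_prop)
    _ = _ := lintegral_congr fun w => lintegral_const_mul _ (by fun_prop)

lemma enorm_ofReal_toReal {a : ℝ≥0∞} (ha : a ≠ ∞) : ‖((a.toReal : ℝ) : ℂ)‖ₑ = a := by
  rw [← ofReal_norm, Complex.norm_real, ofReal_norm, Real.enorm_toReal ha]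

lemma enorm_integral_ofReal_toReal {X : Type*} [MeasurableSpace X] {μ : Measure X}
    {F : X → ℝ≥0∞} (hF : ∀ᵐ x ∂μ, F x < ∞) (hint : Integrable (fun x => (F x).toReal) μ) :
    ‖∫ x, ((F x).toReal : ℂ) ∂μ‖ₑ = ∫⁻ x, F x ∂μ := by
  rw [integral_complex_ofReal, ← ofReal_norm, Complex.norm_real,
    Real.norm_of_nonneg (integral_nonneg fun _ => ENNReal.toReal_nonneg),
    ofReal_integral_eq_lintegral_ofReal hint (ae_of_all _ fun _ => ENNReal.toReal_nonneg)]
  exact lintegral_congr_ae (hF.mono fun x hx => ENNReal.ofReal_toReal hx.ne)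

variable {d : ℕ}

lemma ae_lt_top_of_weightedLpNorm_lt_top {q : ℝ≥0∞} (hq : 1 ≤ q) {s : ℝ} {A : Rd d → ℝ≥0∞}
    (hA : Measurable A) (h : weightedLpNorm q s A < ∞) : ∀ᵐ x, A x < ∞ := by
  obtain ⟨m, hm⟩ := exists_gt (d - s)
  obtain ⟨C, hC⟩ := exists_lintegral_weight_mul_le (d := d) hq (sub_lt_iff_lt_add.1 hm)
  have hfin := ((hC A hA).trans_lt (ENNReal.mul_lt_top ENNReal.coe_lt_top h)).ne
  filter_upwards [ae_lt_top ((measurable_weight _).mul hA) hfin] with x hx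
  exact ENNReal.lt_top_of_mul_ne_top_right hx.ne (weight_ne_zero _ _)

lemma enorm_convolution_ofReal_toReal {A₁ A₂ : Rd d → ℝ≥0∞} (h₁ : ∀ᵐ x, A₁ x < ∞)
    (h₂ : ∀ᵐ x, A₂ x < ∞) {z : Rd d} (hz : ConvolutionExistsAt (fun x => ((A₁ x).toReal : ℂ))
      (fun x => ((A₂ x).toReal : ℂ)) z (ContinuousLinearMap.mul ℂ ℂ) volume) :
    ‖convolution (fun x => ((A₁ x).toReal : ℂ)) (fun x => ((A₂ x).toReal : ℂ))
      (ContinuousLinearMap.mul ℂ ℂ) volume z‖ₑ = ∫⁻ t, A₁ t * A₂ (z - t) := by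
  have hprod : ∀ t, ContinuousLinearMap.mul ℂ ℂ ((A₁ t).toReal : ℂ) ((A₂ (z - t)).toReal : ℂ) =
      ((A₁ t * A₂ (z - t)).toReal : ℂ) := fun t => by simp [ENNReal.toReal_mul]
  simp only [ConvolutionExistsAt, hprod] at hz
  simp only [convolution, hprod]
  refine enorm_integral_ofReal_toReal ?_ hz.re
  filter_upwards [h₁, (quasiMeasurePreserving_sub_left volume z).ae h₂] with t ht₁ ht₂
  exact ENNReal.mul_lt_top ht₁ ht₂

lemma LebesgueConvEmbeds.exists_lintegral_conv_le {q₁ q₂ q₃ : ℝ≥0∞} {s₁ s₂ s₃ : ℝ}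
    (h : LebesgueConvEmbeds d q₁ q₂ q₃ s₁ s₂ s₃) (hq₁ : 1 ≤ q₁) (hq₂ : 1 ≤ q₂) :
    ∃ C : ℝ≥0, ∀ A₁ A₂ : Rd d → ℝ≥0∞, Measurable A₁ → Measurable A₂ →
      weightedLpNorm q₁ s₁ A₁ < ∞ → weightedLpNorm q₂ s₂ A₂ < ∞ →
      weightedLpNorm q₃ s₃ (fun z => ∫⁻ t, A₁ t * A₂ (z - t)) ≤
        C * (weightedLpNorm q₁ s₁ A₁ * weightedLpNorm q₂ s₂ A₂) := by
  obtain ⟨C, hC⟩ := h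
  refine ⟨C, fun A₁ A₂ hA₁ hA₂ hfin₁ hfin₂ => ?_⟩
  have htop₁ := ae_lt_top_of_weightedLpNorm_lt_top hq₁ hA₁ hfin₁
  have htop₂ := ae_lt_top_of_weightedLpNorm_lt_top hq₂ hA₂ hfin₂
  have hnorm₁ : weightedLpNorm q₁ s₁ (fun x => ‖((A₁ x).toReal : ℂ)‖ₑ) = weightedLpNorm q₁ s₁ A₁ :=
    weightedLpNorm_congr_ae (htop₁.mono fun x hx => enorm_ofReal_toReal hx.ne)
  have hnorm₂ : weightedLpNorm q₂ s₂ (fun x => ‖((A₂ x).toReal : ℂ)‖ₑ) = weightedLpNorm q₂ s₂ A₂ :=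
    weightedLpNorm_congr_ae (htop₂.mono fun x hx => enorm_ofReal_toReal hx.ne)
  obtain ⟨hexists, -, hle⟩ := hC (fun x => ((A₁ x).toReal : ℂ)) (fun x => ((A₂ x).toReal : ℂ))
    ⟨(Complex.measurable_ofReal.comp hA₁.ennreal_toReal).aestronglyMeasurable, by rwa [hnorm₁]⟩
    ⟨(Complex.measurable_ofReal.comp hA₂.ennreal_toReal).aestronglyMeasurable, by rwa [hnorm₂]⟩
  rw [hnorm₁, hnorm₂, mul_assoc] at hle
  rwa [← weightedLpNorm_congr_ae
    (hexists.mono fun z hz => enorm_convolution_ofReal_toReal htop₁ htop₂ hz)]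

end Global

/-! ### Superposition of localized pieces -/

section Superposition

lemma exists_clm_eq_integral {X V F E : Type*} [MeasurableSpace X] {μ : Measure X}
    [NormedAddCommGroup V] [NormedSpace ℝ V] [NormedAddCommGroup F] [NormedSpace ℂ F]
    [NormedSpace ℝ F] [SMulCommClass ℝ ℂ F] [NormedAddCommGroup E] [NormedSpace ℂ E]
    {T : X → 𝓢(V, F) →ₗ[ℂ] E} (hT : ∀ φ, AEStronglyMeasurable (fun x => T x φ) μ) {m : ℕ}
    {C : ℝ≥0} {G : X → ℝ≥0∞} (hG : ∫⁻ x, G x ∂μ < ∞)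
    (hle : ∀ φ : 𝓢(V, F), ∀ᵐ x ∂μ,
      ‖T x φ‖ₑ ≤ C * ENNReal.ofReal (supSeminorm m φ) * G x) :
    ∃ H : 𝓢(V, F) →L[ℂ] E, ∀ φ, H φ = ∫ x, T x φ ∂μ := by
  have hfin : ∀ φ : 𝓢(V, F), C * ENNReal.ofReal (supSeminorm m φ) * ∫⁻ x, G x ∂μ ≠ ∞ := fun φ =>
    ENNReal.mul_ne_top (ENNReal.mul_ne_top ENNReal.coe_ne_top ENNReal.ofReal_ne_top) hG.ne
  have hbound : ∀ φ : 𝓢(V, F), ∫⁻ x, ‖T x φ‖ₑ ∂μ ≤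
      C * ENNReal.ofReal (supSeminorm m φ) * ∫⁻ x, G x ∂μ := fun φ => by
    rw [← lintegral_const_mul' _ _ (ENNReal.mul_ne_top ENNReal.coe_ne_top ENNReal.ofReal_ne_top)]
    exact lintegral_mono_ae (hle φ)
  have hint : ∀ φ, Integrable (fun x => T x φ) μ := fun φ =>
    ⟨hT φ, (hbound φ).trans_lt (hfin φ).lt_top⟩
  refine ⟨SchwartzMap.mkCLMtoNormedSpace (σ := RingHom.id ℂ) (fun φ => ∫ x, T x φ ∂μ)
    (fun φ φ' => ?_) (fun c φ => ?_)
    ⟨Finset.Iic (m, m), C * (∫⁻ x, G x ∂μ).toReal, by positivity, fun φ => ?_⟩, fun φ => rfl⟩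
  · simp only [map_add]
    exact integral_add (hint φ) (hint φ')
  · simp only [map_smul]
    exact integral_smul _ _
  · calc ‖∫ x, T x φ ∂μ‖ = ‖∫ x, T x φ ∂μ‖ₑ.toReal := (toReal_enorm _).symm
      _ ≤ (C * ENNReal.ofReal (supSeminorm m φ) * ∫⁻ x, G x ∂μ).toReal :=
          ENNReal.toReal_mono (hfin φ) ((enorm_integral_le_lintegral_enorm _).trans (hbound φ))
      _ = C * (∫⁻ x, G x ∂μ).toReal * supSeminorm m φ := by
          rw [ENNReal.toReal_mul, ENNReal.toReal_mul, ENNReal.coe_toReal,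
            ENNReal.toReal_ofReal (apply_nonneg _ _)]
          ring

variable {d : ℕ} {E₁ E₂ E₃ : Type*} [NormedAddCommGroup E₁] [NormedSpace ℂ E₁]
  [NormedAddCommGroup E₂] [NormedSpace ℂ E₂] [NormedAddCommGroup E₃] [NormedSpace ℂ E₃]
  (B : E₁ →L[ℂ] E₂ →L[ℂ] E₃) (f₁ : 𝓢(Rd d, ℂ) →L[ℂ] E₁) (f₂ : 𝓢(Rd d, ℂ) →L[ℂ] E₂)

lemma stronglyMeasurable_pairing {X : Type*} [TopologicalSpace X] [MeasurableSpace X]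
    [OpensMeasurableSpace X] [SecondCountableTopology X] {a b : X → 𝓢(Rd d, ℂ)}
    (ha : Continuous a) (hb : Continuous b) (φ : 𝓢(Rd d, ℂ)) :
    StronglyMeasurable fun x => pairing B f₁ f₂ (a x) (b x) φ := by
  have hcont : Continuous fun z : X × Rd d => φ z.2 • prodSymbol B f₁ f₂ (a z.1) (b z.1) z.2 :=
    (φ.continuous.comp continuous_snd).smul (continuous_prodSymbol B f₁ f₂
      (ha.comp continuous_fst) (hb.comp continuous_fst) continuous_snd)
  exact hcont.stronglyMeasurable.integral_prod_right (ν := volume)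

lemma prodSymbol_add_left (a a' b : 𝓢(Rd d, ℂ)) (ξ : Rd d) :
    prodSymbol B f₁ f₂ (a + a') b ξ = prodSymbol B f₁ f₂ a b ξ + prodSymbol B f₁ f₂ a' b ξ := by
  simp only [prodSymbol, charMul, map_add, add_apply]

lemma prodSymbol_smul_left (c : ℂ) (a b : 𝓢(Rd d, ℂ)) (ξ : Rd d) :
    prodSymbol B f₁ f₂ (c • a) b ξ = c • prodSymbol B f₁ f₂ a b ξ := by
  simp only [prodSymbol, charMul, map_smul, smul_apply]

lemma exists_norm_pairing_le_left (b φ : 𝓢(Rd d, ℂ)) : ∃ (m : ℕ) (C : ℝ≥0), ∀ a : 𝓢(Rd d, ℂ),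
    ‖pairing B f₁ f₂ a b φ‖ ≤ C * supSeminorm m a := by
  obtain ⟨k, m, C, hle⟩ := exists_norm_prodSymbol_le B f₁ f₂ b
  set I : ℝ := ∫ ξ, ‖φ ξ‖ * (1 + ‖ξ‖) ^ k
  have hI : 0 ≤ I := integral_nonneg fun ξ => by positivity
  refine ⟨m, C * I.toNNReal, fun a => ?_⟩
  calc ‖pairing B f₁ f₂ a b φ‖
      ≤ ∫ ξ, C * supSeminorm m a * (‖φ ξ‖ * (1 + ‖ξ‖) ^ k) := by
        refine norm_integral_le_of_norm_le ((integrable_norm_mul_one_add_pow φ k).const_mul _)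
          (ae_of_all _ fun ξ => ?_)
        calc ‖φ ξ • prodSymbol B f₁ f₂ a b ξ‖
            ≤ ‖φ ξ‖ * (C * supSeminorm m a * (1 + ‖ξ‖) ^ k) := by
              rw [norm_smul]
              gcongr
              exact hle a ξ
          _ = _ := by ring
    _ = _ := by
        rw [integral_const_mul, NNReal.coe_mul, Real.coe_toNNReal _ hI]
        ring

/-- The pairing as a continuous linear map of the window localizing `f₁`, so that windows can be
decomposed into integrals of translates. -/
def pairingLeft (b φ : 𝓢(Rd d, ℂ)) : 𝓢(Rd d, ℂ) →L[ℂ] E₃ :=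
  SchwartzMap.mkCLMtoNormedSpace (σ := RingHom.id ℂ) (fun a => pairing B f₁ f₂ a b φ)
    (fun a a' => by
      simp only [pairing_apply, prodSymbol_add_left, smul_add]
      exact integral_add (integrable_smul_prodSymbol B f₁ f₂ a b φ)
        (integrable_smul_prodSymbol B f₁ f₂ a' b φ))
    (fun c a => by
      simp only [pairing_apply, prodSymbol_smul_left, smul_comm _ c, RingHom.id_apply]
      exact integral_smul _ _)
    (by
      obtain ⟨m, C, hle⟩ := exists_norm_pairing_le_left B f₁ f₂ b φ
      exact ⟨Finset.Iic (m, m), C, C.coe_nonneg, hle⟩)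

lemma pairingLeft_apply (a b φ : 𝓢(Rd d, ℂ)) :
    pairingLeft B f₁ f₂ b φ a = pairing B f₁ f₂ a b φ := rfl

lemma pairing_flip (a b φ : 𝓢(Rd d, ℂ)) :
    pairing B.flip f₂ f₁ b a φ = pairing B f₁ f₂ a b φ := rfl

variable [CompleteSpace E₃] {ψ : 𝓢(Rd d, ℂ)}

lemma pairing_eq_integral_left (hψ : ∫ x, ψ x = 1) (a b φ : 𝓢(Rd d, ℂ)) :
    pairing B f₁ f₂ a b φ = ∫ x, pairing B f₁ f₂ (mulSchwartz (translate x ψ) a) b φ := by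
  simpa only [pairingLeft_apply, mulSchwartz_comm a] using
    apply_eq_integral_translate (pairingLeft B f₁ f₂ b φ) hψ a

lemma pairing_eq_integral_integral (hψ : ∫ x, ψ x = 1) (a b φ : 𝓢(Rd d, ℂ)) :
    pairing B f₁ f₂ a b φ = ∫ x, ∫ y,
      pairing B f₁ f₂ (mulSchwartz (translate x ψ) a) (mulSchwartz (translate y ψ) b) φ := by
  rw [pairing_eq_integral_left B f₁ f₂ hψ]
  refine integral_congr_ae (ae_of_all _ fun x => ?_)
  simpa only [pairing_flip] using
    pairing_eq_integral_left B.flip f₂ f₁ hψ b (mulSchwartz (translate x ψ) a) φ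

end Superposition

/-! ### Norm estimates for superpositions -/

section Localized

variable {d : ℕ}

lemma exists_integral_eq_one_support_subset_closedBall (d : ℕ) : ∃ ψ : 𝓢(Rd d, ℂ),
    ∫ x, ψ x = 1 ∧ Function.support ψ ⊆ Metric.closedBall 0 2 := by
  obtain ⟨ρ, -, hzero, -, hint⟩ := exists_bump d one_pos
  refine ⟨(∫ y, ρ y)⁻¹ • ρ, ?_, fun y hy => ?_⟩
  · simp only [smul_apply, smul_eq_mul]
    rw [integral_const_mul, inv_mul_cancel₀ hint]
  · by_contra hfar
    rw [mem_closedBall_zero_iff, not_le] at hfar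
    exact hy (by rw [smul_apply, hzero y (by linarith), smul_zero])

lemma support_translate_subset_closedBall {ψ : 𝓢(Rd d, ℂ)} {R : ℝ}
    (hψ : Function.support ψ ⊆ Metric.closedBall 0 R) (x : Rd d) :
    Function.support (translate x ψ) ⊆ Metric.closedBall x R := fun y hy => by
  have hmem : y - x ∈ Metric.closedBall 0 R := hψ hy
  rwa [mem_closedBall_zero_iff, ← mem_closedBall_iff_norm] at hmem

lemma hasCompactSupport_translate {ψ : 𝓢(Rd d, ℂ)} {R : ℝ}
    (hψ : Function.support ψ ⊆ Metric.closedBall 0 R) (x : Rd d) :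
    HasCompactSupport (translate x ψ) :=
  HasCompactSupport.of_support_subset_isCompact (isCompact_closedBall x R)
    (support_translate_subset_closedBall hψ x)

lemma support_mulSchwartz_subset_left (a b : 𝓢(Rd d, ℂ)) :
    Function.support (mulSchwartz a b) ⊆ Function.support a := fun y hy ha =>
  hy (by rw [mulSchwartz_apply, ha, zero_mul])

lemma measurable_lintegral_weight_conv {X : Type*} [MeasurableSpace X] (s : ℝ)
    {P : X → Rd d → ℝ≥0∞} (hP : Measurable (Function.uncurry P)) :
    Measurable (Function.uncurry fun x ξ => ∫⁻ η, weight s (ξ - η) * P x η) := by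
  have hweight : Measurable fun z : (X × Rd d) × Rd d => weight s (z.1.2 - z.2) :=
    (measurable_weight s).comp (by fun_prop)
  have hP' : Measurable fun z : (X × Rd d) × Rd d => P z.1.1 z.2 :=
    hP.comp (g := Function.uncurry P) (f := fun z : (X × Rd d) × Rd d => (z.1.1, z.2))
      (by fun_prop)
  exact (hweight.mul hP').lintegral_prod_right' (ν := volume)

lemma exists_weightedLpNorm_superposition_le {X : Type*} [MeasurableSpace X] (μ : Measure X)
    [SigmaFinite μ] {p : ℝ≥0∞} (hp : 1 ≤ p) (r : ℝ) {m : ℝ} (hm : d + |r| < m) :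
    ∃ C : ℝ≥0, ∀ (P : X → Rd d → ℝ≥0∞) (w A : X → ℝ≥0∞), Measurable (Function.uncurry P) →
      Measurable w → (∀ x, w x ≠ ∞) → (∀ᵐ x ∂μ, weightedLpNorm p r (P x) ≤ A x) →
      weightedLpNorm p r (fun ξ => ∫⁻ x, w x * (∫⁻ η, weight (-m) (ξ - η) * P x η) ∂μ) ≤
        C * ∫⁻ x, w x * A x ∂μ := by
  obtain ⟨C, hC⟩ := exists_weightedLpNorm_conv_weight_le (d := d) hp r hm
  refine ⟨C, fun P w A hP hw hw_top hA => ?_⟩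
  calc _ ≤ ∫⁻ x, weightedLpNorm p r (fun ξ => w x * ∫⁻ η, weight (-m) (ξ - η) * P x η) ∂μ :=
        weightedLpNorm_lintegral_le hp r
          ((hw.comp measurable_fst).mul (measurable_lintegral_weight_conv (-m) hP))
    _ ≤ ∫⁻ x, C * (w x * A x) ∂μ := by
        refine lintegral_mono_ae (hA.mono fun x hx => ?_)
        calc _ ≤ w x * weightedLpNorm p r (fun ξ => ∫⁻ η, weight (-m) (ξ - η) * P x η) :=
              weightedLpNorm_const_mul_le p r _ (hw_top x)
          _ ≤ w x * (C * A x) := by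
              gcongr
              exact (hC (P x) hP.of_uncurry_left).trans (by gcongr)
          _ = _ := by ring
    _ = _ := lintegral_const_mul' _ _ ENNReal.coe_ne_top

lemma tendsto_integral_of_enorm_le {X E : Type*} [MeasurableSpace X] {μ : Measure X}
    [NormedAddCommGroup E] [NormedSpace ℝ E] {F : ℕ → X → E} {f : X → E} {G : X → ℝ≥0∞}
    (hF : ∀ n, AEStronglyMeasurable (F n) μ) (hG : AEMeasurable G μ) (hfin : ∫⁻ x, G x ∂μ ≠ ∞)
    (hle : ∀ n, ∀ᵐ x ∂μ, ‖F n x‖ₑ ≤ G x)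
    (hlim : ∀ᵐ x ∂μ, Tendsto (fun n => F n x) atTop (𝓝 (f x))) :
    Tendsto (fun n => ∫ x, F n x ∂μ) atTop (𝓝 (∫ x, f x ∂μ)) := by
  refine tendsto_integral_of_dominated_convergence (fun x => (G x).toReal) hF
    (integrable_toReal_of_lintegral_ne_top hG hfin) (fun n => ?_) hlim
  filter_upwards [hle n, ae_lt_top' hG hfin] with x hx hx_top
  rw [← toReal_enorm]
  exact ENNReal.toReal_mono hx_top.ne hx

lemma LebesgueConvEmbeds.lintegral_weight_add_mul_lt_top {q₁ q₂ q₃ : ℝ≥0∞} {s₁ s₂ s₃ : ℝ}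
    (h : LebesgueConvEmbeds d q₁ q₂ q₃ s₁ s₂ s₃) (hq₁ : 1 ≤ q₁) (hq₂ : 1 ≤ q₂) (hq₃ : 1 ≤ q₃)
    {m : ℝ} (hm : d < m + s₃) {A₁ A₂ : Rd d → ℝ≥0∞} (hA₁ : Measurable A₁) (hA₂ : Measurable A₂)
    (hfin₁ : weightedLpNorm q₁ s₁ A₁ < ∞) (hfin₂ : weightedLpNorm q₂ s₂ A₂ < ∞) :
    ∫⁻ p : Rd d × Rd d, weight (-m) (p.1 + p.2) * (A₁ p.1 * A₂ p.2) < ∞ := by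
  obtain ⟨C, hC⟩ := exists_lintegral_weight_mul_le (d := d) hq₃ hm
  obtain ⟨C', hconv⟩ := h.exists_lintegral_conv_le hq₁ hq₂
  rw [Measure.volume_eq_prod, lintegral_prod_add_mul (measurable_weight _) hA₁ hA₂]
  exact (hC _ (by fun_prop)).trans_lt (ENNReal.mul_lt_top ENNReal.coe_lt_top
    ((hconv A₁ A₂ hA₁ hA₂ hfin₁ hfin₂).trans_lt
      (ENNReal.mul_lt_top ENNReal.coe_lt_top (ENNReal.mul_lt_top hfin₁ hfin₂))))

lemma LebesgueConvEmbeds.exists_lintegral_weight_sub_mul_le {q₁ q₂ q₃ : ℝ≥0∞} {s₁ s₂ s₃ : ℝ}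
    (h : LebesgueConvEmbeds d q₁ q₂ q₃ s₁ s₂ s₃) (hq₁ : 1 ≤ q₁) (hq₂ : 1 ≤ q₂) (hq₃ : 1 ≤ q₃)
    {m : ℝ} (hm : d + |s₃| < m) : ∃ C : ℝ≥0, ∀ A₁ A₂ : Rd d → ℝ≥0∞, Measurable A₁ → Measurable A₂ →
      weightedLpNorm q₁ s₁ A₁ < ∞ → weightedLpNorm q₂ s₂ A₂ < ∞ →
      weightedLpNorm q₃ s₃ (fun z => ∫⁻ p : Rd d × Rd d,
        weight (-m) (z - (p.1 + p.2)) * (A₁ p.1 * A₂ p.2)) ≤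
        C * (weightedLpNorm q₁ s₁ A₁ * weightedLpNorm q₂ s₂ A₂) := by
  obtain ⟨C, hC⟩ := exists_weightedLpNorm_conv_weight_le (d := d) hq₃ s₃ hm
  obtain ⟨C', hconv⟩ := h.exists_lintegral_conv_le hq₁ hq₂
  refine ⟨C * C', fun A₁ A₂ hA₁ hA₂ hfin₁ hfin₂ => ?_⟩
  have hprod : ∀ z : Rd d, ∫⁻ p : Rd d × Rd d, weight (-m) (z - (p.1 + p.2)) *
      (A₁ p.1 * A₂ p.2) = ∫⁻ w, weight (-m) (z - w) * ∫⁻ t, A₁ t * A₂ (w - t) := fun z =>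
    lintegral_prod_add_mul (K := fun w => weight (-m) (z - w))
      ((measurable_weight _).comp (measurable_const.sub measurable_id)) hA₁ hA₂
  simp only [hprod]
  refine (hC _ (by fun_prop)).trans ?_
  rw [ENNReal.coe_mul, mul_assoc]
  gcongr
  exact hconv A₁ A₂ hA₁ hA₂ hfin₁ hfin₂

section

variable {E : Type*} [NormedAddCommGroup E] [NormedSpace ℂ E] [CompleteSpace E] {p q : ℝ≥0∞}

lemma exists_weightedLpNorm_localNorm_le_amalgamNorm (hp : 1 ≤ p) (hq : 1 ≤ q) (r s : ℝ)
    {g : 𝓢(Rd d, ℂ)} (hg : g ≠ 0) (ψ : 𝓢(Rd d, ℂ)) : ∃ C : ℝ≥0, ∀ f : 𝓢'(Rd d, E),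
      weightedLpNorm q s (fun x => localNorm p r f (translate x ψ)) ≤
        C * amalgamNorm p q r s g f := by
  obtain ⟨C, hC⟩ := exists_windowChange_le (E := E) hp hq r s (conjSchwartz_ne_zero hg) ψ
  exact ⟨C, fun f => by rw [amalgamNorm_eq]; exact hC f⟩

lemma MemAmalgam.weightedLpNorm_localNorm_lt_top {r s : ℝ} {f : 𝓢'(Rd d, E)}
    (hf : MemAmalgam p q r s f) (hp : 1 ≤ p) (hq : 1 ≤ q) (ψ : 𝓢(Rd d, ℂ)) :
    weightedLpNorm q s (fun x => localNorm p r f (translate x ψ)) < ∞ := by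
  obtain ⟨g, hg, hfin⟩ := hf
  obtain ⟨C, hC⟩ := exists_weightedLpNorm_localNorm_le_amalgamNorm (E := E) hp hq r s hg ψ
  exact (hC f).trans_lt (ENNReal.mul_lt_top ENNReal.coe_lt_top hfin)

end

end Localized

/-! ### Convolution of distributions in amalgam spaces -/

section AmalgamConvolution

variable {d : ℕ} {E₁ E₂ E₃ : Type*} [NormedAddCommGroup E₁] [NormedSpace ℂ E₁]
  [NormedAddCommGroup E₂] [NormedSpace ℂ E₂] [NormedAddCommGroup E₃] [NormedSpace ℂ E₃]
  {B : E₁ →L[ℂ] E₂ →L[ℂ] E₃} {p₁ p₂ p₃ : ℝ≥0∞} {r₁ r₂ r₃ : ℝ} {R : ℝ} {ψ : 𝓢(Rd d, ℂ)}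

lemma measurable_weight_mul_localNorm (N : ℕ) (ψ : 𝓢(Rd d, ℂ)) (f₁ : 𝓢(Rd d, ℂ) →L[ℂ] E₁)
    (f₂ : 𝓢(Rd d, ℂ) →L[ℂ] E₂) : Measurable fun p : Rd d × Rd d => weight (-(N : ℝ)) (p.1 + p.2) *
      (localNorm p₁ r₁ f₁ (translate p.1 ψ) * localNorm p₂ r₂ f₂ (translate p.2 ψ)) :=
  ((measurable_weight _).comp (measurable_fst.add measurable_snd)).mul
    (((measurable_localNorm p₁ r₁ f₁ (continuous_translate_left ψ)).comp measurable_fst).mul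
      ((measurable_localNorm p₂ r₂ f₂ (continuous_translate_left ψ)).comp measurable_snd))

variable [CompleteSpace E₁] [CompleteSpace E₂] [CompleteSpace E₃]

lemma FourierLebesgueConvEmbeds.exists_enorm_pairing_truncation_le
    (hB : FourierLebesgueConvEmbeds d B p₁ p₂ p₃ r₁ r₂ r₃) (hp₁ : 1 ≤ p₁) (hp₂ : 1 ≤ p₂)
    (hp₃ : 1 ≤ p₃) (hR : 0 < R) (hψ : Function.support ψ ⊆ Metric.closedBall 0 R) (N : ℕ)
    (χ₁ χ₂ : 𝓢(Rd d, ℂ)) : ∃ (m : ℕ) (C : ℝ≥0), ∀ (f₁ : 𝓢(Rd d, ℂ) →L[ℂ] E₁)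
      (f₂ : 𝓢(Rd d, ℂ) →L[ℂ] E₂) (n : ℕ) (φ : 𝓢(Rd d, ℂ)) (x y : Rd d),
      localNorm p₁ r₁ f₁ (translate x ψ) < ∞ → localNorm p₂ r₂ f₂ (translate y ψ) < ∞ →
      ‖pairing B f₁ f₂ (mulSchwartz (translate x ψ) (dilate χ₁ n))
          (mulSchwartz (translate y ψ) (dilate χ₂ n)) φ‖ₑ ≤
        C * ENNReal.ofReal (supSeminorm m φ) * (weight (-(N : ℝ)) (x + y) *
          (localNorm p₁ r₁ f₁ (translate x ψ) * localNorm p₂ r₂ f₂ (translate y ψ))) := by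
  obtain ⟨ρ, hρ, -⟩ := exists_bump d hR
  have hρψ : ∀ y, ψ y ≠ 0 → ρ y = 1 := fun y hy => hρ y (mem_closedBall_zero_iff.1 (hψ hy))
  obtain ⟨T₁, hT₁⟩ := exists_localNorm_truncation_le (E := E₁) hp₁ r₁ hρψ χ₁
  obtain ⟨T₂, hT₂⟩ := exists_localNorm_truncation_le (E := E₂) hp₂ r₂ hρψ χ₂
  obtain ⟨m, C, hC⟩ := hB.exists_enorm_pairing_le hp₃ hR N
  have hsupport : ∀ x a, Function.support (mulSchwartz (translate x ψ) a) ⊆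
      Metric.closedBall x R := fun x a =>
    (support_mulSchwartz_subset_left _ a).trans (support_translate_subset_closedBall hψ x)
  refine ⟨m, C * (T₁ * T₂), fun f₁ f₂ n φ x y hx hy => ?_⟩
  have hle₁ := hT₁ f₁ n x
  have hle₂ := hT₂ f₂ n y
  calc _ ≤ C * ENNReal.ofReal (supSeminorm m φ) * (weight (-(N : ℝ)) (x + y) *
        (localNorm p₁ r₁ f₁ (mulSchwartz (translate x ψ) (dilate χ₁ n)) *
          localNorm p₂ r₂ f₂ (mulSchwartz (translate y ψ) (dilate χ₂ n)))) :=
        hC f₁ f₂ _ _ φ x y (hsupport x _) (hsupport y _)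
          (hle₁.trans_lt (ENNReal.mul_lt_top ENNReal.coe_lt_top hx))
          (hle₂.trans_lt (ENNReal.mul_lt_top ENNReal.coe_lt_top hy))
    _ ≤ C * ENNReal.ofReal (supSeminorm m φ) * (weight (-(N : ℝ)) (x + y) *
        (T₁ * localNorm p₁ r₁ f₁ (translate x ψ) * (T₂ * localNorm p₂ r₂ f₂ (translate y ψ)))) := by
        gcongr
    _ = _ := by push_cast; ring

section

variable {f₁ : 𝓢(Rd d, ℂ) →L[ℂ] E₁} {f₂ : 𝓢(Rd d, ℂ) →L[ℂ] E₂}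

lemma FourierLebesgueConvEmbeds.tendsto_pairing_dilate
    (hB : FourierLebesgueConvEmbeds d B p₁ p₂ p₃ r₁ r₂ r₃) (hp₁ : 1 ≤ p₁) (hp₂ : 1 ≤ p₂)
    (hp₃ : 1 ≤ p₃) (hψ_int : ∫ x, ψ x = 1) (hR : 0 < R)
    (hψ : Function.support ψ ⊆ Metric.closedBall 0 R)
    (hA : ∀ᵐ p : Rd d × Rd d, localNorm p₁ r₁ f₁ (translate p.1 ψ) < ∞ ∧
      localNorm p₂ r₂ f₂ (translate p.2 ψ) < ∞) {N : ℕ}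
    (hfin : ∫⁻ p : Rd d × Rd d, weight (-(N : ℝ)) (p.1 + p.2) *
      (localNorm p₁ r₁ f₁ (translate p.1 ψ) * localNorm p₂ r₂ f₂ (translate p.2 ψ)) < ∞)
    {χ₁ χ₂ : 𝓢(Rd d, ℂ)} (hχ₁ : IsCutoff χ₁) (hχ₂ : IsCutoff χ₂) (φ : 𝓢(Rd d, ℂ)) :
    Tendsto (fun n => pairing B f₁ f₂ (dilate χ₁ n) (dilate χ₂ n) φ) atTop
      (𝓝 (∫ p : Rd d × Rd d, pairing B f₁ f₂ (translate p.1 ψ) (translate p.2 ψ) φ)) := by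
  obtain ⟨m, C, hC⟩ := hB.exists_enorm_pairing_truncation_le hp₁ hp₂ hp₃ hR hψ N χ₁ χ₂
  have hcompact := hasCompactSupport_translate hψ
  have hcont : ∀ χ, Continuous fun x => mulSchwartz (translate x ψ) χ := fun χ => by
    simp only [mulSchwartz_comm _ χ]
    exact (mulSchwartz χ).continuous.comp (continuous_translate_left ψ)
  have hmeas : ∀ n, StronglyMeasurable fun p : Rd d × Rd d => pairing B f₁ f₂
      (mulSchwartz (translate p.1 ψ) (dilate χ₁ n))
      (mulSchwartz (translate p.2 ψ) (dilate χ₂ n)) φ := fun n =>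
    stronglyMeasurable_pairing B f₁ f₂ ((hcont _).comp continuous_fst)
      ((hcont _).comp continuous_snd) φ
  have hle := fun n => hA.mono fun p hp => hC f₁ f₂ n φ p.1 p.2 hp.1 hp.2
  have hbound : ∫⁻ p : Rd d × Rd d, C * ENNReal.ofReal (supSeminorm m φ) *
      (weight (-(N : ℝ)) (p.1 + p.2) * (localNorm p₁ r₁ f₁ (translate p.1 ψ) *
        localNorm p₂ r₂ f₂ (translate p.2 ψ))) < ∞ := by
    rw [lintegral_const_mul' _ _ (by finiteness)]
    exact ENNReal.mul_lt_top (by finiteness) hfin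
  have hiterated : ∀ n, pairing B f₁ f₂ (dilate χ₁ n) (dilate χ₂ n) φ = ∫ p : Rd d × Rd d,
      pairing B f₁ f₂ (mulSchwartz (translate p.1 ψ) (dilate χ₁ n))
        (mulSchwartz (translate p.2 ψ) (dilate χ₂ n)) φ := fun n => by
    rw [pairing_eq_integral_integral B f₁ f₂ hψ_int, Measure.volume_eq_prod, integral_prod]
    exact ⟨(hmeas n).aestronglyMeasurable, (lintegral_mono_ae (hle n)).trans_lt hbound⟩
  simp only [hiterated]
  refine tendsto_integral_of_enorm_le (fun n => (hmeas n).aestronglyMeasurable)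
    ((measurable_weight_mul_localNorm N ψ f₁ f₂).const_mul _).aemeasurable hbound.ne hle
    (Eventually.of_forall fun p => tendsto_const_nhds.congr' ?_)
  filter_upwards [hχ₁.eventually_mul_dilate_eq (hcompact p.1),
    hχ₂.eventually_mul_dilate_eq (hcompact p.2)] with n h₁ h₂
  rw [h₁, h₂]

theorem FourierLebesgueConvEmbeds.exists_isConvolution
    (hB : FourierLebesgueConvEmbeds d B p₁ p₂ p₃ r₁ r₂ r₃) (hp₁ : 1 ≤ p₁) (hp₂ : 1 ≤ p₂)
    (hp₃ : 1 ≤ p₃) (hψ_int : ∫ x, ψ x = 1) (hR : 0 < R)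
    (hψ : Function.support ψ ⊆ Metric.closedBall 0 R)
    (hA : ∀ᵐ p : Rd d × Rd d, localNorm p₁ r₁ f₁ (translate p.1 ψ) < ∞ ∧
      localNorm p₂ r₂ f₂ (translate p.2 ψ) < ∞) {N : ℕ}
    (hfin : ∫⁻ p : Rd d × Rd d, weight (-(N : ℝ)) (p.1 + p.2) *
      (localNorm p₁ r₁ f₁ (translate p.1 ψ) * localNorm p₂ r₂ f₂ (translate p.2 ψ)) < ∞) :
    ∃ h : 𝓢'(Rd d, E₃), IsConvolution B f₁ f₂ h ∧ ∀ φ, h φ =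
      ∫ p : Rd d × Rd d, pairing B f₁ f₂ (translate p.1 ψ) (translate p.2 ψ) (𝓕⁻ φ) := by
  obtain ⟨m, C, hC⟩ := hB.exists_enorm_pairing_le hp₃ hR N
  have hmeas := stronglyMeasurable_pairing B f₁ f₂
    ((continuous_translate_left ψ).comp (continuous_fst (X := Rd d) (Y := Rd d)))
    ((continuous_translate_left ψ).comp continuous_snd)
  obtain ⟨H, hH⟩ := exists_clm_eq_integral (fun φ => (hmeas φ).aestronglyMeasurable) hfin
    fun φ => hA.mono fun p hp => hC f₁ f₂ _ _ φ p.1 p.2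
      (support_translate_subset_closedBall hψ p.1) (support_translate_subset_closedBall hψ p.2)
      hp.1 hp.2
  let H' : 𝓢'(Rd d, E₃) := H
  refine ⟨𝓕⁻ H', fun χ₁ χ₂ hχ₁ hχ₂ φ => ?_, fun φ => hH _⟩
  rw [FourierTransform.fourier_fourierInv_eq]
  exact hH φ ▸ hB.tendsto_pairing_dilate hp₁ hp₂ hp₃ hψ_int hR hψ hA hfin hχ₁ hχ₂ φ

end

lemma FourierLebesgueConvEmbeds.exists_localNorm_superposition_le
    (hB : FourierLebesgueConvEmbeds d B p₁ p₂ p₃ r₁ r₂ r₃) (hp₃ : 1 ≤ p₃) (hR : 0 < R)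
    (hψ : Function.support ψ ⊆ Metric.closedBall 0 R) (N : ℕ) (g : 𝓢(Rd d, ℂ)) :
    ∃ C : ℝ≥0, ∀ (f₁ : 𝓢(Rd d, ℂ) →L[ℂ] E₁) (f₂ : 𝓢(Rd d, ℂ) →L[ℂ] E₂)
      (h : 𝓢(Rd d, ℂ) →L[ℂ] E₃) (z : Rd d),
      (∀ᵐ p : Rd d × Rd d, localNorm p₁ r₁ f₁ (translate p.1 ψ) < ∞ ∧
        localNorm p₂ r₂ f₂ (translate p.2 ψ) < ∞) →
      (∀ φ, h φ = ∫ p : Rd d × Rd d,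
        pairing B f₁ f₂ (translate p.1 ψ) (translate p.2 ψ) (𝓕⁻ φ)) →
      localNorm p₃ r₃ h (translate z g) ≤ C * ∫⁻ p : Rd d × Rd d,
        weight (-(N : ℝ)) (z - (p.1 + p.2)) *
        (localNorm p₁ r₁ f₁ (translate p.1 ψ) * localNorm p₂ r₂ f₂ (translate p.2 ψ)) := by
  obtain ⟨M, hM⟩ := exists_nat_gt (d + |r₃|)
  obtain ⟨C₁, h₁⟩ := exists_enorm_pairing_charMul_translate_le (d := d) (E₁ := E₁) (E₂ := E₂)
    (E₃ := E₃) hR M N g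
  obtain ⟨C₂, h₂⟩ := exists_weightedLpNorm_superposition_le
    (volume : Measure (Rd d × Rd d)) hp₃ r₃ hM
  obtain ⟨C₃, h₃⟩ := hB.exists_prodSymbol_le
  have hsupport := support_translate_subset_closedBall hψ
  have hcompact := hasCompactSupport_translate hψ
  refine ⟨C₂ * (C₁ * C₃), fun f₁ f₂ h z hA hh => ?_⟩
  have hsymbol : Measurable (Function.uncurry fun (p : Rd d × Rd d) η =>
      ‖prodSymbol B f₁ f₂ (translate p.1 ψ) (translate p.2 ψ) η‖ₑ) :=
    (continuous_prodSymbol B f₁ f₂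
      ((continuous_translate_left ψ).comp (continuous_fst.comp continuous_fst))
      ((continuous_translate_left ψ).comp (continuous_snd.comp continuous_fst))
      continuous_snd).enorm.measurable
  have hweight : Measurable fun p : Rd d × Rd d => C₁ * weight (-(N : ℝ)) (z - (p.1 + p.2)) :=
    ((measurable_weight _).comp (by fun_prop)).const_mul _
  calc localNorm p₃ r₃ h (translate z g) ≤ weightedLpNorm p₃ r₃ fun ξ => ∫⁻ p : Rd d × Rd d,
        C₁ * weight (-(N : ℝ)) (z - (p.1 + p.2)) * ∫⁻ η, weight (-(M : ℝ)) (ξ - η) *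
          ‖prodSymbol B f₁ f₂ (translate p.1 ψ) (translate p.2 ψ) η‖ₑ := by
        refine weightedLpNorm_mono fun ξ => ?_
        rw [hh]
        exact (enorm_integral_le_lintegral_enorm _).trans (lintegral_mono fun p =>
          h₁ B f₁ f₂ _ _ p.1 p.2 z ξ (hsupport p.1) (hsupport p.2))
    _ ≤ C₂ * ∫⁻ p : Rd d × Rd d, C₁ * weight (-(N : ℝ)) (z - (p.1 + p.2)) * (C₃ *
        (localNorm p₁ r₁ f₁ (translate p.1 ψ) * localNorm p₂ r₂ f₂ (translate p.2 ψ))) :=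
        h₂ _ _ _ hsymbol hweight
          (fun p => ENNReal.mul_ne_top ENNReal.coe_ne_top (weight_ne_top _ _))
          (hA.mono fun p hp => h₃ f₁ f₂ _ _ (hcompact p.1) (hcompact p.2) hp.1 hp.2)
    _ = _ := by
        rw [ENNReal.coe_mul, mul_assoc, ← lintegral_const_mul' (C₁ * C₃ : ℝ≥0) _ ENNReal.coe_ne_top]
        congr 1
        exact lintegral_congr fun p => by push_cast; ring

theorem FourierLebesgueConvEmbeds.exists_isConvolution_weightedLpNorm_le
    {q₁ q₂ q₃ : ℝ≥0∞} {s₁ s₂ s₃ : ℝ} (hB : FourierLebesgueConvEmbeds d B p₁ p₂ p₃ r₁ r₂ r₃)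
    (hq : LebesgueConvEmbeds d q₁ q₂ q₃ s₁ s₂ s₃) (hp₁ : 1 ≤ p₁) (hp₂ : 1 ≤ p₂) (hp₃ : 1 ≤ p₃)
    (hq₁ : 1 ≤ q₁) (hq₂ : 1 ≤ q₂) (hq₃ : 1 ≤ q₃) (hψ_int : ∫ x, ψ x = 1) (hR : 0 < R)
    (hψ : Function.support ψ ⊆ Metric.closedBall 0 R) (g : 𝓢(Rd d, ℂ)) :
    ∃ C : ℝ≥0, ∀ (f₁ : 𝓢'(Rd d, E₁)) (f₂ : 𝓢'(Rd d, E₂)),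
      weightedLpNorm q₁ s₁ (fun x => localNorm p₁ r₁ f₁ (translate x ψ)) < ∞ →
      weightedLpNorm q₂ s₂ (fun x => localNorm p₂ r₂ f₂ (translate x ψ)) < ∞ →
      ∃ h : 𝓢'(Rd d, E₃), IsConvolution B f₁ f₂ h ∧
        weightedLpNorm q₃ s₃ (fun z => localNorm p₃ r₃ h (translate z g)) ≤
          C * (weightedLpNorm q₁ s₁ (fun x => localNorm p₁ r₁ f₁ (translate x ψ)) *
            weightedLpNorm q₂ s₂ (fun x => localNorm p₂ r₂ f₂ (translate x ψ))) := by
  obtain ⟨N, hN⟩ := exists_nat_gt (d + |s₃|)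
  obtain ⟨C₁, h₁⟩ := hB.exists_localNorm_superposition_le hp₃ hR hψ N g
  obtain ⟨C₂, h₂⟩ := hq.exists_lintegral_weight_sub_mul_le hq₁ hq₂ hq₃ hN
  refine ⟨C₁ * C₂, fun f₁ f₂ hfin₁ hfin₂ => ?_⟩
  have hA₁ := measurable_localNorm p₁ r₁ f₁ (continuous_translate_left ψ)
  have hA₂ := measurable_localNorm p₂ r₂ f₂ (continuous_translate_left ψ)
  have hA : ∀ᵐ p : Rd d × Rd d, localNorm p₁ r₁ f₁ (translate p.1 ψ) < ∞ ∧
      localNorm p₂ r₂ f₂ (translate p.2 ψ) < ∞ :=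
    (Measure.quasiMeasurePreserving_fst.ae
      (ae_lt_top_of_weightedLpNorm_lt_top hq₁ hA₁ hfin₁)).and
      (Measure.quasiMeasurePreserving_snd.ae
        (ae_lt_top_of_weightedLpNorm_lt_top hq₂ hA₂ hfin₂))
  obtain ⟨h, hconv, hh⟩ := hB.exists_isConvolution hp₁ hp₂ hp₃ hψ_int hR hψ hA
    (hq.lintegral_weight_add_mul_lt_top hq₁ hq₂ hq₃ (m := N)
      (by linarith [neg_abs_le s₃]) hA₁ hA₂ hfin₁ hfin₂)
  refine ⟨h, hconv, ?_⟩
  rw [ENNReal.coe_mul, mul_assoc]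
  exact (weightedLpNorm_mono fun z => h₁ f₁ f₂ h z hA hh).trans
    ((weightedLpNorm_const_mul_le q₃ s₃ _ ENNReal.coe_ne_top).trans
      (mul_le_mul_right (h₂ _ _ hA₁ hA₂ hfin₁ hfin₂) _))

end AmalgamConvolution

end WienerAmalgam

end

theorem mainTheorem9 (d : ℕ) {E₁ E₂ E₃ : Type*}
    [NormedAddCommGroup E₁] [NormedSpace ℂ E₁] [CompleteSpace E₁]
    [NormedAddCommGroup E₂] [NormedSpace ℂ E₂] [CompleteSpace E₂]
    [NormedAddCommGroup E₃] [NormedSpace ℂ E₃] [CompleteSpace E₃]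
    (B : E₁ →L[ℂ] E₂ →L[ℂ] E₃) (hB : ‖B‖ ≤ 1)
    (p₁ p₂ p₃ q₁ q₂ q₃ : ENNReal)
    (hp₁ : 1 ≤ p₁) (hp₂ : 1 ≤ p₂) (hp₃ : 1 ≤ p₃)
    (hq₁ : 1 ≤ q₁) (hq₂ : 1 ≤ q₂) (hq₃ : 1 ≤ q₃)
    (r₁ r₂ r₃ s₁ s₂ s₃ : ℝ)
    (hlocal : WienerAmalgam.FourierLebesgueConvEmbeds d B p₁ p₂ p₃ r₁ r₂ r₃)
    (hglobal : WienerAmalgam.LebesgueConvEmbeds d q₁ q₂ q₃ s₁ s₂ s₃) :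
    WienerAmalgam.AmalgamConvEmbeds d B p₁ p₂ p₃ q₁ q₂ q₃ r₁ r₂ r₃ s₁ s₂ s₃ := by
  intro g₁ g₂ g₃ hg₁ hg₂ hg₃
  obtain ⟨ψ, hψ_int, hψ⟩ := WienerAmalgam.exists_integral_eq_one_support_subset_closedBall d
  obtain ⟨C, hC⟩ := hlocal.exists_isConvolution_weightedLpNorm_le hglobal hp₁ hp₂ hp₃ hq₁ hq₂ hq₃
    hψ_int two_pos hψ (WienerAmalgam.conjSchwartz g₃)
  obtain ⟨C₁, hC₁⟩ := WienerAmalgam.exists_weightedLpNorm_localNorm_le_amalgamNorm (E := E₁)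
    hp₁ hq₁ r₁ s₁ hg₁ ψ
  obtain ⟨C₂, hC₂⟩ := WienerAmalgam.exists_weightedLpNorm_localNorm_le_amalgamNorm (E := E₂)
    hp₂ hq₂ r₂ s₂ hg₂ ψ
  refine ⟨C * (C₁ * C₂), fun f₁ f₂ hf₁ hf₂ => ?_⟩
  have hfin₁ := hf₁.weightedLpNorm_localNorm_lt_top hp₁ hq₁ ψ
  have hfin₂ := hf₂.weightedLpNorm_localNorm_lt_top hp₂ hq₂ ψ
  obtain ⟨h, hconv, hle⟩ := hC f₁ f₂ hfin₁ hfin₂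
  rw [← WienerAmalgam.amalgamNorm_eq] at hle
  refine ⟨h, hconv, ⟨g₃, hg₃, hle.trans_lt (ENNReal.mul_lt_top ENNReal.coe_lt_top
    (ENNReal.mul_lt_top hfin₁ hfin₂))⟩, hle.trans ?_⟩
  calc _ ≤ C * ((C₁ * WienerAmalgam.amalgamNorm p₁ q₁ r₁ s₁ g₁ f₁) *
        (C₂ * WienerAmalgam.amalgamNorm p₂ q₂ r₂ s₂ g₂ f₂)) := by
        gcongr
        exacts [hC₁ f₁, hC₂ f₂]
    _ = _ := by push_cast; ring
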